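/- **Theorem.** Let $M$ be a compact smooth Riemannian $n$-manifold (without boundary, possibly disconnected) with metric $g$ and volume measure $dV_g$, let $\Omega\subseteq M$ be open, let $\mu$ be a positive finite Borel measure on $M$ with $\operatorname{supp}(\mu)\subseteq\overline{\Omega}$ and $\mu(\Omega)>0$, and let $0\le k\le n$. Let $\Gamma_c^\infty(\bigwedge^k\Omega)$ be the smooth $k$-forms with compact support in $\Omega$, $d$ the exterior derivative, $d^*$ its $L^2(dV_g)$-adjoint ($d^*=0$ on $0$-forms), and $L^2(\bigwedge^k\Omega,\mu)$ the Hilbert space of classes of $\mu$-measurable $k$-forms on $\Omega$ with $\int_\Omega|\omega|^2\,d\mu<\infty$, with inner product $\langle\omega,\eta\rangle_\mu=\int_\Omega\langle\omega,\eta\rangle_g\,d\mu$. Assume the Poincaré inequality (PI): for a constant $C>0$, $$\int_\Omega|u|^2\,d\mu\le C\int_\Omega\big(|du|^2+|d^*u|^2\big)\,dV_g\qquad\text{for all }u\in\Gamma_c^\infty\big({\textstyle\bigwedge}^k\Omega\big).$$ Let $W^{1,2}_0(\bigwedge^k\Omega)$ be the closure of $\Gamma_c^\infty(\bigwedge^k\Omega)$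 in the Sobolev space $W^{1,2}(\bigwedge^k\Omega)$ of $L^2(dV_g)$-forms $u$ on $\Omega$ with weak $du,d^*u\in L^2(dV_g)$, with norm $\big(\int_\Omega(|u|^2+|du|^2+|d^*u|^2)\,dV_g\big)^{1/2}$. By (PI) there is a unique bounded linear map $\iota:W^{1,2}_0(\bigwedge^k\Omega)\to L^2(\bigwedge^k\Omega,\mu)$ that sends each $u\in\Gamma_c^\infty(\bigwedge^k\Omega)$ to its class. Put $\mathcal N_k=\ker\iota$, let $\mathcal N_k^\perp$ be its orthogonal complement in $W^{1,2}_0(\bigwedge^k\Omega)$, and let $\mathcal E(u,v)=\int_\Omega\big(\langle du,dv\rangle_g+\langle d^*u,d^*v\rangle_g\big)\,dV_g$ with domain $\operatorname{dom}(\mathcal E)=\iota(\mathcal N_k^\perp)$, which is identified with $\mathcal N_k^\perp$ through the injection $\iota|_{\mathcal N_k^\perp}$. The Kreĭn–Feller operator $\Delta_\mu^k$ is the operator in $L^2(\bigwedge^k\Omega,\mu)$ defined as follows: $u\in\operatorname{dom}(\Delta_\mu^k)$ and $\Delta_\mu^ku=f$ if and only if $u\in\operatorname{dom}(\mathcal E)$,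 $f\in L^2(\bigwedge^k\Omega,\mu)$ and $$\mathcal E(u,v)=\langle -f,v\rangle_\mu\qquad\text{for all }v\in\operatorname{dom}(\mathcal E).$$ Then for every $f\in L^2(\bigwedge^k\Omega,\mu)$ there is a unique $u\in\operatorname{dom}(\Delta_\mu^k)$ with $\Delta_\mu^ku=f$, and the inverse operator $$(\Delta_\mu^k)^{-1}:L^2\big({\textstyle\bigwedge}^k\Omega,\mu\big)\to\operatorname{dom}(\Delta_\mu^k)\subseteq L^2\big({\textstyle\bigwedge}^k\Omega,\mu\big),\qquad f\mapsto u,$$ is a bounded linear operator on $L^2(\bigwedge^k\Omega,\mu)$ of operator norm at most $C$. -/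

import Mathlib

open Set Filter Topology MeasureTheory Manifold Bundle
open scoped ContDiff ENNReal
noncomputable section
namespace KreinFeller

section Pointwise
variable {V : Type*} [NormedAddCommGroup V] [InnerProductSpace ℝ V] [FiniteDimensional ℝ V]
  {k : ℕ}

/-- The inner product on alternating `k`-forms on a Euclidean space `V` for which the products
`e^{i₁} ∧ ⋯ ∧ e^{iₖ}`, `i₁ < ⋯ < iₖ`, of an orthonormal coframe are orthonormal, that is
`∑_{i₁ < ⋯ < iₖ} θ(e_{i₁}, …, e_{iₖ}) η(e_{i₁}, …, e_{iₖ})`.  It is written as `1 / k!` times the sum over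
all multi-indices: those with a repetition contribute zero, and the `k!` orderings of a strictly
increasing one contribute equally. -/
def formInner (θ η : V [⋀^Fin k]→L[ℝ] ℝ) : ℝ :=
  (k.factorial : ℝ)⁻¹ * ∑ J : Fin k → Fin (Module.finrank ℝ V),
    θ (fun r => stdOrthonormalBasis ℝ V (J r)) * η (fun r => stdOrthonormalBasis ℝ V (J r))

theorem formInner_comm (θ η : V [⋀^Fin k]→L[ℝ] ℝ) : formInner θ η = formInner η θ := by
  simp only [formInner, mul_comm]

theorem formInner_add_left (θ₁ θ₂ η : V [⋀^Fin k]→L[ℝ] ℝ) :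
    formInner (θ₁ + θ₂) η = formInner θ₁ η + formInner θ₂ η := by
  simp only [formInner, ContinuousAlternatingMap.add_apply, add_mul, Finset.sum_add_distrib,
    mul_add]

theorem formInner_smul_left (c : ℝ) (θ η : V [⋀^Fin k]→L[ℝ] ℝ) :
    formInner (c • θ) η = c * formInner θ η := by
  simp only [formInner, ContinuousAlternatingMap.smul_apply, smul_eq_mul, mul_assoc,
    ← Finset.mul_sum]
  ring

theorem formInner_self_nonneg (θ : V [⋀^Fin k]→L[ℝ] ℝ) : 0 ≤ formInner θ θ :=
  mul_nonneg (by positivity) (Finset.sum_nonneg fun _ _ => mul_self_nonneg _)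

theorem abs_formInner_le (θ η : V [⋀^Fin k]→L[ℝ] ℝ) :
    |formInner θ η| ≤ formInner θ θ + formInner η η := by
  have h1 := formInner_self_nonneg (θ + η)
  have h2 := formInner_self_nonneg (θ + (-1 : ℝ) • η)
  have e1 := formInner_self_nonneg θ
  have e2 := formInner_self_nonneg η
  rw [formInner_add_left, formInner_comm θ, formInner_comm η, formInner_add_left,
    formInner_add_left, formInner_comm η θ] at h1
  rw [formInner_add_left, formInner_comm θ, formInner_comm (_ • η), formInner_add_left,
    formInner_add_left, formInner_comm θ (_ • η), formInner_smul_left, formInner_smul_left,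
    formInner_comm η (_ • η), formInner_smul_left, formInner_comm η θ] at h2
  rw [abs_le]
  constructor <;> linarith

/-- The inner product of forms through the coefficients in an arbitrary basis. -/
theorem formInner_eq_basis {ι : Type*} [Fintype ι] [DecidableEq ι] (b : Module.Basis ι ℝ V)
    (θ η : V [⋀^Fin k]→L[ℝ] ℝ) :
    formInner θ η = (k.factorial : ℝ)⁻¹ * ∑ i : Fin k → ι, ∑ j : Fin k → ι,
      (∏ r, (Matrix.of fun a c => inner ℝ (b a) (b c))⁻¹ (i r) (j r)) *
        (θ (fun r => b (i r)) * η (fun r => b (j r))) := by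
  set f := stdOrthonormalBasis ℝ V
  set Q : Matrix ι ι ℝ := Matrix.of fun a c => ∑ l, b.repr (f l) a * b.repr (f l) c with hQ
  have hQG : Q * (Matrix.of fun a c => inner ℝ (b a) (b c)) = 1 := by
    ext a c
    have h := congrArg (fun v => b.repr v a) (f.sum_repr (b c))
    simp only [map_sum, map_smul, Finsupp.coe_finsetSum, Finset.sum_apply,
      Finsupp.coe_smul, Pi.smul_apply, smul_eq_mul, Module.Basis.repr_self, f.repr_apply_apply] at h
    rw [Matrix.one_apply, Matrix.mul_apply]
    rw [Finsupp.single_apply] at h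
    simp only [eq_comm (a := c)] at h
    rw [← h]
    simp only [hQ, Matrix.of_apply, Finset.sum_mul]
    rw [Finset.sum_comm]
    refine Finset.sum_congr rfl fun l _ => ?_
    have h2 : inner ℝ (f l) (b c) = ∑ x, b.repr (f l) x * inner ℝ (b x) (b c) := by
      conv_lhs => rw [← b.sum_repr (f l)]
      simp only [sum_inner, real_inner_smul_left]
    rw [h2, Finset.sum_mul]
    exact Finset.sum_congr rfl fun x _ => by ring
  rw [Matrix.inv_eq_left_inv hQG]
  have hexp : ∀ (α : V [⋀^Fin k]→L[ℝ] ℝ) (J : Fin k → Fin (Module.finrank ℝ V)),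
      α (fun r => f (J r)) =
        ∑ i : Fin k → ι, (∏ r, b.repr (f (J r)) (i r)) * α (fun r => b (i r)) := by
    intro α J
    have : (fun r => f (J r)) = fun r => ∑ a, b.repr (f (J r)) a • b a := by
      funext r; exact (b.sum_repr _).symm
    rw [this]
    have h := (α.toMultilinearMap).map_sum (fun r a => b.repr (f (J r)) a • b a)
    refine h.trans (Finset.sum_congr rfl fun i _ => ?_)
    exact (α.toMultilinearMap).map_smul_univ (fun r => b.repr (f (J r)) (i r)) (fun r => b (i r))
  rw [formInner]
  congr 1
  have : ∀ i j : Fin k → ι, ∏ r, Q (i r) (j r) =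
      ∑ J : Fin k → Fin (Module.finrank ℝ V),
        (∏ r, b.repr (f (J r)) (i r)) * ∏ r, b.repr (f (J r)) (j r) := by
    intro i j
    simp only [hQ, Matrix.of_apply, Finset.prod_univ_sum, Fintype.piFinset_univ,
      Finset.prod_mul_distrib]
  simp only [this]
  calc _ = ∑ J : Fin k → Fin (Module.finrank ℝ V), ∑ i : Fin k → ι, ∑ j : Fin k → ι,
        (∏ r, b.repr (f (J r)) (i r)) * (∏ r, b.repr (f (J r)) (j r)) *
        (θ (fun r => b (i r)) * η (fun r => b (j r))) := by
        refine Finset.sum_congr rfl fun J _ => ?_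
        rw [hexp θ J, hexp η J, Finset.sum_mul_sum]
        exact Finset.sum_congr rfl fun i _ => Finset.sum_congr rfl fun j _ => by ring
    _ = _ := by
        rw [Finset.sum_comm]
        refine Finset.sum_congr rfl fun i _ => ?_
        rw [Finset.sum_comm]
        exact Finset.sum_congr rfl fun j _ => by rw [Finset.sum_mul]
end Pointwise

/-- A (not necessarily continuous) differential `k`-form on the `n`-manifold `M`. -/
abbrev Form (n : ℕ) (M : Type*) [TopologicalSpace M] [ChartedSpace (EuclideanSpace ℝ (Fin n)) M]
    (k : ℕ) : Type _ :=
  ∀ x : M, TangentSpace (𝓡 n) x [⋀^Fin k]→L[ℝ] ℝ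

section Defs
variable {n : ℕ} {M : Type*} [TopologicalSpace M] [ChartedSpace (EuclideanSpace ℝ (Fin n)) M]
  {k : ℕ}

/-- The expression of a `k`-form in the preferred chart at `x₀`: its pullback under the inverse
chart (only meaningful on the target of the chart). -/
def chartRep (x₀ : M) (θ : Form n M k) (y : EuclideanSpace ℝ (Fin n)) :
    EuclideanSpace ℝ (Fin n) [⋀^Fin k]→L[ℝ] ℝ :=
  (θ ((extChartAt (𝓡 n) x₀).symm y)).compContinuousLinearMap
    (mfderiv 𝓘(ℝ, EuclideanSpace ℝ (Fin n)) (𝓡 n) (extChartAt (𝓡 n) x₀).symm y)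

/-- A form is smooth when its expression in each chart of an atlas is. -/
def IsSmoothForm (θ : Form n M k) : Prop :=
  ∀ x₀ : M, ContDiffOn ℝ ∞ (chartRep x₀ θ) (extChartAt (𝓡 n) x₀).target

theorem chartRep_zero (x₀ : M) : chartRep x₀ (0 : Form n M k) = 0 := by
  ext; rfl

theorem chartRep_add (x₀ : M) (θ η : Form n M k) :
    chartRep x₀ (θ + η) = chartRep x₀ θ + chartRep x₀ η := by
  ext; rfl

theorem chartRep_smul (x₀ : M) (c : ℝ) (θ : Form n M k) :
    chartRep x₀ (c • θ) = c • chartRep x₀ θ := by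
  ext; rfl

variable (n) in
/-- The space of smooth `k`-forms on `M` whose support is compact and contained in `Ω`; this is the
space of compactly supported smooth `k`-forms on `Ω`, extended by zero. -/
def testForms (Ω : Set M) (k : ℕ) : Submodule ℝ (Form n M k) where
  carrier := {θ | IsSmoothForm θ ∧ IsCompact (closure {x | θ x ≠ 0}) ∧ closure {x | θ x ≠ 0} ⊆ Ω}
  zero_mem' := by
    refine ⟨fun x₀ => ?_, ?_⟩
    · rw [chartRep_zero]; exact contDiffOn_const
    · simp
  add_mem' := by
    rintro θ η ⟨h1, h2, h3⟩ ⟨h4, h5, h6⟩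
    have hsub : closure {x | (θ + η) x ≠ 0} ⊆ closure {x | θ x ≠ 0} ∪ closure {x | η x ≠ 0} := by
      rw [← closure_union]
      refine closure_mono fun x hx => ?_
      by_contra hc
      simp only [mem_union, mem_ofPred_eq, not_or, not_not] at hc
      exact hx (by rw [Pi.add_apply, hc.1, hc.2, add_zero])
    refine ⟨fun x₀ => ?_, (h2.union h5).of_isClosed_subset isClosed_closure hsub,
      hsub.trans (union_subset h3 h6)⟩
    rw [chartRep_add]; exact (h1 x₀).add (h4 x₀)
  smul_mem' := by
    rintro c θ ⟨h1, h2, h3⟩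
    have hsub : closure {x | (c • θ) x ≠ 0} ⊆ closure {x | θ x ≠ 0} :=
      closure_mono fun x hx h => hx (by rw [Pi.smul_apply, h, smul_zero])
    refine ⟨fun x₀ => ?_, h2.of_isClosed_subset isClosed_closure hsub, hsub.trans h3⟩
    rw [chartRep_smul]; exact (h1 x₀).const_smul c

/-- The exterior derivative of a (smooth) `k`-form; at `x` it is computed in the chart at `x`. -/
def extD (θ : Form n M k) : Form n M (k + 1) := fun x =>
  (extDeriv (chartRep x θ) (extChartAt (𝓡 n) x x)).compContinuousLinearMap
    (mfderiv (𝓡 n) 𝓘(ℝ, EuclideanSpace ℝ (Fin n)) (extChartAt (𝓡 n) x) x)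

/-- A `k`-form is measurable with respect to `ν` when its coefficients in every chart are
(almost everywhere equal to) measurable functions. -/
def IsMeasurableForm [MeasurableSpace M] (ν : Measure M) (θ : Form n M k) : Prop :=
  ∀ x₀ : M, AEStronglyMeasurable (fun p => chartRep x₀ θ (extChartAt (𝓡 n) x₀ p))
    (ν.restrict (chartAt (EuclideanSpace ℝ (Fin n)) x₀).source)

theorem isMeasurableForm_add [MeasurableSpace M] {ν : Measure M} {θ η : Form n M k}
    (hθ : IsMeasurableForm ν θ) (hη : IsMeasurableForm ν η) : IsMeasurableForm ν (θ + η) := by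
  intro x₀; rw [chartRep_add]; exact (hθ x₀).add (hη x₀)

theorem isMeasurableForm_smul [MeasurableSpace M] {ν : Measure M} {θ : Form n M k} (c : ℝ)
    (hθ : IsMeasurableForm ν θ) : IsMeasurableForm ν (c • θ) := by
  intro x₀; rw [chartRep_smul]; exact (hθ x₀).const_smul c

theorem mfderiv_symm_eq_symmL [IsManifold (𝓡 n) ∞ M] (x₀ : M) {y : EuclideanSpace ℝ (Fin n)}
    (hy : y ∈ (extChartAt (𝓡 n) x₀).target) :
    mfderiv 𝓘(ℝ, EuclideanSpace ℝ (Fin n)) (𝓡 n) (extChartAt (𝓡 n) x₀).symm y =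
      (trivializationAt (EuclideanSpace ℝ (Fin n)) (TangentSpace (𝓡 n)) x₀).symmL ℝ
        ((extChartAt (𝓡 n) x₀).symm y) := by
  have hs : (extChartAt (𝓡 n) x₀).symm y ∈ (chartAt (EuclideanSpace ℝ (Fin n)) x₀).source := by
    rw [← extChartAt_source (𝓡 n)]; exact (extChartAt (𝓡 n) x₀).map_target hy
  have h := TangentBundle.symmL_trivializationAt (𝕜 := ℝ) (I := 𝓡 n) hs
  rw [h, ModelWithCorners.range_eq_univ, mfderivWithin_univ, (extChartAt (𝓡 n) x₀).right_inv hy]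


variable [RiemannianBundle (fun x : M => TangentSpace (𝓡 n) x)]

instance instFiniteDimensionalTangent (x : M) : FiniteDimensional ℝ (TangentSpace (𝓡 n) x) :=
  inferInstanceAs (FiniteDimensional ℝ (EuclideanSpace ℝ (Fin n)))

/-- The matrix `g_{ij}` of the Riemannian metric in the coordinates of the chart at `x₀`. -/
def gram (x₀ : M) (y : EuclideanSpace ℝ (Fin n)) : Matrix (Fin n) (Fin n) ℝ :=
  Matrix.of fun i j => inner ℝ
    (mfderiv 𝓘(ℝ, EuclideanSpace ℝ (Fin n)) (𝓡 n) (extChartAt (𝓡 n) x₀).symm y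
      (EuclideanSpace.basisFun (Fin n) ℝ i))
    (mfderiv 𝓘(ℝ, EuclideanSpace ℝ (Fin n)) (𝓡 n) (extChartAt (𝓡 n) x₀).symm y
      (EuclideanSpace.basisFun (Fin n) ℝ j))


variable (n) in
/-- The measure `√(det g_{ij}) dx¹ ⋯ dxⁿ` of the chart at `x₀`, as a measure on `M`. -/
def chartVol [MeasurableSpace M] (x₀ : M) : Measure M :=
  ((volume.restrict (extChartAt (𝓡 n) x₀).target).withDensity
    fun y => ENNReal.ofReal (Real.sqrt (gram x₀ y).det)).map (extChartAt (𝓡 n) x₀).symm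

variable (n M) in
/-- The Riemannian volume measure `dV_g`.  The measures of the charts agree on overlaps, so their
supremum is the measure that restricts to each of them on the domain of the chart. -/
def riemVol [MeasurableSpace M] : Measure M := ⨆ x₀ : M, chartVol n x₀

open scoped Classical in
/-- The formal adjoint `d*` of `d` on smooth `(k+1)`-forms: the smooth form `ζ` such that
`⟨ζ, η⟩ = ⟨θ, dη⟩` in `L²` for all smooth `k`-forms `η` on (the compact manifold) `M`. -/
def adjD [MeasurableSpace M] (θ : Form n M (k + 1)) : Form n M k :=
  if h : ∃ ζ : Form n M k, IsSmoothForm ζ ∧ ∀ η : Form n M k, IsSmoothForm η →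
      ∫ x, formInner (ζ x) (η x) ∂(riemVol n M) = ∫ x, formInner (θ x) (extD η x) ∂(riemVol n M)
  then h.choose else 0

/-- The codifferential `d*` on smooth `k`-forms; it is zero on functions. -/
def coD [MeasurableSpace M] : ∀ {k : ℕ}, Form n M k → Form n M (k - 1)
  | 0, _ => 0
  | _ + 1, θ => adjD θ

variable [IsManifold (𝓡 n) ∞ M]
  [IsContMDiffRiemannianBundle (𝓡 n) ∞ (EuclideanSpace ℝ (Fin n))
    (fun x : M => TangentSpace (𝓡 n) x)]

instance instIsContinuousRiemannianBundleTangent :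
    IsContinuousRiemannianBundle (EuclideanSpace ℝ (Fin n))
      (fun x : M => TangentSpace (𝓡 n) x) := by
  obtain ⟨g, hg, h⟩ := IsContMDiffRiemannianBundle.exists_contMDiff (IB := 𝓡 n) (n := ∞)
    (F := EuclideanSpace ℝ (Fin n)) (E := fun x : M => TangentSpace (𝓡 n) x)
  exact ⟨g, hg.continuous, h⟩

theorem continuousOn_gram (x₀ : M) :
    ContinuousOn (fun p => gram x₀ (extChartAt (𝓡 n) x₀ p))
      (chartAt (EuclideanSpace ℝ (Fin n)) x₀).source := by
  refine continuousOn_pi.2 fun i => continuousOn_pi.2 fun j => ?_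
  set e := trivializationAt (EuclideanSpace ℝ (Fin n)) (TangentSpace (𝓡 n) (M := M)) x₀ with he
  have hbase : e.baseSet = (chartAt (EuclideanSpace ℝ (Fin n)) x₀).source := by
    rw [he, TangentBundle.trivializationAt_baseSet]
  set b := (EuclideanSpace.basisFun (Fin n) ℝ).toBasis with hb
  have hc : ∀ i, ContinuousOn (fun p => (⟨p, e.localFrame b i p⟩ :
      TotalSpace (EuclideanSpace ℝ (Fin n)) (TangentSpace (𝓡 n) (M := M)))) e.baseSet :=
    fun i => (e.contMDiffOn_localFrame_baseSet (I := 𝓡 n) 1 b i).continuousOn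
  have h2 : ContinuousOn (fun p => inner ℝ (e.localFrame b i p) (e.localFrame b j p))
      e.baseSet := (hc i).inner_bundle (hc j)
  rw [← hbase]
  refine h2.congr fun p hp => ?_
  have hp' : p ∈ (extChartAt (𝓡 n) x₀).source := by rw [extChartAt_source, ← hbase]; exact hp
  have key : ∀ q ∈ e.baseSet, ∀ a, e.localFrame b a q =
      e.symmL ℝ q (EuclideanSpace.basisFun (Fin n) ℝ a) := by
    intro q hq a
    rw [e.localFrame_apply_of_mem_baseSet b hq]
    simp [Bundle.Trivialization.basisAt, hb]
    exact (Bundle.Trivialization.symmL_apply (R := ℝ) e hq _).symm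
  have hpp : (extChartAt (𝓡 n) x₀).symm (extChartAt (𝓡 n) x₀ p) = p :=
    (extChartAt (𝓡 n) x₀).left_inv hp'
  have h3 : ∀ q ∈ e.baseSet, (extChartAt (𝓡 n) x₀).symm (extChartAt (𝓡 n) x₀ p) = q →
      gram x₀ (extChartAt (𝓡 n) x₀ p) i j =
      inner ℝ (e.localFrame b i q) (e.localFrame b j q) := by
    rintro q hq rfl
    rw [key _ hq, key _ hq, gram, Matrix.of_apply,
      mfderiv_symm_eq_symmL x₀ ((extChartAt (𝓡 n) x₀).map_source hp')]
    rfl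
  exact h3 p hp hpp

variable [CompactSpace M] [MeasurableSpace M] [BorelSpace M]

theorem aestronglyMeasurable_formInner {ν : Measure M} {θ η : Form n M k}
    (hθ : IsMeasurableForm ν θ) (hη : IsMeasurableForm ν η) :
    AEStronglyMeasurable (fun x => formInner (θ x) (η x)) ν := by
  obtain ⟨t, -, ht⟩ := isCompact_univ.elim_nhds_subcover
    (fun x : M => (chartAt (EuclideanSpace ℝ (Fin n)) x).source)
    (fun x _ => chart_source_mem_nhds _ x)
  rw [← Measure.restrict_univ (μ := ν)]
  have hcov : (univ : Set M) =
      ⋃ x : t, (chartAt (EuclideanSpace ℝ (Fin n)) (x : M)).source := by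
    refine (Set.eq_univ_of_univ_subset ?_).symm
    simpa [Set.iUnion_subtype] using ht
  rw [hcov, aestronglyMeasurable_iUnion_iff]
  rintro ⟨x₀, -⟩
  set S := (chartAt (EuclideanSpace ℝ (Fin n)) x₀).source with hS
  have hSm : MeasurableSet S := (chartAt (EuclideanSpace ℝ (Fin n)) x₀).open_source.measurableSet
  have hsc : SecondCountableTopology (Matrix (Fin n) (Fin n) ℝ) :=
    inferInstanceAs (SecondCountableTopology (Fin n → Fin n → ℝ))
  have hG := (continuousOn_gram (n := n) x₀).aestronglyMeasurable (μ := ν) hSm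
  have hev : ∀ (i : Fin k → Fin n) {α : Form n M k}, IsMeasurableForm ν α →
      AEStronglyMeasurable (fun p => chartRep x₀ α (extChartAt (𝓡 n) x₀ p)
        (fun r => EuclideanSpace.basisFun (Fin n) ℝ (i r))) (ν.restrict S) := by
    intro i α hα
    have hcont : Continuous (fun β : EuclideanSpace ℝ (Fin n) [⋀^Fin k]→L[ℝ] ℝ =>
        β (fun r => EuclideanSpace.basisFun (Fin n) ℝ (i r))) := by fun_prop
    exact hcont.comp_aestronglyMeasurable (hα x₀)
  have hGi : ∀ a c : Fin n, AEStronglyMeasurable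
      (fun p => (gram x₀ (extChartAt (𝓡 n) x₀ p))⁻¹ a c) (ν.restrict S) := by
    intro a c
    simp only [Matrix.inv_def, Ring.inverse_eq_inv', Matrix.smul_apply, smul_eq_mul]
    have h1 : Continuous fun A : Matrix (Fin n) (Fin n) ℝ => A.det := continuous_id.matrix_det
    have h2 : Continuous fun A : Matrix (Fin n) (Fin n) ℝ => A.adjugate a c :=
      (continuous_id.matrix_adjugate).matrix_elem a c
    exact ((h1.comp_aestronglyMeasurable hG).inv₀).mul (h2.comp_aestronglyMeasurable hG)
  have hmeas : AEStronglyMeasurable (fun p => (k.factorial : ℝ)⁻¹ *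
      ∑ i : Fin k → Fin n, ∑ j : Fin k → Fin n,
      (∏ r, (gram x₀ (extChartAt (𝓡 n) x₀ p))⁻¹ (i r) (j r)) *
        (chartRep x₀ θ (extChartAt (𝓡 n) x₀ p)
            (fun r => EuclideanSpace.basisFun (Fin n) ℝ (i r)) *
          chartRep x₀ η (extChartAt (𝓡 n) x₀ p)
            (fun r => EuclideanSpace.basisFun (Fin n) ℝ (j r)))) (ν.restrict S) := by
    refine AEStronglyMeasurable.const_mul (Finset.aestronglyMeasurable_fun_sum _ fun i _ =>
      Finset.aestronglyMeasurable_fun_sum _ fun j _ => ?_) _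
    exact (Finset.aestronglyMeasurable_fun_prod _ fun r _ => hGi _ _).mul
      ((hev i hθ).mul (hev j hη))
  refine hmeas.congr (ae_restrict_of_forall_mem hSm fun p hp => ?_)
  have hp' : p ∈ (extChartAt (𝓡 n) x₀).source := by rw [extChartAt_source]; exact hp
  have hy := (extChartAt (𝓡 n) x₀).map_source hp'
  have hpp : (extChartAt (𝓡 n) x₀).symm (extChartAt (𝓡 n) x₀ p) = p :=
    (extChartAt (𝓡 n) x₀).left_inv hp'
  have hinv : (mfderiv 𝓘(ℝ, EuclideanSpace ℝ (Fin n)) (𝓡 n) (extChartAt (𝓡 n) x₀).symm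
      (extChartAt (𝓡 n) x₀ p)).IsInvertible := by
    have := isInvertible_mfderivWithin_extChartAt_symm (𝕜 := ℝ) (I := 𝓡 n) hy
    rwa [ModelWithCorners.range_eq_univ, mfderivWithin_univ] at this
  obtain ⟨L, hL⟩ := hinv
  have h4 : formInner (θ ((extChartAt (𝓡 n) x₀).symm (extChartAt (𝓡 n) x₀ p)))
      (η ((extChartAt (𝓡 n) x₀).symm (extChartAt (𝓡 n) x₀ p))) =
      formInner (θ p) (η p) := by rw [hpp]
  change _ = formInner (θ p) (η p)
  rw [← h4, formInner_eq_basis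
    ((EuclideanSpace.basisFun (Fin n) ℝ).toBasis.map L.toLinearEquiv)]
  have hLe : ∀ a, ((EuclideanSpace.basisFun (Fin n) ℝ).toBasis.map L.toLinearEquiv) a =
      mfderiv 𝓘(ℝ, EuclideanSpace ℝ (Fin n)) (𝓡 n) (extChartAt (𝓡 n) x₀).symm
      (extChartAt (𝓡 n) x₀ p) (EuclideanSpace.basisFun (Fin n) ℝ a) := by
    intro a
    rw [← hL, ← OrthonormalBasis.coe_toBasis]
    exact Module.Basis.map_apply _ _ _
  simp only [hLe]
  rfl


variable (n) in
/-- The `ν`-measurable `k`-forms `θ` with `∫ |θ|² dν < ∞`. -/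
def sqIntegrable (ν : Measure M) (k : ℕ) : Submodule ℝ (Form n M k) where
  carrier := {θ | IsMeasurableForm ν θ ∧ Integrable (fun x => formInner (θ x) (θ x)) ν}
  zero_mem' := by
    refine ⟨fun x₀ => ?_, ?_⟩
    · rw [chartRep_zero]; exact aestronglyMeasurable_const
    · have : ∀ x : M, formInner ((0 : Form n M k) x) ((0 : Form n M k) x) = 0 := fun x => by
        simp [formInner]
      simp only [this]
      exact integrable_zero _ _ _
  add_mem' := by
    rintro θ η ⟨h1, h2⟩ ⟨h3, h4⟩
    have hm : IsMeasurableForm ν (θ + η) := isMeasurableForm_add h1 h3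
    refine ⟨hm, ((h2.add h4).const_mul 3).mono' (aestronglyMeasurable_formInner hm hm)
      (Eventually.of_forall fun x => ?_)⟩
    have := abs_formInner_le (θ x) (η x)
    rw [Real.norm_of_nonneg (formInner_self_nonneg _), Pi.add_apply, formInner_add_left,
      formInner_comm (θ x), formInner_comm (η x), formInner_add_left, formInner_add_left,
      formInner_comm (η x) (θ x)]
    have h5 := (abs_le.1 this).2
    have h6 := formInner_self_nonneg (θ x)
    have h7 := formInner_self_nonneg (η x)
    simp only [Pi.add_apply]
    linarith
  smul_mem' := by
    rintro c θ ⟨h1, h2⟩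
    refine ⟨isMeasurableForm_smul c h1, ?_⟩
    have : ∀ x : M, formInner ((c • θ) x) ((c • θ) x) = c * (c * formInner (θ x) (θ x)) :=
      fun x => by
        rw [Pi.smul_apply, formInner_smul_left, formInner_comm, formInner_smul_left]
    simp only [this]
    exact (h2.const_mul c).const_mul c

theorem integrable_formInner {ν : Measure M} {θ η : Form n M k} (hθ : θ ∈ sqIntegrable n ν k)
    (hη : η ∈ sqIntegrable n ν k) : Integrable (fun x => formInner (θ x) (η x)) ν :=
  (hθ.2.add hη.2).mono' (aestronglyMeasurable_formInner hθ.1 hη.1)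
    (Eventually.of_forall fun x => abs_formInner_le (θ x) (η x))

variable (n) in
/-- The space of square integrable forms, before passing to classes, as a type of its own. -/
def PreL2Form (ν : Measure M) (k : ℕ) : Type _ := sqIntegrable n ν k

instance instAddCommGroupPreL2Form (ν : Measure M) (k : ℕ) : AddCommGroup (PreL2Form n ν k) :=
  inferInstanceAs (AddCommGroup (sqIntegrable n ν k))

instance instModulePreL2Form (ν : Measure M) (k : ℕ) : Module ℝ (PreL2Form n ν k) :=
  inferInstanceAs (Module ℝ (sqIntegrable n ν k))

/-- The semi-inner product `∫ ⟨θ, η⟩ dν`. -/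
@[reducible] def preL2Core (ν : Measure M) (k : ℕ) : PreInnerProductSpace.Core ℝ (PreL2Form n ν k) where
  inner θ η := ∫ x, formInner (θ.1 x) (η.1 x) ∂ν
  conj_inner_symm θ η := by
    simp only [conj_trivial]
    exact integral_congr_ae (Eventually.of_forall fun x => formInner_comm _ _)
  re_inner_nonneg θ := integral_nonneg fun x => formInner_self_nonneg _
  add_left θ₁ θ₂ η := by
    rw [← integral_add (integrable_formInner θ₁.2 η.2) (integrable_formInner θ₂.2 η.2)]
    exact integral_congr_ae (Eventually.of_forall fun x => formInner_add_left _ _ _)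
  smul_left θ η c := by
    simp only [conj_trivial]
    rw [← integral_const_mul]
    exact integral_congr_ae (Eventually.of_forall fun x => formInner_smul_left _ _ _)

instance instSeminormedPreL2Form (ν : Measure M) (k : ℕ) :
    SeminormedAddCommGroup (PreL2Form n ν k) :=
  letI := preL2Core (n := n) ν k
  InnerProductSpace.Core.toSeminormedAddCommGroup (𝕜 := ℝ)

instance instInnerProductSpacePreL2Form (ν : Measure M) (k : ℕ) :
    InnerProductSpace ℝ (PreL2Form n ν k) :=
  InnerProductSpace.ofCore (preL2Core ν k)

variable (n) in
/-- The space `L²(⋀ᵏ, ν)` of classes of square integrable `k`-forms modulo forms with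
`∫ |θ|² dν = 0`, with the inner product `∫ ⟨θ, η⟩ dν`. -/
abbrev L2Form (ν : Measure M) (k : ℕ) : Type _ := SeparationQuotient (PreL2Form n ν k)

/-- A square integrable form as an element of `PreL2Form`. -/
def toPreL2 {ν : Measure M} (θ : Form n M k) (h : θ ∈ sqIntegrable n ν k) : PreL2Form n ν k :=
  ⟨θ, h⟩

/-- The form `θ` is square integrable and `a` is its class in `L²`. -/
def IsClassOf {ν : Measure M} (θ : Form n M k) (a : L2Form n ν k) : Prop :=
  ∃ h : θ ∈ sqIntegrable n ν k, (SeparationQuotient.mk (toPreL2 θ h) : L2Form n ν k) = a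

theorem IsClassOf.zero (ν : Measure M) : IsClassOf (0 : Form n M k) (0 : L2Form n ν k) :=
  ⟨zero_mem _, rfl⟩

theorem IsClassOf.add {ν : Measure M} {θ η : Form n M k} {a b : L2Form n ν k}
    (h1 : IsClassOf θ a) (h2 : IsClassOf η b) : IsClassOf (θ + η) (a + b) := by
  obtain ⟨h1, rfl⟩ := h1
  obtain ⟨h2, rfl⟩ := h2
  exact ⟨add_mem h1 h2, rfl⟩

theorem IsClassOf.smul {ν : Measure M} {θ : Form n M k} {a : L2Form n ν k} (c : ℝ)
    (h1 : IsClassOf θ a) : IsClassOf (c • θ) (c • a) := by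
  obtain ⟨h1, rfl⟩ := h1
  exact ⟨Submodule.smul_mem _ c h1, rfl⟩

variable (n) in
/-- Triples of `L²`-forms on `Ω` of degrees `k`, `k + 1`, `k - 1`, with the Hilbert sum inner product.
A Sobolev form `u` is recorded as the triple `(u, du, d*u)`, so that the inner product is
`⟨u, v⟩ + ⟨du, dv⟩ + ⟨d*u, d*v⟩`. -/
abbrev SobolevAmbient (Ω : Set M) (k : ℕ) : Type _ :=
  WithLp 2 (L2Form n ((riemVol n M).restrict Ω) k ×
    WithLp 2 (L2Form n ((riemVol n M).restrict Ω) (k + 1) ×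
      L2Form n ((riemVol n M).restrict Ω) (k - 1)))

/-- `a` is the weak exterior derivative of `u` on `Ω`: `⟨a, φ⟩ = ⟨u, d*φ⟩` for all test forms `φ`. -/
def IsWeakD {Ω : Set M} (u : L2Form n ((riemVol n M).restrict Ω) k)
    (a : L2Form n ((riemVol n M).restrict Ω) (k + 1)) : Prop :=
  ∀ φ ∈ testForms n Ω (k + 1), ∀ (p : L2Form n ((riemVol n M).restrict Ω) (k + 1))
    (q : L2Form n ((riemVol n M).restrict Ω) k),
    IsClassOf φ p → IsClassOf (adjD φ) q → inner ℝ a p = inner ℝ u q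

/-- `b` is the weak codifferential of `u` on `Ω`: `⟨b, φ⟩ = ⟨u, dφ⟩` for all test forms `φ`; for
`0`-forms, `d*u = 0`. -/
def IsWeakCoD {Ω : Set M} : ∀ {k : ℕ}, L2Form n ((riemVol n M).restrict Ω) k →
    L2Form n ((riemVol n M).restrict Ω) (k - 1) → Prop
  | 0, _, b => b = 0
  | k + 1, u, b => ∀ φ ∈ testForms n Ω k, ∀ (p : L2Form n ((riemVol n M).restrict Ω) k)
      (q : L2Form n ((riemVol n M).restrict Ω) (k + 1)),
      IsClassOf φ p → IsClassOf (extD φ) q →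
        inner ℝ (show L2Form n ((riemVol n M).restrict Ω) k from b) p = inner ℝ u q

variable (n) in
/-- The Sobolev space `W^{1,2}(⋀ᵏ Ω)` of `L²`-forms with weak `du` and `d*u` in `L²`, as the space of
triples `(u, du, d*u)`. -/
def sobolev (Ω : Set M) (k : ℕ) : Submodule ℝ (SobolevAmbient n Ω k) where
  carrier := {w | IsWeakD w.fst w.snd.fst ∧ IsWeakCoD w.fst w.snd.snd}
  zero_mem' := by
    refine ⟨fun φ _ p q _ _ => ?_, ?_⟩
    · simp only [WithLp.zero_fst, WithLp.zero_snd, inner_zero_left]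
    · cases k with
      | zero => rfl
      | succ k => intro φ _ p q _ _; exact (inner_zero_left p).trans (inner_zero_left q).symm
  add_mem' := by
    rintro w v ⟨h1, h2⟩ ⟨h3, h4⟩
    refine ⟨fun φ hφ p q hp hq => ?_, ?_⟩
    · simp only [WithLp.add_fst, WithLp.add_snd, inner_add_left, h1 φ hφ p q hp hq,
        h3 φ hφ p q hp hq]
    · cases k with
      | zero =>
        change w.snd.snd + v.snd.snd = 0
        rw [show w.snd.snd = 0 from h2, show v.snd.snd = 0 from h4, add_zero]
      | succ k =>
        intro φ hφ p q hp hq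
        refine (inner_add_left _ _ p).trans (Eq.trans ?_ (inner_add_left _ _ q).symm)
        exact congrArg₂ _ (h2 φ hφ p q hp hq) (h4 φ hφ p q hp hq)
  smul_mem' := by
    rintro c w ⟨h1, h2⟩
    refine ⟨fun φ hφ p q hp hq => ?_, ?_⟩
    · simp only [WithLp.smul_fst, WithLp.smul_snd, real_inner_smul_left, h1 φ hφ p q hp hq]
    · cases k with
      | zero =>
        change c • w.snd.snd = 0
        rw [show w.snd.snd = 0 from h2, smul_zero]
      | succ k =>
        intro φ hφ p q hp hq
        refine (real_inner_smul_left _ p c).trans (Eq.trans ?_ (real_inner_smul_left _ q c).symm)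
        exact congrArg _ (h2 φ hφ p q hp hq)

variable (n) in
/-- The test forms inside `W^{1,2}(⋀ᵏ Ω)`. -/
def sobolevTest (Ω : Set M) (k : ℕ) : Submodule ℝ (SobolevAmbient n Ω k) where
  carrier := {w | w ∈ sobolev n Ω k ∧ ∃ φ ∈ testForms n Ω k, IsClassOf φ w.fst}
  zero_mem' := ⟨zero_mem _, 0, zero_mem _, IsClassOf.zero _⟩
  add_mem' := by
    rintro w v ⟨h1, φ, hφ, h2⟩ ⟨h3, ψ, hψ, h4⟩
    exact ⟨add_mem h1 h3, φ + ψ, add_mem hφ hψ, h2.add h4⟩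
  smul_mem' := by
    rintro c w ⟨h1, φ, hφ, h2⟩
    exact ⟨Submodule.smul_mem _ c h1, c • φ, Submodule.smul_mem _ c hφ, h2.smul c⟩

variable (n) in
/-- `W^{1,2}_0(⋀ᵏ Ω)`: the closure of the test forms in the `W^{1,2}` norm. -/
def sobolevZero (Ω : Set M) (k : ℕ) : Submodule ℝ (SobolevAmbient n Ω k) :=
  (sobolevTest n Ω k).topologicalClosure

variable (n) in
/-- The Poincaré inequality (PI) for `μ` with constant `C`:
`∫_Ω |u|² dμ ≤ C ∫_Ω (|du|² + |d*u|²) dV_g` for all smooth compactly supported `k`-forms `u` on `Ω`. -/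
def PoincareInequality (μ : Measure M) (Ω : Set M) (k : ℕ) (C : ℝ) : Prop :=
  ∀ u ∈ testForms n Ω k,
    ∫ x in Ω, formInner (u x) (u x) ∂μ ≤
      C * ∫ x in Ω, (formInner (extD u x) (extD u x) + formInner (coD u x) (coD u x))
        ∂(riemVol n M)

variable (n) in
/-- The pairs formed by a test form as an element of `W^{1,2}(⋀ᵏ Ω)` and as an element of
`L²(⋀ᵏ Ω, μ)`. -/
def testGraph (μ : Measure M) (Ω : Set M) (k : ℕ) :
    Submodule ℝ (SobolevAmbient n Ω k × L2Form n (μ.restrict Ω) k) where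
  carrier := {z | z.1 ∈ sobolev n Ω k ∧
    ∃ φ ∈ testForms n Ω k, IsClassOf φ z.1.fst ∧ IsClassOf φ z.2}
  zero_mem' := ⟨zero_mem _, 0, zero_mem _, IsClassOf.zero _, IsClassOf.zero _⟩
  add_mem' := by
    rintro w v ⟨h1, φ, hφ, h2, h3⟩ ⟨h4, ψ, hψ, h5, h6⟩
    exact ⟨add_mem h1 h4, φ + ψ, add_mem hφ hψ, h2.add h5, h3.add h6⟩
  smul_mem' := by
    rintro c w ⟨h1, φ, hφ, h2, h3⟩
    exact ⟨Submodule.smul_mem _ c h1, c • φ, Submodule.smul_mem _ c hφ, h2.smul c, h3.smul c⟩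

variable (n) in
/-- The relation "`a` is the `L²(⋀ᵏ Ω, μ)`-representative of `w`", for `w` in `W^{1,2}_0`: some sequence
of test forms converges to `w` in `W^{1,2}` and to `a` in `L²(⋀ᵏ Ω, μ)`.  Under (PI) it is the graph of
the bounded map `ι`. -/
def iotaGraph (μ : Measure M) (Ω : Set M) (k : ℕ) :
    Submodule ℝ (SobolevAmbient n Ω k × L2Form n (μ.restrict Ω) k) :=
  (testGraph n μ Ω k).topologicalClosure

variable (n) in
/-- The kernel of `ι`: the elements of `W^{1,2}_0` whose representative in `L²(⋀ᵏ Ω, μ)` is zero. -/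
def nullSpace (μ : Measure M) (Ω : Set M) (k : ℕ) : Submodule ℝ (SobolevAmbient n Ω k) :=
  sobolevZero n Ω k ⊓ (iotaGraph n μ Ω k).comap (LinearMap.inl ℝ _ _)

variable (n) in
/-- The orthogonal complement of the kernel of `ι` in `W^{1,2}_0`.  The domain of the form `𝓔` is its
image under `ι`. -/
def nullSpacePerp (μ : Measure M) (Ω : Set M) (k : ℕ) : Submodule ℝ (SobolevAmbient n Ω k) :=
  sobolevZero n Ω k ⊓ (nullSpace n μ Ω k)ᗮ

/-- `𝓔(w, v) = ∫_Ω (⟨dw, dv⟩ + ⟨d*w, d*v⟩) dV_g`. -/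
def energy {Ω : Set M} (w v : SobolevAmbient n Ω k) : ℝ :=
  inner ℝ w.snd.fst v.snd.fst + inner ℝ w.snd.snd v.snd.snd

variable (n) in
/-- The graph of the Kreĭn-Feller operator `Δ_μ^k`: the pairs `(u, f)` with `u` in the domain of `𝓔` and
`𝓔(u, v) = ⟨-f, v⟩_μ` for all `v` in the domain of `𝓔`. -/
def laplacianGraph (μ : Measure M) (Ω : Set M) (k : ℕ) :
    Submodule ℝ (L2Form n (μ.restrict Ω) k × L2Form n (μ.restrict Ω) k) where
  carrier := {z | ∃ w ∈ nullSpacePerp n μ Ω k, (w, z.1) ∈ iotaGraph n μ Ω k ∧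
    ∀ v ∈ nullSpacePerp n μ Ω k, ∀ v' : L2Form n (μ.restrict Ω) k,
      (v, v') ∈ iotaGraph n μ Ω k → energy w v = inner ℝ (-z.2) v'}
  zero_mem' := ⟨0, zero_mem _, zero_mem _, fun v _ v' _ => by simp [energy]⟩
  add_mem' := by
    rintro z y ⟨w, hw, h1, h2⟩ ⟨v, hv, h3, h4⟩
    refine ⟨w + v, add_mem hw hv, add_mem h1 h3, fun t ht t' htt' => ?_⟩
    have e1 := h2 t ht t' htt'
    have e2 := h4 t ht t' htt'
    simp only [energy, WithLp.add_fst, WithLp.add_snd, inner_add_left, Prod.snd_add, neg_add]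
      at e1 e2 ⊢
    linarith
  smul_mem' := by
    rintro c z ⟨w, hw, h1, h2⟩
    refine ⟨c • w, Submodule.smul_mem _ c hw, Submodule.smul_mem _ c h1, fun t ht t' htt' => ?_⟩
    have e1 := h2 t ht t' htt'
    simp only [energy, WithLp.smul_fst, WithLp.smul_snd, real_inner_smul_left, Prod.smul_snd,
      inner_neg_left] at e1 ⊢
    rw [← mul_add, e1]; ring

variable (n) in
/-- The Kreĭn-Feller operator `Δ_μ^k` as a partially defined operator on `L²(⋀ᵏ Ω, μ)`. -/
def laplacian (μ : Measure M) (Ω : Set M) (k : ℕ) :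
    L2Form n (μ.restrict Ω) k →ₗ.[ℝ] L2Form n (μ.restrict Ω) k :=
  (laplacianGraph n μ Ω k).toLinearPMap

end Defs
end KreinFeller
end

open KreinFeller

open Set Filter Topology MeasureTheory Manifold Bundle
open scoped ContDiff ENNReal
set_option linter.unusedSectionVars false

/-! The operator is inverted by the Lax–Milgram theorem. An element of the ambient Sobolev space is
a triple `(u, du, d*u)`, and `energy` is the inner product of the last two components. The Poincaré
inequality passes to closures (`PoincareInequality.norm_sq_le_of_iotaGraph`): `‖a‖² ≤ C 𝓔(w, w)`
whenever `(w, a)` lies in `iotaGraph`. Hence ι is single-valued, bounded, and defined on all of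
$W^{1,2}_0$. If 𝓔 is coercive on the orthogonal complement of ker ι for the full Sobolev norm, then
some `w` in this complement satisfies 𝓔(w, v) = ⟨-f, ιv⟩ for all `v`, and u = ιw solves the
equation. The norm bound is ‖u‖² ≤ C 𝓔(w, w) = C ⟨-f, u⟩ ≤ C ‖f‖ ‖u‖, which also gives uniqueness.
That the graph is that of an operator follows from the density of dom 𝓔 in L²(μ)
(`eq_zero_of_inner_nullSpacePerp`).

Coercivity is the analytic core, because (PI) bounds the L²(μ)-norm by the energy and says nothing
direct about the L²(dV)-norm. Zero energy forces ιw = 0 by (PI), so `w` is in ker ι and orthogonal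
to it, hence zero. A compactness argument (`exists_le_mul_norm_of_injective`) turns this injectivity
into a lower bound once the Sobolev norm is controlled by the energy up to finitely many bounded
functionals, which is `exists_norm_sq_le`.

That estimate combines two local facts. The first is Gaffney's inequality (`exists_gradient_bound`):
near a point all first derivatives of the coefficients of a cut-off form are controlled in L² by the
form, its `d` and its `d*`. In a flat space this is an identity obtained from two integrations by
parts (`integral_gaffney`). For the metric, no coordinate formula for `d*` is used: the adjoint
relation is tested against the Euclidean divergence of the localized form itself, in a basis
orthonormal at the centre, and the deviation of the coefficients from constants is absorbed
(`integral_sq_fderiv_le`). The second is Rellich's theorem in quantitative form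
(`exists_finite_averages`): on small cubes a function differs from its averages by a small multiple
of its gradient, and the averages are the finitely many functionals.

The supporting facts are that `d*` exists on smooth forms (`exists_adjoint`), so that the definition
of `adjD` by choice has content; that test forms are total in L² (`eq_zero_of_inner_framePair`), so
that weak derivatives are unique and those of a test form are the classical ones; and that the
spaces of square integrable forms are complete (`completeSpace_preL2Form`). -/

namespace KreinFeller

/-! ### Pointwise linear algebra of alternating forms. -/

section Algebra
variable {V : Type*} [NormedAddCommGroup V] [InnerProductSpace ℝ V] [FiniteDimensional ℝ V]
  {k : ℕ}

/-- The wedge product of the covectors dual to `w 0, …, w (k - 1)`. -/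
noncomputable def flatWedge (w : Fin k → V) : V [⋀^Fin k]→L[ℝ] ℝ :=
  { (Matrix.detRowAlternating (n := Fin k) (R := ℝ)).compLinearMap
      (LinearMap.pi fun b => (innerₛₗ ℝ (w b))) with
    cont := by
      change Continuous fun v : Fin k → V => Matrix.det (Matrix.of fun a b => inner ℝ (w b) (v a))
      refine Continuous.matrix_det (continuous_pi fun a => continuous_pi fun b => ?_)
      exact continuous_const.inner (continuous_apply a) }

theorem flatWedge_apply (w v : Fin k → V) :
    flatWedge w v = Matrix.det (Matrix.of fun a b => inner ℝ (v a) (w b)) := by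
  have : flatWedge w v = Matrix.det (Matrix.of fun a b => inner ℝ (w b) (v a)) := rfl
  rw [this]
  simp only [real_inner_comm]

/-- `flatWedge w` is the Riesz representative of evaluation at `w`. The Leibniz expansion of the
determinant gives one sum for each permutation σ; reindexing the multi-index by σ and using that `β`
alternates cancels the sign, so all `k!` sums equal `β w`, and the factor `1 / k!` in `formInner`
removes the multiplicity. -/
theorem formInner_flatWedge (w : Fin k → V) (β : V [⋀^Fin k]→L[ℝ] ℝ) :
    formInner (flatWedge w) β = β w := by
  set f := stdOrthonormalBasis ℝ V
  have hexp : β w = ∑ J : Fin k → Fin (Module.finrank ℝ V),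
      (∏ r, inner ℝ (f (J r)) (w r)) * β (fun r => f (J r)) := by
    have h1 : w = fun r => ∑ a, inner ℝ (f a) (w r) • f a := by
      funext r; exact (f.sum_repr' (w r)).symm
    conv_lhs => rw [h1]
    refine ((β.toMultilinearMap).map_sum (fun r a => inner ℝ (f a) (w r) • f a)).trans
      (Finset.sum_congr rfl fun i _ => ?_)
    exact (β.toMultilinearMap).map_smul_univ _ _
  have hperm : ∀ σ : Equiv.Perm (Fin k), ∑ J : Fin k → Fin (Module.finrank ℝ V),
      ((Equiv.Perm.sign σ : ℤ) : ℝ) * (∏ r, inner ℝ (f (J (σ r))) (w r)) *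
        β (fun r => f (J r)) = β w := by
    intro σ
    rw [hexp]
    refine Eq.trans ?_
      (Equiv.sum_comp (Equiv.arrowCongr σ⁻¹ (Equiv.refl (Fin (Module.finrank ℝ V)))) _)
    refine Finset.sum_congr rfl fun J _ => ?_
    have e1 : ∀ r, (Equiv.arrowCongr σ⁻¹ (Equiv.refl (Fin (Module.finrank ℝ V)))) J r
      = J (σ r) := fun r => rfl
    simp only [e1]
    have h2 := β.toAlternatingMap.map_perm (fun r => f (J r)) σ
    have h3 : β (fun r => f (J (σ r))) =
      ((Equiv.Perm.sign σ : ℤ) : ℝ) * β (fun r => f (J r)) := by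
      refine h2.trans ?_
      rw [Units.smul_def, zsmul_eq_mul]; rfl
    rw [h3]; ring
  have hcard : ∑ σ : Equiv.Perm (Fin k), β w = (k.factorial : ℝ) * β w := by
    rw [Finset.sum_const, Finset.card_univ, Fintype.card_perm, Fintype.card_fin, nsmul_eq_mul]
  rw [formInner]
  have h4 : ∑ J : Fin k → Fin (Module.finrank ℝ V),
      flatWedge w (fun r => f (J r)) * β (fun r => f (J r)) = (k.factorial : ℝ) * β w := by
    rw [← hcard, Finset.sum_congr rfl fun σ _ => (hperm σ).symm, Finset.sum_comm]
    refine Finset.sum_congr rfl fun J _ => ?_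
    rw [flatWedge_apply, Matrix.det_apply', Finset.sum_mul]
    rfl
  rw [h4, inv_mul_cancel_left₀ (by positivity)]

theorem formInner_add_right (η θ₁ θ₂ : V [⋀^Fin k]→L[ℝ] ℝ) :
    formInner η (θ₁ + θ₂) = formInner η θ₁ + formInner η θ₂ := by
  rw [formInner_comm, formInner_add_left, formInner_comm θ₁, formInner_comm θ₂]

theorem formInner_smul_right (c : ℝ) (θ η : V [⋀^Fin k]→L[ℝ] ℝ) :
    formInner η (c • θ) = c * formInner η θ := by
  rw [formInner_comm, formInner_smul_left, formInner_comm]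

theorem formInner_zero_left (η : V [⋀^Fin k]→L[ℝ] ℝ) : formInner 0 η = 0 := by
  simp [formInner]

theorem formInner_zero_right (η : V [⋀^Fin k]→L[ℝ] ℝ) : formInner η 0 = 0 := by
  simp [formInner]

theorem sq_formInner_le (θ η : V [⋀^Fin k]→L[ℝ] ℝ) :
    formInner θ η ^ 2 ≤ formInner θ θ * formInner η η := by
  have h : ∀ x : ℝ, 0 ≤ formInner η η * (x * x) + 2 * formInner θ η * x + formInner θ θ := by
    intro x
    have := formInner_self_nonneg (θ + x • η)
    rw [formInner_add_left, formInner_add_right, formInner_add_right, formInner_smul_left,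
      formInner_smul_right, formInner_smul_left, formInner_smul_right, formInner_comm η θ] at this
    linarith
  have := discrim_le_zero h
  rw [discrim] at this
  nlinarith

/-- Cauchy–Schwarz against `flatWedge w`, whose squared norm is the Gram determinant. This is how
single coefficients of a form are bounded by its pointwise norm. -/
theorem sq_apply_le (w : Fin k → V) (β : V [⋀^Fin k]→L[ℝ] ℝ) :
    β w ^ 2 ≤ Matrix.det (Matrix.of fun a b => inner ℝ (w a) (w b)) * formInner β β := by
  have := sq_formInner_le (flatWedge w) β
  rwa [formInner_flatWedge, formInner_flatWedge, flatWedge_apply] at this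

theorem formInner_sum_left {ι : Type*} (s : Finset ι) (θ : ι → V [⋀^Fin k]→L[ℝ] ℝ)
    (η : V [⋀^Fin k]→L[ℝ] ℝ) : formInner (∑ i ∈ s, θ i) η = ∑ i ∈ s, formInner (θ i) η := by
  classical
  induction s using Finset.induction_on with
  | empty => simp [formInner_zero_left]
  | insert a s ha ih => rw [Finset.sum_insert ha, Finset.sum_insert ha, formInner_add_left, ih]
end Algebra

/-! ### Smoothness of forms through their coefficients. -/

section Smoothness
variable {E F ι : Type*} [NormedAddCommGroup E] [NormedSpace ℝ E] [FiniteDimensional ℝ E]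
  [NormedAddCommGroup F] [NormedSpace ℝ F] {k : ℕ} [Fintype ι]

/-- Evaluation on basis vectors is injective on alternating forms, so it has a linear left inverse,
continuous because the coefficient space is finite-dimensional. Smoothness and convergence of forms
thereby reduce to those of the coefficients. -/
theorem exists_leftInverse_evalBasis (b : Module.Basis ι ℝ E) :
    ∃ G : ((Fin k → ι) → ℝ) →L[ℝ] (E [⋀^Fin k]→L[ℝ] ℝ),
      ∀ θ : E [⋀^Fin k]→L[ℝ] ℝ, G (fun J => θ (fun r => b (J r))) = θ := by
  let L : (E [⋀^Fin k]→L[ℝ] ℝ) →ₗ[ℝ] ((Fin k → ι) → ℝ) :=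
    { toFun := fun θ J => θ (fun r => b (J r))
      map_add' := fun _ _ => rfl
      map_smul' := fun _ _ => rfl }
  have hL : LinearMap.ker L = ⊥ := by
    rw [LinearMap.ker_eq_bot']
    intro θ hθ
    have : θ.toAlternatingMap = 0 := by
      refine b.ext_alternating fun v _ => ?_
      exact congrFun hθ v
    ext v
    exact congrArg (fun f : E [⋀^Fin k]→ₗ[ℝ] ℝ => f v) this
  obtain ⟨G, hG⟩ := LinearMap.exists_leftInverse_of_injective L hL
  exact ⟨LinearMap.toContinuousLinearMap G, fun θ => congrArg (fun f => f θ) hG⟩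

theorem contDiffOn_of_evalBasis {m : WithTop ℕ∞} (b : Module.Basis ι ℝ E)
    {f : F → E [⋀^Fin k]→L[ℝ] ℝ} {s : Set F}
    (h : ∀ J : Fin k → ι, ContDiffOn ℝ m (fun y => f y (fun r => b (J r))) s) :
    ContDiffOn ℝ m f s := by
  obtain ⟨G, hG⟩ := exists_leftInverse_evalBasis (k := k) b
  have : f = fun y => G (fun J => f y (fun r => b (J r))) := by
    funext y; exact (hG _).symm
  rw [this]
  exact G.contDiff.comp_contDiffOn (contDiffOn_pi.2 h)

theorem contDiffOn_alternating_apply {m : WithTop ℕ∞} {f : F → E [⋀^Fin k]→L[ℝ] ℝ} {s : Set F}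
    (h : ContDiffOn ℝ m f s) (v : Fin k → E) : ContDiffOn ℝ m (fun y => f y v) s :=
  (ContinuousAlternatingMap.apply ℝ E ℝ v).contDiff.comp_contDiffOn h

theorem contDiff_alternating_apply {m : WithTop ℕ∞} {f : F → E [⋀^Fin k]→L[ℝ] ℝ}
    (h : ContDiff ℝ m f) (v : Fin k → E) : ContDiff ℝ m (fun y => f y v) :=
  (ContinuousAlternatingMap.apply ℝ E ℝ v).contDiff.comp h
end Smoothness
end KreinFeller

namespace KreinFeller

/-! ### Forms in charts: change of coordinates, exterior derivative, extension by zero. -/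

section Charts
variable {n : ℕ} {M : Type*} [TopologicalSpace M] [ChartedSpace (EuclideanSpace ℝ (Fin n)) M]
  [IsManifold (𝓡 n) ∞ M] {k : ℕ}

variable (n) in
/-- The coordinate frame of the chart at `x₀`, as a linear map from the model space. -/
noncomputable def frame (x₀ p : M) : EuclideanSpace ℝ (Fin n) →L[ℝ] TangentSpace (𝓡 n) p :=
  (trivializationAt (EuclideanSpace ℝ (Fin n)) (TangentSpace (𝓡 n)) x₀).symmL ℝ p

variable (n) in
/-- The coordinate coframe of the chart at `x₀`. -/
noncomputable def coframe (x₀ p : M) : TangentSpace (𝓡 n) p →L[ℝ] EuclideanSpace ℝ (Fin n) :=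
  (trivializationAt (EuclideanSpace ℝ (Fin n)) (TangentSpace (𝓡 n)) x₀).continuousLinearMapAt ℝ p

variable (n) in
/-- The domain of the chart at `x₀`. -/
abbrev chartDom (x₀ : M) : Set M := (chartAt (EuclideanSpace ℝ (Fin n)) x₀).source

variable (n) in
/-- The change of coordinates from the chart at `x₁` to the chart at `x₀`. -/
noncomputable def chartTrans (x₀ x₁ : M) : EuclideanSpace ℝ (Fin n) → EuclideanSpace ℝ (Fin n) :=
  fun y => extChartAt (𝓡 n) x₀ ((extChartAt (𝓡 n) x₁).symm y)

variable (n) in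
/-- The part of the target of the chart at `x₁` that the change of coordinates is defined on. -/
def overlap (x₀ x₁ : M) : Set (EuclideanSpace ℝ (Fin n)) :=
  (extChartAt (𝓡 n) x₁).target ∩ (extChartAt (𝓡 n) x₁).symm ⁻¹' chartDom n x₀

theorem isOpen_chartDom (x₀ : M) : IsOpen (chartDom n x₀) := (chartAt _ x₀).open_source

theorem isOpen_target (x₀ : M) : IsOpen (extChartAt (𝓡 n) x₀).target := isOpen_extChartAt_target x₀

theorem isOpen_overlap (x₀ x₁ : M) : IsOpen (overlap n x₀ x₁) :=
  (continuousOn_extChartAt_symm x₁).isOpen_inter_preimage (isOpen_target x₁) (isOpen_chartDom x₀)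

theorem symm_mem_chartDom {x₀ : M} {y : EuclideanSpace ℝ (Fin n)}
    (hy : y ∈ (extChartAt (𝓡 n) x₀).target) : (extChartAt (𝓡 n) x₀).symm y ∈ chartDom n x₀ := by
  rw [chartDom, ← extChartAt_source (𝓡 n)]; exact (extChartAt (𝓡 n) x₀).map_target hy

theorem ext_mem_target {x₀ p : M} (hp : p ∈ chartDom n x₀) :
    extChartAt (𝓡 n) x₀ p ∈ (extChartAt (𝓡 n) x₀).target :=
  (extChartAt (𝓡 n) x₀).map_source (by rwa [extChartAt_source])

theorem ext_left_inv {x₀ p : M} (hp : p ∈ chartDom n x₀) :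
    (extChartAt (𝓡 n) x₀).symm (extChartAt (𝓡 n) x₀ p) = p :=
  (extChartAt (𝓡 n) x₀).left_inv (by rwa [extChartAt_source])

theorem ext_right_inv {x₀ : M} {y : EuclideanSpace ℝ (Fin n)}
    (hy : y ∈ (extChartAt (𝓡 n) x₀).target) :
    extChartAt (𝓡 n) x₀ ((extChartAt (𝓡 n) x₀).symm y) = y :=
  (extChartAt (𝓡 n) x₀).right_inv hy

theorem frame_coframe {x₀ p : M} (hp : p ∈ chartDom n x₀) (v : TangentSpace (𝓡 n) p) :
    frame n x₀ p (coframe n x₀ p v) = v :=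
  Trivialization.symmL_continuousLinearMapAt _
    (by rwa [TangentBundle.trivializationAt_baseSet]) v

theorem coframe_frame {x₀ p : M} (hp : p ∈ chartDom n x₀) (v : EuclideanSpace ℝ (Fin n)) :
    coframe n x₀ p (frame n x₀ p v) = v :=
  Trivialization.continuousLinearMapAt_symmL _
    (by rwa [TangentBundle.trivializationAt_baseSet]) v

theorem mfderiv_symm_eq_frame (x₀ : M) {y : EuclideanSpace ℝ (Fin n)}
    (hy : y ∈ (extChartAt (𝓡 n) x₀).target) :
    mfderiv 𝓘(ℝ, EuclideanSpace ℝ (Fin n)) (𝓡 n) (extChartAt (𝓡 n) x₀).symm y =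
      frame n x₀ ((extChartAt (𝓡 n) x₀).symm y) := mfderiv_symm_eq_symmL x₀ hy

theorem mfderiv_ext_eq_coframe {x₀ p : M} (hp : p ∈ chartDom n x₀) :
    mfderiv (𝓡 n) 𝓘(ℝ, EuclideanSpace ℝ (Fin n)) (extChartAt (𝓡 n) x₀) p = coframe n x₀ p :=
  (TangentBundle.continuousLinearMapAt_trivializationAt hp).symm

theorem chartRep_of_mem_target {x₀ : M} {y : EuclideanSpace ℝ (Fin n)}
    (hy : y ∈ (extChartAt (𝓡 n) x₀).target) (θ : Form n M k) :
    chartRep x₀ θ y = (θ ((extChartAt (𝓡 n) x₀).symm y)).compContinuousLinearMap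
      (frame n x₀ ((extChartAt (𝓡 n) x₀).symm y)) := by
  rw [chartRep, mfderiv_symm_eq_frame x₀ hy]

theorem chartRep_ext {x₀ p : M} (hp : p ∈ chartDom n x₀) (θ : Form n M k) :
    chartRep x₀ θ (extChartAt (𝓡 n) x₀ p) = (θ p).compContinuousLinearMap (frame n x₀ p) := by
  rw [chartRep_of_mem_target (ext_mem_target hp)]
  have : ∀ q, q = p → (θ q).compContinuousLinearMap (frame n x₀ q) =
      (θ p).compContinuousLinearMap (frame n x₀ p) := by rintro q rfl; rfl
  exact this _ (ext_left_inv hp)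

theorem form_eq_coframe {x₀ p : M} (hp : p ∈ chartDom n x₀) (θ : Form n M k) :
    θ p = (chartRep x₀ θ (extChartAt (𝓡 n) x₀ p)).compContinuousLinearMap (coframe n x₀ p) := by
  rw [chartRep_ext hp]
  ext v
  simp only [ContinuousAlternatingMap.compContinuousLinearMap_apply]
  congr 1
  funext i
  exact (frame_coframe hp _).symm

theorem contDiffOn_chartTrans (x₀ x₁ : M) :
    ContDiffOn ℝ ∞ (chartTrans n x₀ x₁) (overlap n x₀ x₁) := by
  refine (contDiffOn_ext_coord_change (I := 𝓡 n) (n := ∞) x₀ x₁).mono ?_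
  rintro y ⟨hy, hy'⟩
  simp only [PartialEquiv.trans_source, PartialEquiv.symm_source, mem_inter_iff, mem_preimage,
    extChartAt_source]
  exact ⟨hy, hy'⟩

theorem hasFDerivAt_chartTrans {x₀ x₁ : M} {y : EuclideanSpace ℝ (Fin n)}
    (hy : y ∈ overlap n x₀ x₁) :
    HasFDerivAt (chartTrans n x₀ x₁)
      ((coframe n x₀ ((extChartAt (𝓡 n) x₁).symm y)).comp
        (frame n x₁ ((extChartAt (𝓡 n) x₁).symm y))) y := by
  have hp : (extChartAt (𝓡 n) x₁).symm y ∈ chartDom n x₀ := hy.2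
  have h1 : MDifferentiableAt (𝓡 n) 𝓘(ℝ, EuclideanSpace ℝ (Fin n)) (extChartAt (𝓡 n) x₀)
    ((extChartAt (𝓡 n) x₁).symm y) := mdifferentiableAt_extChartAt hp
  have h2 : MDifferentiableAt 𝓘(ℝ, EuclideanSpace ℝ (Fin n)) (𝓡 n) (extChartAt (𝓡 n) x₁).symm y := by
    have := mdifferentiableWithinAt_extChartAt_symm (I := 𝓡 n) hy.1
    rwa [ModelWithCorners.range_eq_univ, mdifferentiableWithinAt_univ] at this
  have h3 := h1.hasMFDerivAt.comp y h2.hasMFDerivAt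
  rw [mfderiv_ext_eq_coframe hp, mfderiv_symm_eq_frame x₁ hy.1] at h3
  exact h3.hasFDerivAt

theorem fderiv_chartTrans {x₀ x₁ : M} {y : EuclideanSpace ℝ (Fin n)}
    (hy : y ∈ overlap n x₀ x₁) :
    fderiv ℝ (chartTrans n x₀ x₁) y = (coframe n x₀ ((extChartAt (𝓡 n) x₁).symm y)).comp
        (frame n x₁ ((extChartAt (𝓡 n) x₁).symm y)) := (hasFDerivAt_chartTrans hy).fderiv

theorem chartRep_trans {x₀ x₁ : M} {y : EuclideanSpace ℝ (Fin n)} (hy : y ∈ overlap n x₀ x₁)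
    (θ : Form n M k) : chartRep x₁ θ y = (chartRep x₀ θ (chartTrans n x₀ x₁ y)).compContinuousLinearMap
      (fderiv ℝ (chartTrans n x₀ x₁) y) := by
  have hp : (extChartAt (𝓡 n) x₁).symm y ∈ chartDom n x₀ := hy.2
  rw [chartRep_of_mem_target hy.1, form_eq_coframe hp θ, fderiv_chartTrans hy]
  rfl

theorem chartTrans_mem_target {x₀ x₁ : M} {y : EuclideanSpace ℝ (Fin n)}
    (hy : y ∈ overlap n x₀ x₁) : chartTrans n x₀ x₁ y ∈ (extChartAt (𝓡 n) x₀).target :=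
  ext_mem_target hy.2

theorem contDiffOn_fderiv_chartTrans (x₀ x₁ : M) :
    ContDiffOn ℝ ∞ (fderiv ℝ (chartTrans n x₀ x₁)) (overlap n x₀ x₁) :=
  (contDiffOn_chartTrans x₀ x₁).fderiv_of_isOpen (isOpen_overlap x₀ x₁) le_rfl

/-- Smoothness of a pullback. -/
theorem contDiffOn_compContinuousLinearMap {E F G : Type*} [NormedAddCommGroup E] [NormedSpace ℝ E]
    [FiniteDimensional ℝ E] [NormedAddCommGroup F] [NormedSpace ℝ F] [NormedAddCommGroup G]
    [NormedSpace ℝ G] [FiniteDimensional ℝ F] {s : Set G}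
    {f : G → F [⋀^Fin k]→L[ℝ] ℝ} {L : G → E →L[ℝ] F} (hf : ContDiffOn ℝ ∞ f s)
    (hL : ContDiffOn ℝ ∞ L s) :
    ContDiffOn ℝ ∞ (fun y => (f y).compContinuousLinearMap (L y)) s := by
  set b := Module.finBasis ℝ E
  refine contDiffOn_of_evalBasis b fun J => ?_
  set c := Module.finBasis ℝ F
  have : ∀ y, (f y).compContinuousLinearMap (L y) (fun r => b (J r)) =
      ∑ i : Fin k → Fin (Module.finrank ℝ F), (∏ r, c.repr (L y (b (J r))) (i r)) *
        f y (fun r => c (i r)) := by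
    intro y
    rw [ContinuousAlternatingMap.compContinuousLinearMap_apply]
    have h1 : (L y ∘ fun r => b (J r)) = fun r => ∑ a, c.repr (L y (b (J r))) a • c a := by
      funext r; exact (c.sum_repr _).symm
    rw [h1]
    refine (((f y).toMultilinearMap).map_sum (fun r a => c.repr (L y (b (J r))) a • c a)).trans
      (Finset.sum_congr rfl fun i _ => ?_)
    exact ((f y).toMultilinearMap).map_smul_univ _ _
  simp only [this]
  refine ContDiffOn.sum fun i _ => ContDiffOn.mul (contDiffOn_prod fun r _ => ?_)
    (contDiffOn_alternating_apply hf _)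
  have h2 : ContDiffOn ℝ ∞ (fun y => L y (b (J r))) s := hL.clm_apply contDiffOn_const
  exact (LinearMap.toContinuousLinearMap (c.coord (i r))).contDiff.comp_contDiffOn h2

/-- The chart representation of the exterior derivative. -/
theorem chartRep_extD {θ : Form n M k} (hθ : IsSmoothForm θ) {x₀ : M}
    {y : EuclideanSpace ℝ (Fin n)} (hy : y ∈ (extChartAt (𝓡 n) x₀).target) :
    chartRep x₀ (extD θ) y = extDeriv (chartRep x₀ θ) y := by
  set x := (extChartAt (𝓡 n) x₀).symm y with hx
  have hxx : x ∈ chartDom n x := mem_chart_source _ x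
  have hov : y ∈ overlap n x x₀ := ⟨hy, hxx⟩
  have hloc : chartRep x₀ θ =ᶠ[𝓝 y] fun z => (chartRep x θ (chartTrans n x x₀ z)).compContinuousLinearMap
      (fderiv ℝ (chartTrans n x x₀) z) := by
    filter_upwards [(isOpen_overlap x x₀).mem_nhds hov] with z hz
    exact chartRep_trans hz θ
  have hd : DifferentiableAt ℝ (chartRep x θ) (chartTrans n x x₀ y) :=
    ((hθ x).contDiffAt ((isOpen_target x).mem_nhds (chartTrans_mem_target hov))).differentiableAt
      (by simp)
  -- `extD` at `x` is computed in the chart at `x`; naturality of `d` under the change of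
  -- coordinates carries it to the chart at `x₀`.
  rw [hloc.extDeriv_eq, extDeriv_pullback hd
    ((contDiffOn_chartTrans x x₀).contDiffAt ((isOpen_overlap x x₀).mem_nhds hov)) (r := ∞)
    (by simpa [minSmoothness] using
      WithTop.coe_le_coe.2 (le_top : (2 : ℕ∞) ≤ ⊤)), chartRep_of_mem_target hy, fderiv_chartTrans hov]
  rw [← hx, extD, mfderiv_ext_eq_coframe hxx]
  rfl

theorem contDiffOn_extDeriv {E : Type*} [NormedAddCommGroup E] [NormedSpace ℝ E] {s : Set E}
    (hs : IsOpen s) {f : E → E [⋀^Fin k]→L[ℝ] ℝ} (hf : ContDiffOn ℝ ∞ f s) :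
    ContDiffOn ℝ ∞ (extDeriv f) s := by
  have h := (ContinuousAlternatingMap.alternatizeUncurryFinCLM (n := k) ℝ E ℝ).contDiff (n := ∞)
    |>.comp_contDiffOn (hf.fderiv_of_isOpen hs (m := ∞) le_rfl)
  exact h.congr fun _ _ => rfl

theorem isSmoothForm_extD {θ : Form n M k} (hθ : IsSmoothForm θ) : IsSmoothForm (extD θ) :=
  fun x₀ => (contDiffOn_extDeriv (isOpen_target x₀) (hθ x₀)).congr fun _ hy => chartRep_extD hθ hy

open scoped Classical in
/-- The form with the given expression in the chart at `x₀`, extended by zero. -/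
noncomputable def fromChart (x₀ : M)
    (ψ : EuclideanSpace ℝ (Fin n) → EuclideanSpace ℝ (Fin n) [⋀^Fin k]→L[ℝ] ℝ) : Form n M k :=
  fun p => if p ∈ chartDom n x₀ then
    (ψ (extChartAt (𝓡 n) x₀ p)).compContinuousLinearMap (coframe n x₀ p) else 0

theorem chartRep_fromChart {x₀ : M}
    (ψ : EuclideanSpace ℝ (Fin n) → EuclideanSpace ℝ (Fin n) [⋀^Fin k]→L[ℝ] ℝ)
    {y : EuclideanSpace ℝ (Fin n)} (hy : y ∈ (extChartAt (𝓡 n) x₀).target) :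
    chartRep x₀ (fromChart x₀ ψ) y = ψ y := by
  have hp := symm_mem_chartDom hy
  rw [chartRep_of_mem_target hy, fromChart, if_pos hp, ext_right_inv hy]
  ext v
  simp only [ContinuousAlternatingMap.compContinuousLinearMap_apply]
  congr 1
  funext i
  exact coframe_frame hp _

theorem fromChart_apply_ne {x₀ : M}
    {ψ : EuclideanSpace ℝ (Fin n) → EuclideanSpace ℝ (Fin n) [⋀^Fin k]→L[ℝ] ℝ} {p : M}
    (h : fromChart x₀ ψ p ≠ 0) : p ∈ chartDom n x₀ ∧ ψ (extChartAt (𝓡 n) x₀ p) ≠ 0 := by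
  rw [fromChart] at h
  split_ifs at h with hp
  · refine ⟨hp, fun h0 => h ?_⟩
    rw [h0]; rfl
  · exact absurd rfl h

theorem isCompact_image_symm {x₀ : M} {K : Set (EuclideanSpace ℝ (Fin n))} (hK : IsCompact K)
    (hKt : K ⊆ (extChartAt (𝓡 n) x₀).target) : IsCompact ((extChartAt (𝓡 n) x₀).symm '' K) :=
  hK.image_of_continuousOn ((continuousOn_extChartAt_symm x₀).mono hKt)

theorem closure_fromChart_subset [T2Space M] {x₀ : M}
    {ψ : EuclideanSpace ℝ (Fin n) → EuclideanSpace ℝ (Fin n) [⋀^Fin k]→L[ℝ] ℝ}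
    {K : Set (EuclideanSpace ℝ (Fin n))} (hK : IsCompact K)
    (hKt : K ⊆ (extChartAt (𝓡 n) x₀).target) (hψ : ∀ y ∉ K, ψ y = 0) :
    closure {p | fromChart x₀ ψ p ≠ 0} ⊆ (extChartAt (𝓡 n) x₀).symm '' K := by
  refine closure_minimal ?_ (isCompact_image_symm hK hKt).isClosed
  intro p hp
  obtain ⟨h1, h2⟩ := fromChart_apply_ne hp
  exact ⟨_, by_contra fun h => h2 (hψ _ h), ext_left_inv h1⟩

/-- In another chart, a point either lies over the domain of the first one, where the expression is
a smooth pullback, or lies off the closed support, near which the form is zero. -/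
theorem isSmoothForm_of_chart {x₀ : M} {θ : Form n M k}
    (hsub : closure {p | θ p ≠ 0} ⊆ chartDom n x₀)
    (hs : ContDiffOn ℝ ∞ (chartRep x₀ θ) (extChartAt (𝓡 n) x₀).target) : IsSmoothForm θ := by
  intro x₁ y hy
  by_cases hyS : (extChartAt (𝓡 n) x₁).symm y ∈ chartDom n x₀
  · have hov : y ∈ overlap n x₀ x₁ := ⟨hy, hyS⟩
    have h1 : ContDiffOn ℝ ∞ (fun z => (chartRep x₀ θ (chartTrans n x₀ x₁ z)).compContinuousLinearMap
        (fderiv ℝ (chartTrans n x₀ x₁) z)) (overlap n x₀ x₁) :=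
      contDiffOn_compContinuousLinearMap
        (hs.comp (contDiffOn_chartTrans x₀ x₁) fun z hz => chartTrans_mem_target hz)
        (contDiffOn_fderiv_chartTrans x₀ x₁)
    have h2 : ContDiffOn ℝ ∞ (chartRep x₁ θ) (overlap n x₀ x₁) :=
      h1.congr fun z hz => chartRep_trans hz θ
    exact (h2.contDiffAt ((isOpen_overlap x₀ x₁).mem_nhds hov)).contDiffWithinAt
  · have hopen : IsOpen ((extChartAt (𝓡 n) x₁).target ∩
        (extChartAt (𝓡 n) x₁).symm ⁻¹' (closure {p | θ p ≠ 0})ᶜ) :=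
      (continuousOn_extChartAt_symm x₁).isOpen_inter_preimage (isOpen_target x₁)
        isClosed_closure.isOpen_compl
    have : chartRep x₁ θ =ᶠ[𝓝 y] fun _ => 0 := by
      filter_upwards [hopen.mem_nhds ⟨hy, fun h => hyS (hsub h)⟩] with z hz
      have h0 : θ ((extChartAt (𝓡 n) x₁).symm z) = 0 := by
        by_contra h; exact hz.2 (subset_closure h)
      rw [chartRep, h0]; rfl
    exact (contDiffAt_const.congr_of_eventuallyEq this).contDiffWithinAt

theorem isSmoothForm_fromChart [T2Space M] {x₀ : M}
    {ψ : EuclideanSpace ℝ (Fin n) → EuclideanSpace ℝ (Fin n) [⋀^Fin k]→L[ℝ] ℝ}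
    {K : Set (EuclideanSpace ℝ (Fin n))} (hK : IsCompact K)
    (hKt : K ⊆ (extChartAt (𝓡 n) x₀).target) (hψ : ∀ y ∉ K, ψ y = 0)
    (hs : ContDiffOn ℝ ∞ ψ (extChartAt (𝓡 n) x₀).target) : IsSmoothForm (fromChart x₀ ψ) := by
  refine isSmoothForm_of_chart ((closure_fromChart_subset hK hKt hψ).trans ?_)
    (hs.congr fun y hy => chartRep_fromChart ψ hy)
  rintro p ⟨z, hz, rfl⟩
  exact symm_mem_chartDom (hKt hz)

theorem extD_eq_zero_of_notMem {θ : Form n M k} {x : M} (hx : x ∉ closure {x | θ x ≠ 0}) :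
    extD θ x = 0 := by
  have hopen : IsOpen ((extChartAt (𝓡 n) x).target ∩
      (extChartAt (𝓡 n) x).symm ⁻¹' (closure {x | θ x ≠ 0})ᶜ) :=
    (continuousOn_extChartAt_symm x).isOpen_inter_preimage (isOpen_target x)
      isClosed_closure.isOpen_compl
  have hxd : x ∈ chartDom n x := mem_chart_source _ x
  have : chartRep x θ =ᶠ[𝓝 (extChartAt (𝓡 n) x x)] fun _ => 0 := by
    filter_upwards [hopen.mem_nhds ⟨ext_mem_target hxd, by
      rw [mem_preimage, ext_left_inv hxd]; exact hx⟩] with z hz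
    have h0 : θ ((extChartAt (𝓡 n) x).symm z) = 0 := by
      by_contra h; exact hz.2 (subset_closure h)
    rw [chartRep, h0]; rfl
  rw [extD, this.extDeriv_eq]
  have : extDeriv (fun _ : EuclideanSpace ℝ (Fin n) =>
      (0 : EuclideanSpace ℝ (Fin n) [⋀^Fin k]→L[ℝ] ℝ)) (extChartAt (𝓡 n) x x) = 0 := by
    ext v
    simp [extDeriv, ContinuousAlternatingMap.alternatizeUncurryFin_apply]
  rw [this]; rfl
end Charts
end KreinFeller

namespace KreinFeller

/-! ### The metric and the volume density in coordinates. -/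

section Metric
variable {n : ℕ} {M : Type*} [TopologicalSpace M] [ChartedSpace (EuclideanSpace ℝ (Fin n)) M]
  [IsManifold (𝓡 n) ∞ M] {k : ℕ}
  [RiemannianBundle (fun x : M => TangentSpace (𝓡 n) x)]
  {ι : Type*} [Fintype ι] [DecidableEq ι]

/-- The matrix of the metric in the basis `b` of the model space, in the chart at `x₀`. -/
noncomputable def metricMatrix (x₀ : M) (b : Module.Basis ι ℝ (EuclideanSpace ℝ (Fin n)))
    (y : EuclideanSpace ℝ (Fin n)) : Matrix ι ι ℝ :=
  Matrix.of fun i j => inner ℝ (frame n x₀ ((extChartAt (𝓡 n) x₀).symm y) (b i))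
    (frame n x₀ ((extChartAt (𝓡 n) x₀).symm y) (b j))

/-- The density of the Riemannian volume in the chart at `x₀`. -/
noncomputable def volDensity (x₀ : M) (y : EuclideanSpace ℝ (Fin n)) : ℝ :=
  Real.sqrt (gram x₀ y).det

/-- The coefficients of the inner product of forms times the volume density. -/
noncomputable def pairCoeff (x₀ : M) (b : Module.Basis ι ℝ (EuclideanSpace ℝ (Fin n)))
    (I J : Fin k → ι) (y : EuclideanSpace ℝ (Fin n)) : ℝ :=
  volDensity x₀ y * ∏ r, (metricMatrix x₀ b y)⁻¹ (I r) (J r)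

/-- The coordinate frame as a linear equivalence. -/
noncomputable def frameEquiv {x₀ p : M} (hp : p ∈ chartDom n x₀) :
    EuclideanSpace ℝ (Fin n) ≃ₗ[ℝ] TangentSpace (𝓡 n) p :=
  LinearEquiv.ofLinearMap (frame n x₀ p : EuclideanSpace ℝ (Fin n) →ₗ[ℝ] TangentSpace (𝓡 n) p)
    (coframe n x₀ p : TangentSpace (𝓡 n) p →ₗ[ℝ] EuclideanSpace ℝ (Fin n))
    (LinearMap.ext fun v => frame_coframe hp v) (LinearMap.ext fun v => coframe_frame hp v)

theorem posDef_metricMatrix (x₀ : M) (b : Module.Basis ι ℝ (EuclideanSpace ℝ (Fin n)))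
    {y : EuclideanSpace ℝ (Fin n)} (hy : y ∈ (extChartAt (𝓡 n) x₀).target) :
    (metricMatrix x₀ b y).PosDef := by
  have hp := symm_mem_chartDom hy
  have hli : LinearIndependent ℝ
      (fun i => frame n x₀ ((extChartAt (𝓡 n) x₀).symm y) (b i)) :=
    (b.map (frameEquiv hp)).linearIndependent
  exact Matrix.posDef_gram_iff_linearIndependent.2 hli

theorem gram_eq_metricMatrix (x₀ : M) {y : EuclideanSpace ℝ (Fin n)}
    (hy : y ∈ (extChartAt (𝓡 n) x₀).target) :
    gram x₀ y = metricMatrix x₀ (EuclideanSpace.basisFun (Fin n) ℝ).toBasis y := by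
  ext i j
  rw [gram, metricMatrix, Matrix.of_apply, Matrix.of_apply, mfderiv_symm_eq_frame x₀ hy]
  simp only [OrthonormalBasis.coe_toBasis]
  rfl

theorem det_gram_pos (x₀ : M) {y : EuclideanSpace ℝ (Fin n)}
    (hy : y ∈ (extChartAt (𝓡 n) x₀).target) : 0 < (gram x₀ y).det := by
  rw [gram_eq_metricMatrix x₀ hy]; exact (posDef_metricMatrix x₀ _ hy).det_pos

theorem volDensity_pos (x₀ : M) {y : EuclideanSpace ℝ (Fin n)}
    (hy : y ∈ (extChartAt (𝓡 n) x₀).target) : 0 < volDensity x₀ y :=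
  Real.sqrt_pos.2 (det_gram_pos x₀ hy)

/-- This is `formInner_eq_basis` for the image of `b` under the coordinate frame. The basis is left
arbitrary so that one orthonormal at a given point can be chosen later; the density stays the one of
the standard basis, because it multiplies Lebesgue measure in the chart. -/
theorem formInner_mul_volDensity {x₀ : M} (b : Module.Basis ι ℝ (EuclideanSpace ℝ (Fin n)))
    {y : EuclideanSpace ℝ (Fin n)} (hy : y ∈ (extChartAt (𝓡 n) x₀).target) (θ η : Form n M k) :
    formInner (θ ((extChartAt (𝓡 n) x₀).symm y)) (η ((extChartAt (𝓡 n) x₀).symm y)) *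
        volDensity x₀ y =
      (k.factorial : ℝ)⁻¹ * ∑ I : Fin k → ι, ∑ J : Fin k → ι, pairCoeff x₀ b I J y *
        (chartRep x₀ θ y (fun r => b (I r)) * chartRep x₀ η y (fun r => b (J r))) := by
  rw [formInner_eq_basis (b.map (frameEquiv (symm_mem_chartDom hy))), mul_assoc]
  congr 1
  rw [Finset.sum_mul]
  refine Finset.sum_congr rfl fun I _ => ?_
  rw [Finset.sum_mul]
  refine Finset.sum_congr rfl fun J _ => ?_
  rw [chartRep_of_mem_target hy, chartRep_of_mem_target hy, pairCoeff, mul_comm, ← mul_assoc]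
  rfl

variable [IsContMDiffRiemannianBundle (𝓡 n) ∞ (EuclideanSpace ℝ (Fin n))
    (fun x : M => TangentSpace (𝓡 n) x)]

theorem contMDiffOn_inner_frame (x₀ : M) (v w : EuclideanSpace ℝ (Fin n)) :
    ContMDiffOn (𝓡 n) 𝓘(ℝ, ℝ) ∞ (fun p => inner ℝ (frame n x₀ p v) (frame n x₀ p w))
      (chartDom n x₀) := by
  set e := trivializationAt (EuclideanSpace ℝ (Fin n)) (TangentSpace (𝓡 n) (M := M)) x₀ with he
  have hbase : e.baseSet = chartDom n x₀ := by
    rw [he, TangentBundle.trivializationAt_baseSet]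
  have h : ∀ v, ContMDiffOn (𝓡 n) ((𝓡 n).prod 𝓘(ℝ, EuclideanSpace ℝ (Fin n))) ∞ (fun p =>
      (⟨p, frame n x₀ p v⟩ : TotalSpace (EuclideanSpace ℝ (Fin n))
        (TangentSpace (𝓡 n) (M := M)))) (chartDom n x₀) := by
    intro v
    have h1 := e.contMDiffOn_symm (IB := 𝓡 n) (n := ∞)
    have h2 : ContMDiffOn (𝓡 n) ((𝓡 n).prod 𝓘(ℝ, EuclideanSpace ℝ (Fin n))) ∞
        (fun p : M => (p, v)) (chartDom n x₀) :=
      contMDiffOn_id.prodMk contMDiffOn_const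
    have h3 := h1.comp h2 (fun p hp => by
      rw [mem_preimage, e.mem_target, hbase]; exact hp)
    refine h3.congr fun p hp => ?_
    have hp' : p ∈ e.baseSet := by rwa [hbase]
    rw [frame, Trivialization.symmL_apply (R := ℝ) e hp']
    exact e.mk_symm hp' v
  exact (h v).inner_bundle (h w)

theorem contDiffOn_metricMatrix (x₀ : M) (b : Module.Basis ι ℝ (EuclideanSpace ℝ (Fin n)))
    (i j : ι) : ContDiffOn ℝ ∞ (fun y => metricMatrix x₀ b y i j) (extChartAt (𝓡 n) x₀).target := by
  have h := (contMDiffOn_inner_frame x₀ (b i) (b j)).comp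
    (contMDiffOn_extChartAt_symm (I := 𝓡 n) (n := ∞) x₀) (fun y hy => symm_mem_chartDom hy)
  exact h.contDiffOn

theorem contDiffOn_det {E : Type*} [NormedAddCommGroup E] [NormedSpace ℝ E] {s : Set E}
    {A : E → Matrix ι ι ℝ} (hA : ∀ i j, ContDiffOn ℝ ∞ (fun y => A y i j) s) :
    ContDiffOn ℝ ∞ (fun y => (A y).det) s := by
  simp only [Matrix.det_apply']
  exact ContDiffOn.sum fun σ _ => contDiffOn_const.mul (contDiffOn_prod fun i _ => hA _ _)

theorem contDiffOn_inv_metricMatrix (x₀ : M)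
    (b : Module.Basis ι ℝ (EuclideanSpace ℝ (Fin n))) (i j : ι) :
    ContDiffOn ℝ ∞ (fun y => (metricMatrix x₀ b y)⁻¹ i j) (extChartAt (𝓡 n) x₀).target := by
  simp only [Matrix.inv_def, Ring.inverse_eq_inv', Matrix.smul_apply, smul_eq_mul]
  refine ContDiffOn.mul (ContDiffOn.inv (contDiffOn_det (contDiffOn_metricMatrix x₀ b))
    fun y hy => (posDef_metricMatrix x₀ b hy).det_pos.ne') ?_
  simp only [Matrix.adjugate_apply]
  refine contDiffOn_det fun a c => ?_
  simp only [Matrix.updateRow_apply]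
  split_ifs
  · exact contDiffOn_const
  · exact contDiffOn_metricMatrix x₀ b a c

theorem contDiffOn_volDensity (x₀ : M) :
    ContDiffOn ℝ ∞ (volDensity (n := n) x₀) (extChartAt (𝓡 n) x₀).target := by
  have h : ContDiffOn ℝ ∞ (fun y => (gram x₀ y).det) (extChartAt (𝓡 n) x₀).target :=
    (contDiffOn_det (contDiffOn_metricMatrix x₀ (EuclideanSpace.basisFun (Fin n) ℝ).toBasis)).congr
      fun y hy => by rw [gram_eq_metricMatrix x₀ hy]
  exact h.sqrt fun y hy => (det_gram_pos x₀ hy).ne'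

theorem contDiffOn_pairCoeff (x₀ : M) (b : Module.Basis ι ℝ (EuclideanSpace ℝ (Fin n)))
    (I J : Fin k → ι) : ContDiffOn ℝ ∞ (pairCoeff x₀ b I J) (extChartAt (𝓡 n) x₀).target :=
  (contDiffOn_volDensity x₀).mul
    (contDiffOn_prod fun r _ => contDiffOn_inv_metricMatrix x₀ b (I r) (J r))

end Metric

/-! ### The Riemannian measure and integration in a chart. -/

section Volume
variable {n : ℕ} {M : Type*} [TopologicalSpace M] [ChartedSpace (EuclideanSpace ℝ (Fin n)) M]
  [IsManifold (𝓡 n) ∞ M]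
  [RiemannianBundle (fun x : M => TangentSpace (𝓡 n) x)]
  [IsContMDiffRiemannianBundle (𝓡 n) ∞ (EuclideanSpace ℝ (Fin n))
    (fun x : M => TangentSpace (𝓡 n) x)]
  [MeasurableSpace M] [BorelSpace M]

theorem aemeasurable_symm (x₀ : M) : AEMeasurable (extChartAt (𝓡 n) x₀).symm
    (volume.restrict (extChartAt (𝓡 n) x₀).target) :=
  (continuousOn_extChartAt_symm x₀).aemeasurable (isOpen_target x₀).measurableSet

theorem aemeasurable_symm_withDensity (x₀ : M) : AEMeasurable (extChartAt (𝓡 n) x₀).symm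
    ((volume.restrict (extChartAt (𝓡 n) x₀).target).withDensity
      fun y => ENNReal.ofReal (volDensity x₀ y)) :=
  (aemeasurable_symm (n := n) x₀).mono_ac (withDensity_absolutelyContinuous _ _)

theorem aemeasurable_volDensity (x₀ : M) : AEMeasurable (volDensity (n := n) x₀)
    (volume.restrict (extChartAt (𝓡 n) x₀).target) :=
  (contDiffOn_volDensity x₀).continuousOn.aemeasurable (isOpen_target x₀).measurableSet

theorem measurableSet_target_inter_preimage (x₀ : M) {A : Set M} (hA : MeasurableSet A) :
    MeasurableSet ((extChartAt (𝓡 n) x₀).target ∩ (extChartAt (𝓡 n) x₀).symm ⁻¹' A) := by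
  have h : Measurable ((extChartAt (𝓡 n) x₀).target.domRestrict (extChartAt (𝓡 n) x₀).symm) :=
    (continuousOn_iff_continuous_domRestrict.1 (continuousOn_extChartAt_symm x₀)).measurable
  have := (isOpen_target x₀).measurableSet.subtype_image (h hA)
  convert this using 1
  ext y
  simp [and_comm]

theorem chartVol_apply (x₀ : M) {A : Set M} (hA : MeasurableSet A) :
    chartVol n x₀ A = ∫⁻ y in (extChartAt (𝓡 n) x₀).target ∩ (extChartAt (𝓡 n) x₀).symm ⁻¹' A,
      ENNReal.ofReal (volDensity x₀ y) := by
  have hm := measurableSet_target_inter_preimage (n := n) x₀ hA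
  have h1 : chartVol n x₀ A = ((volume.restrict (extChartAt (𝓡 n) x₀).target).withDensity
      fun y => ENNReal.ofReal (volDensity x₀ y)) ((extChartAt (𝓡 n) x₀).symm ⁻¹' A) :=
    Measure.map_apply_of_aemeasurable (aemeasurable_symm_withDensity (n := n) x₀) hA
  rw [h1, ← restrict_withDensity (isOpen_target x₀).measurableSet,
    Measure.restrict_apply' (isOpen_target x₀).measurableSet, inter_comm, withDensity_apply _ hm]

theorem frame_eq_frame_comp {x₀ x₁ : M} {y : EuclideanSpace ℝ (Fin n)} (hy : y ∈ overlap n x₀ x₁)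
    (v : EuclideanSpace ℝ (Fin n)) :
    frame n x₁ ((extChartAt (𝓡 n) x₁).symm y) v =
      frame n x₀ ((extChartAt (𝓡 n) x₁).symm y) (fderiv ℝ (chartTrans n x₀ x₁) y v) := by
  rw [fderiv_chartTrans hy]
  exact (frame_coframe hy.2 _).symm

/-- The Gram matrix changes by the congruence `AᵀGA`, where `A` is the Jacobian matrix, so its
determinant is multiplied by `(det A)²`. -/
theorem volDensity_trans {x₀ x₁ : M} {y : EuclideanSpace ℝ (Fin n)} (hy : y ∈ overlap n x₀ x₁) :
    volDensity x₁ y = |(fderiv ℝ (chartTrans n x₀ x₁) y).det| *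
      volDensity x₀ (chartTrans n x₀ x₁ y) := by
  set b := (EuclideanSpace.basisFun (Fin n) ℝ).toBasis
  set L := fderiv ℝ (chartTrans n x₀ x₁) y
  set A := LinearMap.toMatrix b b (L : EuclideanSpace ℝ (Fin n) →ₗ[ℝ] EuclideanSpace ℝ (Fin n))
  have hdet : L.det = A.det := (LinearMap.det_toMatrix b _).symm
  have hsymm : (extChartAt (𝓡 n) x₀).symm (chartTrans n x₀ x₁ y) = (extChartAt (𝓡 n) x₁).symm y :=
    ext_left_inv hy.2
  have hm0 : metricMatrix x₀ b (chartTrans n x₀ x₁ y) = Matrix.of fun i j =>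
      inner ℝ (frame n x₀ ((extChartAt (𝓡 n) x₁).symm y) (b i))
        (frame n x₀ ((extChartAt (𝓡 n) x₁).symm y) (b j)) := by
    rw [metricMatrix, hsymm]
  have hg : gram x₁ y = A.transpose * gram x₀ (chartTrans n x₀ x₁ y) * A := by
    rw [gram_eq_metricMatrix x₁ hy.1, gram_eq_metricMatrix x₀ (chartTrans_mem_target hy), hm0]
    ext i j
    have hL : ∀ i, L (b i) = ∑ a, A a i • b a := by
      intro i
      rw [← b.sum_repr (L (b i))]
      simp [A, LinearMap.toMatrix_apply]
    rw [metricMatrix, Matrix.of_apply, frame_eq_frame_comp hy, frame_eq_frame_comp hy]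
    change inner ℝ (frame n x₀ _ (L (b i))) (frame n x₀ _ (L (b j))) = _
    rw [hL, hL]
    simp only [map_sum, map_smul, sum_inner, inner_sum, real_inner_smul_left,
      real_inner_smul_right, Matrix.mul_apply, Matrix.transpose_apply, Matrix.of_apply,
      Finset.sum_mul]
    refine Finset.sum_congr rfl fun a _ => Finset.sum_congr rfl fun c _ => ?_
    ring
  rw [volDensity, volDensity, hg, Matrix.det_mul, Matrix.det_mul, Matrix.det_transpose, hdet,
    ← Real.sqrt_sq_eq_abs, ← Real.sqrt_mul (sq_nonneg _)]
  congr 1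
  ring

/-- The change of variables formula: the Jacobian factor is exactly the quotient of the two
densities. -/
theorem chartVol_eq_of_subset {x₀ x₁ : M} {A : Set M} (hA : MeasurableSet A)
    (h0 : A ⊆ chartDom n x₀) (h1 : A ⊆ chartDom n x₁) : chartVol n x₁ A = chartVol n x₀ A := by
  rw [chartVol_apply x₁ hA, chartVol_apply x₀ hA]
  set B := (extChartAt (𝓡 n) x₁).target ∩ (extChartAt (𝓡 n) x₁).symm ⁻¹' A with hB
  have hBo : ∀ y ∈ B, y ∈ overlap n x₀ x₁ := fun y hy => ⟨hy.1, h0 hy.2⟩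
  have himg : (extChartAt (𝓡 n) x₀).target ∩ (extChartAt (𝓡 n) x₀).symm ⁻¹' A =
      chartTrans n x₀ x₁ '' B := by
    ext z
    constructor
    · rintro ⟨hz, hzA⟩
      refine ⟨extChartAt (𝓡 n) x₁ ((extChartAt (𝓡 n) x₀).symm z),
        ⟨ext_mem_target (h1 hzA), ?_⟩, ?_⟩
      · rw [mem_preimage, ext_left_inv (h1 hzA)]; exact hzA
      · rw [chartTrans, ext_left_inv (h1 hzA), ext_right_inv hz]
    · rintro ⟨y, hy, rfl⟩
      refine ⟨chartTrans_mem_target (hBo y hy), ?_⟩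
      rw [mem_preimage, chartTrans, ext_left_inv (h0 hy.2)]; exact hy.2
  have hinj : InjOn (chartTrans n x₀ x₁) B := by
    intro y hy z hz h
    have h' := congrArg (extChartAt (𝓡 n) x₀).symm h
    rw [chartTrans, chartTrans, ext_left_inv (h0 hy.2), ext_left_inv (h0 hz.2)] at h'
    rw [← ext_right_inv hy.1, h', ext_right_inv hz.1]
  have hBm : MeasurableSet B := measurableSet_target_inter_preimage x₁ hA
  rw [himg, lintegral_image_eq_lintegral_abs_det_fderiv_mul volume hBm
    (fun y hy => (((hasFDerivAt_chartTrans (hBo y hy)).differentiableAt).hasFDerivAt).hasFDerivWithinAt)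
    hinj]
  refine setLIntegral_congr_fun hBm fun y hy => ?_
  rw [volDensity_trans (hBo y hy), ENNReal.ofReal_mul (abs_nonneg _)]

theorem chartVol_compl (x₀ : M) : chartVol n x₀ (chartDom n x₀)ᶜ = 0 := by
  rw [chartVol_apply x₀ (isOpen_chartDom x₀).measurableSet.compl]
  have : (extChartAt (𝓡 n) x₀).target ∩ (extChartAt (𝓡 n) x₀).symm ⁻¹' (chartDom n x₀)ᶜ = ∅ := by
    ext y
    simp only [mem_inter_iff, mem_preimage, mem_compl_iff, mem_empty_iff_false, iff_false, not_and,
      not_not]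
    exact fun hy => symm_mem_chartDom hy
  rw [this]; simp

theorem riemVol_restrict (x₀ : M) :
    (riemVol n M).restrict (chartDom n x₀) = chartVol n x₀ := by
  have hS : MeasurableSet (chartDom n x₀) := (isOpen_chartDom x₀).measurableSet
  have hself : (chartVol n x₀).restrict (chartDom n x₀) = chartVol n x₀ :=
    Measure.restrict_eq_self_of_ae_mem (by
      rw [ae_iff]; exact chartVol_compl x₀)
  refine le_antisymm ?_ ?_
  -- A supremum of measures is bounded by any common upper bound. Inside the domain of `x₀` each
  -- chart measure is at most `chartVol n x₀`, since the two agree on overlaps; outside it is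
  -- bounded by `riemVol` itself, a term that disappears on restricting to the domain.
  · have hle : riemVol n M ≤ chartVol n x₀ + (riemVol n M).restrict (chartDom n x₀)ᶜ := by
      refine iSup_le fun x₁ => ?_
      have h1 : chartVol n x₁ = (chartVol n x₁).restrict (chartDom n x₀) +
          (chartVol n x₁).restrict (chartDom n x₀)ᶜ := (Measure.restrict_add_restrict_compl hS).symm
      rw [h1]
      refine add_le_add ?_ (Measure.restrict_mono le_rfl (le_iSup (chartVol n) x₁))
      refine Measure.le_iff.2 fun A hA => ?_
      rw [Measure.restrict_apply hA]
      have h2 : chartVol n x₁ (A ∩ chartDom n x₀) ≤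
          chartVol n x₁ (A ∩ chartDom n x₀ ∩ chartDom n x₁) := by
        refine (measure_mono (fun p hp => ?_ : _ ⊆ (A ∩ chartDom n x₀ ∩ chartDom n x₁) ∪
          (chartDom n x₁)ᶜ)).trans ((measure_union_le _ _).trans ?_)
        · by_cases h : p ∈ chartDom n x₁
          · exact Or.inl ⟨hp, h⟩
          · exact Or.inr h
        · rw [chartVol_compl, add_zero]
      refine h2.trans ?_
      rw [chartVol_eq_of_subset (x₀ := x₀) ((hA.inter hS).inter (isOpen_chartDom x₁).measurableSet)
        (fun p hp => hp.1.2) (fun p hp => hp.2)]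
      exact measure_mono fun p hp => hp.1.1
    have := Measure.restrict_mono (Subset.refl (chartDom n x₀)) hle
    refine this.trans ?_
    rw [Measure.restrict_add, Measure.restrict_restrict hS, inter_compl_self,
      Measure.restrict_empty, add_zero, hself]
  · rw [← hself]
    exact Measure.restrict_mono le_rfl (le_iSup (chartVol n) x₀)

/-- Integration in a chart. -/
theorem integral_chartDom (x₀ : M) {f : M → ℝ}
    (hf : AEStronglyMeasurable f ((riemVol n M).restrict (chartDom n x₀))) :
    ∫ p in chartDom n x₀, f p ∂(riemVol n M) = ∫ y in (extChartAt (𝓡 n) x₀).target,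
      f ((extChartAt (𝓡 n) x₀).symm y) * volDensity x₀ y := by
  rw [riemVol_restrict] at hf ⊢
  have h1 : ∫ p, f p ∂(chartVol n x₀) = ∫ y, f ((extChartAt (𝓡 n) x₀).symm y)
      ∂((volume.restrict (extChartAt (𝓡 n) x₀).target).withDensity
        fun y => ENNReal.ofReal (volDensity x₀ y)) :=
    integral_map (aemeasurable_symm_withDensity (n := n) x₀) hf
  rw [h1, integral_withDensity_eq_integral_toReal_smul₀
    (aemeasurable_volDensity x₀).ennreal_ofReal (Eventually.of_forall fun y => ENNReal.ofReal_lt_top)]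
  refine setIntegral_congr_fun (isOpen_target x₀).measurableSet fun y hy => ?_
  simp only [smul_eq_mul]
  rw [ENNReal.toReal_ofReal (volDensity_pos x₀ hy).le, mul_comm]

theorem integrableOn_chartDom_iff (x₀ : M) {f : M → ℝ}
    (hf : AEStronglyMeasurable f ((riemVol n M).restrict (chartDom n x₀))) :
    IntegrableOn f (chartDom n x₀) (riemVol n M) ↔
      IntegrableOn (fun y => f ((extChartAt (𝓡 n) x₀).symm y) * volDensity x₀ y)
        (extChartAt (𝓡 n) x₀).target := by
  rw [IntegrableOn, riemVol_restrict] at *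
  have h1 : Integrable f (chartVol n x₀) ↔ Integrable (f ∘ (extChartAt (𝓡 n) x₀).symm)
      ((volume.restrict (extChartAt (𝓡 n) x₀).target).withDensity
        fun y => ENNReal.ofReal (volDensity x₀ y)) :=
    integrable_map_measure hf (aemeasurable_symm_withDensity (n := n) x₀)
  rw [h1, integrable_withDensity_iff_integrable_smul₀' (aemeasurable_volDensity x₀).ennreal_ofReal
    (Eventually.of_forall fun y => ENNReal.ofReal_lt_top)]
  refine integrable_congr (ae_restrict_of_forall_mem (isOpen_target x₀).measurableSet fun y hy => ?_)
  simp only [smul_eq_mul, Function.comp]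
  rw [ENNReal.toReal_ofReal (volDensity_pos x₀ hy).le, mul_comm]

instance isLocallyFiniteMeasure_riemVol : IsLocallyFiniteMeasure (riemVol n M) := by
  refine ⟨fun p => ?_⟩
  have hp : p ∈ chartDom n p := mem_chart_source _ p
  obtain ⟨r, hr, hrt⟩ := Metric.nhds_basis_closedBall.mem_iff.1
    ((isOpen_target p).mem_nhds (ext_mem_target hp))
  set V := (extChartAt (𝓡 n) p).source ∩
    extChartAt (𝓡 n) p ⁻¹' Metric.ball (extChartAt (𝓡 n) p p) r with hV
  have hVo : IsOpen V := (continuousOn_extChartAt p).isOpen_inter_preimage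
    (isOpen_extChartAt_source p) Metric.isOpen_ball
  have hVS : V ⊆ chartDom n p := fun q hq => by
    have := hq.1; rwa [extChartAt_source] at this
  refine ⟨V, hVo.mem_nhds ⟨by rwa [extChartAt_source], Metric.mem_ball_self hr⟩, ?_⟩
  have h1 : riemVol n M V = chartVol n p V := by
    rw [← riemVol_restrict, Measure.restrict_apply hVo.measurableSet, inter_eq_left.2 hVS]
  rw [h1, chartVol_apply p hVo.measurableSet]
  have hint : IntegrableOn (volDensity (n := n) p) (Metric.closedBall (extChartAt (𝓡 n) p p) r) :=
    ((contDiffOn_volDensity p).continuousOn.mono hrt).integrableOn_compact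
      (isCompact_closedBall _ _)
  refine lt_of_le_of_lt (lintegral_mono_set ?_) hint.lintegral_lt_top
  rintro y ⟨hy, hy2⟩
  have := hy2.2
  rw [mem_preimage, ext_right_inv hy] at this
  exact Metric.ball_subset_closedBall this

instance isFiniteMeasure_riemVol [CompactSpace M] : IsFiniteMeasure (riemVol n M) :=
  CompactSpace.isFiniteMeasure
end Volume
end KreinFeller

namespace KreinFeller

/-! ### Smooth forms as elements of L², and the totality of test forms. -/

section SmoothForms
variable {n : ℕ} {M : Type*} [TopologicalSpace M] [ChartedSpace (EuclideanSpace ℝ (Fin n)) M]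
  [IsManifold (𝓡 n) ∞ M] {k : ℕ}
  [RiemannianBundle (fun x : M => TangentSpace (𝓡 n) x)]
  [IsContMDiffRiemannianBundle (𝓡 n) ∞ (EuclideanSpace ℝ (Fin n))
    (fun x : M => TangentSpace (𝓡 n) x)]

theorem formInner_ext_point {x₀ p : M} (hp : p ∈ chartDom n x₀) (θ η : Form n M k) :
    formInner (θ p) (η p) = (volDensity x₀ (extChartAt (𝓡 n) x₀ p))⁻¹ *
      ((k.factorial : ℝ)⁻¹ * ∑ I : Fin k → Fin n, ∑ J : Fin k → Fin n,
        pairCoeff x₀ (EuclideanSpace.basisFun (Fin n) ℝ).toBasis I J (extChartAt (𝓡 n) x₀ p) *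
        (chartRep x₀ θ (extChartAt (𝓡 n) x₀ p)
            (fun r => (EuclideanSpace.basisFun (Fin n) ℝ).toBasis (I r)) *
          chartRep x₀ η (extChartAt (𝓡 n) x₀ p)
            (fun r => (EuclideanSpace.basisFun (Fin n) ℝ).toBasis (J r)))) := by
  have hy := ext_mem_target hp
  rw [← formInner_mul_volDensity _ hy θ η, mul_comm, mul_inv_cancel_right₀ (volDensity_pos x₀ hy).ne']
  have : ∀ q, q = p → formInner (θ p) (η p) = formInner (θ q) (η q) := by rintro q rfl; rfl
  exact this _ (ext_left_inv hp)

theorem continuous_formInner {θ η : Form n M k} (hθ : IsSmoothForm θ) (hη : IsSmoothForm η) :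
    Continuous fun p => formInner (θ p) (η p) := by
  rw [continuous_iff_continuousAt]
  intro x₀
  have hx : x₀ ∈ chartDom n x₀ := mem_chart_source _ x₀
  have key : ContinuousOn (fun y => (volDensity x₀ y)⁻¹ *
      ((k.factorial : ℝ)⁻¹ * ∑ I : Fin k → Fin n, ∑ J : Fin k → Fin n,
        pairCoeff x₀ (EuclideanSpace.basisFun (Fin n) ℝ).toBasis I J y *
        (chartRep x₀ θ y (fun r => (EuclideanSpace.basisFun (Fin n) ℝ).toBasis (I r)) *
          chartRep x₀ η y (fun r => (EuclideanSpace.basisFun (Fin n) ℝ).toBasis (J r)))))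
      (extChartAt (𝓡 n) x₀).target := by
    refine ((contDiffOn_volDensity x₀).continuousOn.inv₀ fun y hy =>
      (volDensity_pos x₀ hy).ne').mul (continuousOn_const.mul ?_)
    refine continuousOn_finsetSum _ fun I _ => continuousOn_finsetSum _ fun J _ => ?_
    exact (contDiffOn_pairCoeff x₀ _ I J).continuousOn.mul
      ((contDiffOn_alternating_apply (hθ x₀) _).continuousOn.mul
        (contDiffOn_alternating_apply (hη x₀) _).continuousOn)
  have h2 : ContinuousOn (fun p => formInner (θ p) (η p)) (chartDom n x₀) := by
    refine (key.comp ((continuousOn_extChartAt (I := 𝓡 n) x₀).mono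
      (extChartAt_source (𝓡 n) x₀).symm.subset) fun p hp => ext_mem_target hp).congr fun p hp => ?_
    exact formInner_ext_point hp θ η
  exact h2.continuousAt ((isOpen_chartDom x₀).mem_nhds hx)

/-- The form `ρ • (w₁♭ ∧ ⋯ ∧ wₖ♭)`, where the `wᵣ` are constant in the chart at `x₀`. -/
noncomputable def framePair (x₀ : M) (ρ : M → ℝ) (v : Fin k → EuclideanSpace ℝ (Fin n)) :
    Form n M k :=
  fun p => ρ p • flatWedge (fun r => frame n x₀ p (v r))

/-- Pairing with `framePair` isolates one coefficient of `θ`, which reduces questions on forms to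
questions on scalar functions. -/
theorem formInner_framePair (x₀ : M) (ρ : M → ℝ) (v : Fin k → EuclideanSpace ℝ (Fin n))
    (θ : Form n M k) (p : M) :
    formInner (framePair x₀ ρ v p) (θ p) = ρ p * θ p (fun r => frame n x₀ p (v r)) := by
  rw [framePair, formInner_smul_left, formInner_flatWedge]

theorem closure_framePair_subset (x₀ : M) (ρ : M → ℝ) (v : Fin k → EuclideanSpace ℝ (Fin n)) :
    closure {p | framePair x₀ ρ v p ≠ 0} ⊆ tsupport ρ := by
  refine closure_mono fun p hp h => hp ?_
  change ρ p • _ = _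
  rw [show ρ p = 0 from h, zero_smul]

theorem isSmoothForm_framePair {x₀ : M} {ρ : M → ℝ}
    (hρ : ContMDiffOn (𝓡 n) 𝓘(ℝ, ℝ) ∞ ρ (chartDom n x₀))
    (hsub : tsupport ρ ⊆ chartDom n x₀) (v : Fin k → EuclideanSpace ℝ (Fin n)) :
    IsSmoothForm (framePair x₀ ρ v) := by
  refine isSmoothForm_of_chart ((closure_framePair_subset x₀ ρ v).trans hsub) ?_
  refine contDiffOn_of_evalBasis (EuclideanSpace.basisFun (Fin n) ℝ).toBasis fun J => ?_
  have h1 : ContDiffOn ℝ ∞ (fun y => ρ ((extChartAt (𝓡 n) x₀).symm y))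
      (extChartAt (𝓡 n) x₀).target :=
    (hρ.comp (contMDiffOn_extChartAt_symm (I := 𝓡 n) (n := ∞) x₀)
      (fun y hy => symm_mem_chartDom hy)).contDiffOn
  have h2 : ContDiffOn ℝ ∞ (fun y => Matrix.det (Matrix.of fun a c => inner ℝ
      (frame n x₀ ((extChartAt (𝓡 n) x₀).symm y)
        ((EuclideanSpace.basisFun (Fin n) ℝ).toBasis (J a)))
      (frame n x₀ ((extChartAt (𝓡 n) x₀).symm y) (v c)))) (extChartAt (𝓡 n) x₀).target :=
    contDiffOn_det fun a c => ((contMDiffOn_inner_frame x₀ _ _).comp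
      (contMDiffOn_extChartAt_symm (I := 𝓡 n) (n := ∞) x₀)
      (fun y hy => symm_mem_chartDom hy)).contDiffOn
  refine (h1.mul h2).congr fun y hy => ?_
  rw [chartRep_of_mem_target hy, framePair]
  simp only [ContinuousAlternatingMap.compContinuousLinearMap_apply,
    ContinuousAlternatingMap.smul_apply, smul_eq_mul, flatWedge_apply]
  rfl

variable [T2Space M] [CompactSpace M]

theorem framePair_mem_testForms {x₀ : M} {ρ : M → ℝ} {Ω : Set M}
    (hρ : ContMDiffOn (𝓡 n) 𝓘(ℝ, ℝ) ∞ ρ (chartDom n x₀))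
    (hsub : tsupport ρ ⊆ chartDom n x₀) (hΩ : tsupport ρ ⊆ Ω)
    (v : Fin k → EuclideanSpace ℝ (Fin n)) : framePair x₀ ρ v ∈ testForms n Ω k :=
  ⟨isSmoothForm_framePair hρ hsub v, isClosed_closure.isCompact,
    (closure_framePair_subset x₀ ρ v).trans hΩ⟩

variable [MeasurableSpace M] [BorelSpace M] {ν : Measure M}

theorem IsSmoothForm.isMeasurableForm {θ : Form n M k} (hθ : IsSmoothForm θ) :
    IsMeasurableForm ν θ := by
  intro x₀
  have := ChartedSpace.secondCountable_of_sigmaCompact (EuclideanSpace ℝ (Fin n)) M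
  refine ContinuousOn.aestronglyMeasurable ?_ (isOpen_chartDom x₀).measurableSet
  exact (hθ x₀).continuousOn.comp ((continuousOn_extChartAt (I := 𝓡 n) x₀).mono
      (extChartAt_source (𝓡 n) x₀).symm.subset) fun p hp => ext_mem_target hp

theorem IsSmoothForm.mem_sqIntegrable [IsFiniteMeasure ν] {θ : Form n M k} (hθ : IsSmoothForm θ) :
    θ ∈ sqIntegrable n ν k := by
  have := ChartedSpace.secondCountable_of_sigmaCompact (EuclideanSpace ℝ (Fin n)) M
  exact ⟨hθ.isMeasurableForm, (continuous_formInner hθ hθ).integrable_of_hasCompactSupport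
    (HasCompactSupport.of_compactSpace _)⟩

/-- The class of a square integrable form. -/
noncomputable def toL2 (θ : Form n M k) (h : θ ∈ sqIntegrable n ν k) : L2Form n ν k :=
  SeparationQuotient.mk (toPreL2 θ h)

theorem isClassOf_toL2 {θ : Form n M k} (h : θ ∈ sqIntegrable n ν k) : IsClassOf θ (toL2 θ h) :=
  ⟨h, rfl⟩

theorem exists_isClassOf (a : L2Form n ν k) : ∃ θ, IsClassOf θ a := by
  obtain ⟨⟨θ, h⟩, rfl⟩ := SeparationQuotient.surjective_mk a
  exact ⟨θ, h, rfl⟩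

theorem IsClassOf.inner_eq {θ η : Form n M k} {a b : L2Form n ν k} (h1 : IsClassOf θ a)
    (h2 : IsClassOf η b) : inner ℝ a b = ∫ x, formInner (θ x) (η x) ∂ν := by
  obtain ⟨h1, rfl⟩ := h1
  obtain ⟨h2, rfl⟩ := h2
  rfl

theorem IsClassOf.norm_sq_eq {θ : Form n M k} {a : L2Form n ν k} (h : IsClassOf θ a) :
    ‖a‖ ^ 2 = ∫ x, formInner (θ x) (θ x) ∂ν := by
  rw [← h.inner_eq h, real_inner_self_eq_norm_sq]

theorem IsClassOf.unique {θ : Form n M k} {a b : L2Form n ν k} (h1 : IsClassOf θ a)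
    (h2 : IsClassOf θ b) : a = b := by
  obtain ⟨h1, rfl⟩ := h1
  obtain ⟨h2, rfl⟩ := h2
  rfl

theorem IsMeasurableForm.apply_frame {θ : Form n M k} (h : IsMeasurableForm ν θ) (x₀ : M)
    (v : Fin k → EuclideanSpace ℝ (Fin n)) :
    AEStronglyMeasurable (fun p => θ p (fun r => frame n x₀ p (v r)))
      (ν.restrict (chartDom n x₀)) := by
  have hcont : Continuous (fun β : EuclideanSpace ℝ (Fin n) [⋀^Fin k]→L[ℝ] ℝ => β v) := by fun_prop
  refine (hcont.comp_aestronglyMeasurable (h x₀)).congr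
    (ae_restrict_of_forall_mem (isOpen_chartDom x₀).measurableSet fun p hp => ?_)
  simp only
  rw [chartRep_ext hp]
  rfl

theorem exists_finite_chartDom_cover :
    ∃ t : Finset M, (univ : Set M) = ⋃ x ∈ t, chartDom n x := by
  obtain ⟨t, -, ht⟩ := isCompact_univ.elim_nhds_subcover
    (fun x : M => chartDom n x) (fun x _ => chart_source_mem_nhds _ x)
  exact ⟨t, (Set.eq_univ_of_univ_subset ht).symm⟩

/-- The special test forms are total in `L²`. -/
theorem eq_zero_of_inner_framePair {Ω : Set M} (hΩ : IsOpen Ω) [IsFiniteMeasure ν]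
    (a : L2Form n (ν.restrict Ω) k)
    (h : ∀ (x₀ : M) (ρ : M → ℝ) (v : Fin k → EuclideanSpace ℝ (Fin n)),
      ContMDiff (𝓡 n) 𝓘(ℝ, ℝ) ∞ ρ → tsupport ρ ⊆ chartDom n x₀ → tsupport ρ ⊆ Ω →
      ∀ p, IsClassOf (framePair x₀ ρ v) p → inner ℝ a p = 0) : a = 0 := by
  obtain ⟨α, hα⟩ := exists_isClassOf a
  have hα2 := hα.1
  rw [← inner_self_eq_zero (𝕜 := ℝ), hα.inner_eq hα]
  set b := (EuclideanSpace.basisFun (Fin n) ℝ).toBasis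
  have hloc : ∀ x₀ : M, ∀ J : Fin k → Fin n, ∀ᵐ p ∂(ν.restrict Ω), p ∈ Ω ∩ chartDom n x₀ →
      α p (fun r => frame n x₀ p (b (J r))) = 0 := by
    intro x₀ J
    -- The fundamental lemma of the calculus of variations for a single coefficient, with `ρ` as the
    -- test function.
    refine (hΩ.inter (isOpen_chartDom x₀)).ae_eq_zero_of_integral_contMDiff_smul_eq_zero (𝓡 n)
      ?_ ?_
    · have := ChartedSpace.locallyCompactSpace (EuclideanSpace ℝ (Fin n)) M
      rw [locallyIntegrableOn_iff (hΩ.inter (isOpen_chartDom x₀)).isLocallyClosed]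
      intro K hK hKc
      have hcont : ContinuousOn (fun p => Matrix.det (Matrix.of fun c d => inner ℝ
          (frame n x₀ p (b (J c))) (frame n x₀ p (b (J d))))) K :=
        (continuous_id (X := Matrix (Fin k) (Fin k) ℝ)).matrix_det.comp_continuousOn
          (continuousOn_pi.2 fun c => continuousOn_pi.2 fun d =>
          (contMDiffOn_inner_frame x₀ (b (J c)) (b (J d))).continuousOn.mono
            fun p hp => (hK hp).2)
      obtain ⟨B, hB⟩ := hKc.exists_bound_of_continuousOn hcont
      have hmeas : AEStronglyMeasurable (fun p => α p (fun r => frame n x₀ p (b (J r))))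
          ((ν.restrict Ω).restrict K) :=
        (hα2.1.apply_frame x₀ _).mono_measure (Measure.restrict_mono (fun p hp => (hK hp).2) le_rfl)
      -- The bound is `|t| ≤ 1 + t²` for the coefficient `t`, with `t²` estimated by `sq_apply_le`;
      -- the constant is integrable because `ν` is finite.
      refine Integrable.mono' (g := fun p => 1 + B * formInner (α p) (α p))
        ((integrable_const _).add ((hα2.2.restrict).const_mul B)) hmeas ?_
      refine ae_restrict_of_forall_mem hKc.measurableSet fun p hp => ?_
      have h1 := sq_apply_le (fun r => frame n x₀ p (b (J r))) (α p)
      have h2 := (le_abs_self _).trans (hB p hp)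
      have h3 := h1.trans (mul_le_mul_of_nonneg_right h2 (formInner_self_nonneg _))
      rw [Real.norm_eq_abs]
      nlinarith [sq_nonneg (|α p fun r => frame n x₀ p (b (J r))| - 1),
        sq_abs (α p fun r => frame n x₀ p (b (J r))), abs_nonneg (α p fun r => frame n x₀ p (b (J r)))]
    · intro ρ hρ _ hsub
      have hs1 : tsupport ρ ⊆ chartDom n x₀ := hsub.trans inter_subset_right
      have hs := isSmoothForm_framePair hρ.contMDiffOn hs1 (fun r => b (J r))
      have := h x₀ ρ (fun r => b (J r)) hρ hs1 (hsub.trans inter_subset_left) _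
        (isClassOf_toL2 hs.mem_sqIntegrable)
      rw [hα.inner_eq (isClassOf_toL2 _)] at this
      rw [← this]
      refine integral_congr_ae (Eventually.of_forall fun p => ?_)
      simp only
      rw [formInner_comm, formInner_framePair, smul_eq_mul]
  obtain ⟨t, ht⟩ := exists_finite_chartDom_cover (n := n) (M := M)
  -- Finitely many charts and multi-indices suffice, so the exceptional sets combine to a null set.
  have hall : ∀ᵐ p ∂(ν.restrict Ω), ∀ x₀ ∈ t, ∀ J : Fin k → Fin n, p ∈ Ω ∩ chartDom n x₀ →
      α p (fun r => frame n x₀ p (b (J r))) = 0 := by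
    rw [Finset.eventually_all]
    exact fun x₀ _ => eventually_all.2 (hloc x₀)
  refine integral_eq_zero_of_ae ?_
  filter_upwards [hall, ae_restrict_mem hΩ.measurableSet] with p hp hpΩ
  obtain ⟨x₀, hx₀, hpx⟩ : ∃ x ∈ t, p ∈ chartDom n x := by
    have : p ∈ (univ : Set M) := mem_univ p
    rw [ht] at this
    simpa using this
  have h0 : α p = 0 := by
    have : (α p).toAlternatingMap = 0 := by
      refine (b.map (frameEquiv hpx)).ext_alternating fun v _ => ?_
      exact hp x₀ hx₀ v ⟨hpΩ, hpx⟩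
    ext v
    exact congrArg (fun f : TangentSpace (𝓡 n) p [⋀^Fin k]→ₗ[ℝ] ℝ => f v) this
  rw [h0, formInner_zero_left]; rfl
end SmoothForms
end KreinFeller

namespace KreinFeller

/-! ### Functions vanishing off a compact subset of an open set. -/

section Calculus
variable {E F : Type*} [NormedAddCommGroup E] [NormedSpace ℝ E] [NormedAddCommGroup F]
  [NormedSpace ℝ F] {T K : Set E}

/-- Outside `T` the function is zero on the open complement of `K`. Expressions in a chart are
regular on its target only, hence the pair `K ⊆ T` in this and the following lemmas. -/
theorem continuous_of_zero_off {f : E → F} (hT : IsOpen T) (hK : IsClosed K) (hKT : K ⊆ T)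
    (hf : ContinuousOn f T) (h0 : ∀ y ∉ K, f y = 0) : Continuous f := by
  rw [continuous_iff_continuousAt]
  intro y
  by_cases hy : y ∈ T
  · exact hf.continuousAt (hT.mem_nhds hy)
  · have : f =ᶠ[𝓝 y] fun _ => 0 := by
      filter_upwards [hK.isOpen_compl.mem_nhds fun h => hy (hKT h)] with z hz using h0 z hz
    exact continuousAt_const.congr this.symm

theorem contDiff_of_zero_off {m : WithTop ℕ∞} {f : E → F} (hT : IsOpen T) (hK : IsClosed K)
    (hKT : K ⊆ T) (hf : ContDiffOn ℝ m f T) (h0 : ∀ y ∉ K, f y = 0) : ContDiff ℝ m f := by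
  rw [contDiff_iff_contDiffAt]
  intro y
  by_cases hy : y ∈ T
  · exact hf.contDiffAt (hT.mem_nhds hy)
  · have : f =ᶠ[𝓝 y] fun _ => 0 := by
      filter_upwards [hK.isOpen_compl.mem_nhds fun h => hy (hKT h)] with z hz using h0 z hz
    exact contDiffAt_const.congr_of_eventuallyEq this

theorem fderiv_zero_off {f : E → F} (hK : IsClosed K) (h0 : ∀ y ∉ K, f y = 0) :
    ∀ y ∉ K, fderiv ℝ f y = 0 := by
  intro y hy
  have : f =ᶠ[𝓝 y] fun _ => 0 := by
    filter_upwards [hK.isOpen_compl.mem_nhds hy] with z hz using h0 z hz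
  rw [this.fderiv_eq]; simp

variable [MeasurableSpace E] [BorelSpace E] [FiniteDimensional ℝ E] {μ : Measure E}
  [μ.IsAddHaarMeasure]

theorem integrable_of_zero_off {f : E → ℝ} (hK : IsCompact K) (hf : Continuous f)
    (h0 : ∀ y ∉ K, f y = 0) : Integrable f μ :=
  hf.integrable_of_hasCompactSupport (HasCompactSupport.intro hK h0)

/-- Integration by parts against a function supported in a compact subset of an open set. -/
theorem integral_mul_fderiv_of_zero_off {W h : E → ℝ} (hT : IsOpen T) (hK : IsCompact K)
    (hKT : K ⊆ T) (hW : ContDiff ℝ 1 W) (h0 : ∀ y ∉ K, W y = 0) (hh : ContDiffOn ℝ 1 h T) (v : E) :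
    ∫ y, W y * fderiv ℝ h y v ∂μ = -∫ y, fderiv ℝ W y v * h y ∂μ := by
  have hts : tsupport W ⊆ K := closure_minimal (fun y hy => by
    by_contra h; exact hy (h0 y h)) hK.isClosed
  have h0' := fderiv_zero_off hK.isClosed h0
  have hdh : ContinuousOn (fun y => fderiv ℝ h y v) T :=
    (hh.continuousOn_fderiv_of_isOpen hT le_rfl).clm_apply continuousOn_const
  have hdW : Continuous (fun y => fderiv ℝ W y v) :=
    (hW.continuous_fderiv one_ne_zero).clm_apply continuous_const
  refine integral_mul_fderiv_eq_neg_fderiv_mul_of_integrable ?_ ?_ ?_ ?_ ?_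
  · refine integrable_of_zero_off hK (continuous_of_zero_off hT hK.isClosed hKT
      (hdW.continuousOn.mul hh.continuousOn) ?_) ?_ <;>
    · intro y hy; rw [h0' y hy]; simp
  · refine integrable_of_zero_off hK (continuous_of_zero_off hT hK.isClosed hKT
      (hW.continuous.continuousOn.mul hdh) ?_) ?_ <;>
    · intro y hy; rw [h0 y hy, zero_mul]
  · refine integrable_of_zero_off hK (continuous_of_zero_off hT hK.isClosed hKT
      (hW.continuous.continuousOn.mul hh.continuousOn) ?_) ?_ <;>
    · intro y hy; rw [h0 y hy, zero_mul]
  · exact fun y _ => hW.differentiable one_ne_zero y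
  · exact fun y hy => (hh.contDiffAt (hT.mem_nhds (hKT (hts hy)))).differentiableAt one_ne_zero
end Calculus

/-! ### Existence of the codifferential on smooth forms. -/

section Adjoint
variable {n : ℕ} {M : Type*} [TopologicalSpace M] [ChartedSpace (EuclideanSpace ℝ (Fin n)) M]
  [IsManifold (𝓡 n) ∞ M] {k : ℕ}

theorem IsSmoothForm.add {θ η : Form n M k} (h1 : IsSmoothForm θ) (h2 : IsSmoothForm η) :
    IsSmoothForm (θ + η) := fun x₀ => by
  rw [chartRep_add]; exact (h1 x₀).add (h2 x₀)

theorem IsSmoothForm.smul {θ : Form n M k} (h1 : IsSmoothForm θ) (c : ℝ) :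
    IsSmoothForm (c • θ) := fun x₀ => by
  rw [chartRep_smul]; exact (h1 x₀).const_smul c

theorem isSmoothForm_zero : IsSmoothForm (0 : Form n M k) := fun x₀ => by
  rw [chartRep_zero]; exact contDiffOn_const

theorem isSmoothForm_sum {ι : Type*} (s : Finset ι) {θ : ι → Form n M k}
    (h : ∀ i ∈ s, IsSmoothForm (θ i)) : IsSmoothForm (∑ i ∈ s, θ i) := by
  classical
  induction s using Finset.induction_on with
  | empty => simpa using isSmoothForm_zero
  | insert a s ha ih =>
    rw [Finset.sum_insert ha]
    exact (h a (Finset.mem_insert_self a s)).add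
      (ih fun i hi => h i (Finset.mem_insert_of_mem hi))

theorem IsSmoothForm.mul_fun {θ : Form n M k} (h : IsSmoothForm θ) {f : M → ℝ}
    (hf : ContMDiff (𝓡 n) 𝓘(ℝ, ℝ) ∞ f) : IsSmoothForm (fun p => f p • θ p : Form n M k) := by
  intro x₀
  have h1 : ContDiffOn ℝ ∞ (fun y => f ((extChartAt (𝓡 n) x₀).symm y))
      (extChartAt (𝓡 n) x₀).target :=
    (hf.comp_contMDiffOn (contMDiffOn_extChartAt_symm (I := 𝓡 n) (n := ∞) x₀)).contDiffOn
  exact (h1.smul (h x₀)).congr fun y _ => by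
    ext v; rfl

variable [RiemannianBundle (fun x : M => TangentSpace (𝓡 n) x)]
  [IsContMDiffRiemannianBundle (𝓡 n) ∞ (EuclideanSpace ℝ (Fin n))
    (fun x : M => TangentSpace (𝓡 n) x)]
  [T2Space M] [CompactSpace M] [MeasurableSpace M] [BorelSpace M]

theorem integral_riemVol_eq_chart (x₀ : M) {f : M → ℝ} (hf : Continuous f)
    (h0 : ∀ p ∉ chartDom n x₀, f p = 0) :
    ∫ p, f p ∂(riemVol n M) = ∫ y in (extChartAt (𝓡 n) x₀).target,
      f ((extChartAt (𝓡 n) x₀).symm y) * volDensity x₀ y := by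
  have := ChartedSpace.secondCountable_of_sigmaCompact (EuclideanSpace ℝ (Fin n)) M
  rw [← integral_chartDom x₀ hf.aestronglyMeasurable,
    setIntegral_eq_integral_of_forall_compl_eq_zero h0]

/-- The exterior derivative evaluated on members of a family of vectors. -/
theorem extDeriv_basis {ι E : Type*} [NormedAddCommGroup E] [NormedSpace ℝ E]
    {α : E → E [⋀^Fin k]→L[ℝ] ℝ} {y : E} (h : DifferentiableAt ℝ α y) (b : ι → E)
    (J : Fin (k + 1) → ι) : extDeriv α y (fun r => b (J r)) =
      ∑ r : Fin (k + 1), (-1) ^ r.val * fderiv ℝ (fun z => α z (fun s => b (r.removeNth J s))) y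
        (b (J r)) := by
  rw [extDeriv_apply h]
  refine Finset.sum_congr rfl fun r _ => ?_
  simp only [zsmul_eq_mul, Int.cast_pow, Int.cast_neg, Int.cast_one]
  rfl

/-- In the chart `⟨ψ, dη⟩` is the integral of `∑ W_J (dη)_J / (k+1)!`, where the `W_J` are smooth
with compact support in the target. Since `(dη)_J` is an alternating sum of first derivatives of
coefficients of `η`, integration by parts moves the derivatives onto `W_J`, and what remains is a
pairing of `η` with an explicit sum of `framePair`s. -/
theorem exists_adjoint_of_chart {x₀ : M} {ψ : Form n M (k + 1)} (hψ : IsSmoothForm ψ)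
    (hsub : closure {p | ψ p ≠ 0} ⊆ chartDom n x₀) :
    ∃ ζ : Form n M k, IsSmoothForm ζ ∧ ∀ η : Form n M k, IsSmoothForm η →
      ∫ x, formInner (ζ x) (η x) ∂(riemVol n M) =
        ∫ x, formInner (ψ x) (extD η x) ∂(riemVol n M) := by
  classical
  set b := (EuclideanSpace.basisFun (Fin n) ℝ).toBasis
  set T := (extChartAt (𝓡 n) x₀).target with hT
  have hTo : IsOpen T := isOpen_target x₀
  set S := closure {p | ψ p ≠ 0} with hS
  have hSc : IsCompact S := isClosed_closure.isCompact
  set K := extChartAt (𝓡 n) x₀ '' S with hKdef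
  have hK : IsCompact K := hSc.image_of_continuousOn ((continuousOn_extChartAt x₀).mono
    (by rwa [extChartAt_source]))
  have hKT : K ⊆ T := by
    rintro _ ⟨p, hp, rfl⟩; exact ext_mem_target (hsub hp)
  have hψ0 : ∀ y ∈ T, y ∉ K → chartRep x₀ ψ y = 0 := by
    intro y hy hyK
    have h0 : ψ ((extChartAt (𝓡 n) x₀).symm y) = 0 := by
      by_contra h
      exact hyK ⟨_, subset_closure h, ext_right_inv hy⟩
    rw [chartRep, h0]; rfl
  -- the raised components of `ψ` times the volume density
  set W : (Fin (k + 1) → Fin n) → EuclideanSpace ℝ (Fin n) → ℝ := fun J => T.indicator fun y =>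
    ∑ I : Fin (k + 1) → Fin n, pairCoeff x₀ b I J y * chartRep x₀ ψ y (fun r => b (I r)) with hW
  have hW0 : ∀ J, ∀ y ∉ K, W J y = 0 := by
    intro J y hy
    by_cases hyT : y ∈ T
    · simp [hW, indicator_of_mem hyT, hψ0 y hyT hy]
    · simp [hW, indicator_of_notMem hyT]
  have hWs : ∀ J, ContDiff ℝ ∞ (W J) := by
    intro J
    refine contDiff_of_zero_off hTo hK.isClosed hKT ?_ (hW0 J)
    have h1 : ContDiffOn ℝ ∞ (fun y => ∑ I : Fin (k + 1) → Fin n,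
        pairCoeff x₀ b I J y * chartRep x₀ ψ y (fun r => b (I r))) T :=
      ContDiffOn.sum fun I _ => (contDiffOn_pairCoeff x₀ b I J).mul
        (contDiffOn_alternating_apply (hψ x₀) _)
    exact h1.congr fun y hy => indicator_of_mem hy _
  -- The division cancels the density of the Riemannian measure, so that integration over `M`
  -- returns a Lebesgue integral of the derivative of `W J`.
  set ρ : (Fin (k + 1) → Fin n) → Fin (k + 1) → M → ℝ := fun J r =>
    (chartDom n x₀).indicator fun p =>
      fderiv ℝ (W J) (extChartAt (𝓡 n) x₀ p) (b (J r)) / volDensity x₀ (extChartAt (𝓡 n) x₀ p)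
    with hρ
  have hρts : ∀ J r, tsupport (ρ J r) ⊆ S := by
    intro J r
    refine closure_minimal (fun p hp => ?_) isClosed_closure
    by_contra hpS
    refine hp ?_
    by_cases hpx : p ∈ chartDom n x₀
    · rw [hρ]
      simp only [indicator_of_mem hpx]
      have : extChartAt (𝓡 n) x₀ p ∉ K := by
        rintro ⟨q, hq, hqp⟩
        have := congrArg (extChartAt (𝓡 n) x₀).symm hqp
        rw [ext_left_inv (hsub hq), ext_left_inv hpx] at this
        exact hpS (this ▸ hq)
      rw [fderiv_zero_off hK.isClosed (hW0 J) _ this]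
      simp
    · simp [hρ, indicator_of_notMem hpx]
  have hρs : ∀ J r, ContMDiffOn (𝓡 n) 𝓘(ℝ, ℝ) ∞ (ρ J r) (chartDom n x₀) := by
    intro J r
    have h1 : ContDiffOn ℝ ∞ (fun y => fderiv ℝ (W J) y (b (J r)) / volDensity x₀ y) T := by
      refine ContDiffOn.div ?_ (contDiffOn_volDensity x₀) fun y hy => (volDensity_pos x₀ hy).ne'
      exact (((hWs J).fderiv_right (m := ∞) le_rfl).clm_apply contDiff_const).contDiffOn
    have h2 := h1.contMDiffOn.comp (contMDiffOn_extChartAt (I := 𝓡 n) (n := ∞) (x := x₀))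
      (fun p hp => ext_mem_target hp)
    exact h2.congr fun p hp => indicator_of_mem hp _
  have hfp : ∀ J r, IsSmoothForm (framePair x₀ (ρ J r) (fun s => b (r.removeNth J s))) :=
    fun J r => isSmoothForm_framePair (hρs J r) ((hρts J r).trans hsub) _
  -- The minus sign is that of the integration by parts, the factorial the normalization of
  -- `formInner` in degree `k + 1`, and `(-1) ^ r` the sign in the formula for `d`.
  refine ⟨(-(((k + 1).factorial : ℝ)⁻¹)) • ∑ J : Fin (k + 1) → Fin n, ∑ r : Fin (k + 1),
    ((-1 : ℝ) ^ r.val) • framePair x₀ (ρ J r) (fun s => b (r.removeNth J s)),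
    (isSmoothForm_sum _ fun J _ => isSmoothForm_sum _ fun r _ => (hfp J r).smul _).smul _, ?_⟩
  intro η hη
  have hηc : ∀ v : Fin k → EuclideanSpace ℝ (Fin n), ContDiffOn ℝ 1 (fun y => chartRep x₀ η y v) T :=
    fun v =>
    (contDiffOn_alternating_apply (f := chartRep x₀ η) (hη x₀) v).of_le (by simp)
  -- the left-hand side
  have hL : ∀ J r, ∫ x, formInner (framePair x₀ (ρ J r) (fun s => b (r.removeNth J s)) x) (η x)
      ∂(riemVol n M) = ∫ y, fderiv ℝ (W J) y (b (J r)) *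
        chartRep x₀ η y (fun s => b (r.removeNth J s)) := by
    intro J r
    rw [integral_riemVol_eq_chart x₀ (continuous_formInner (hfp J r) hη)]
    · refine Eq.trans ?_ (setIntegral_eq_integral_of_forall_compl_eq_zero (s := T) ?_)
      · refine setIntegral_congr_fun hTo.measurableSet fun y hy => ?_
        rw [formInner_framePair, chartRep_of_mem_target hy]
        simp only [hρ, indicator_of_mem (symm_mem_chartDom hy), ext_right_inv hy]
        have := (volDensity_pos x₀ hy).ne'
        rw [ContinuousAlternatingMap.compContinuousLinearMap_apply]
        field_simp
        rfl
      · intro y hy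
        rw [fderiv_zero_off hK.isClosed (hW0 J) y fun h => hy (hKT h)]
        simp
    · intro p hp
      rw [formInner_framePair]
      simp [hρ, indicator_of_notMem hp]
  have hL2 : ∫ x, formInner (((-(((k + 1).factorial : ℝ)⁻¹)) • ∑ J : Fin (k + 1) → Fin n,
      ∑ r : Fin (k + 1), ((-1 : ℝ) ^ r.val) •
        framePair x₀ (ρ J r) (fun s => b (r.removeNth J s)) : Form n M k) x) (η x)
      ∂(riemVol n M) = -((k + 1).factorial : ℝ)⁻¹ * ∑ J : Fin (k + 1) → Fin n,
        ∑ r : Fin (k + 1), (-1) ^ r.val * ∫ y, fderiv ℝ (W J) y (b (J r)) *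
        chartRep x₀ η y (fun s => b (r.removeNth J s)) := by
    simp only [Pi.smul_apply, Finset.sum_apply, formInner_smul_left, formInner_sum_left]
    rw [integral_const_mul, integral_finsetSum]
    · congr 1
      refine Finset.sum_congr rfl fun J _ => ?_
      rw [integral_finsetSum]
      · refine Finset.sum_congr rfl fun r _ => ?_
        rw [integral_const_mul, hL]
      · exact fun r _ => (integrable_formInner (hfp J r).mem_sqIntegrable
          hη.mem_sqIntegrable).const_mul _
    · exact fun J _ => integrable_finsetSum _ fun r _ =>
        (integrable_formInner (hfp J r).mem_sqIntegrable hη.mem_sqIntegrable).const_mul _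
  rw [hL2, integral_riemVol_eq_chart x₀ (continuous_formInner hψ (isSmoothForm_extD hη))]
  · have hWint : ∀ J r, Integrable (fun y => W J y *
        fderiv ℝ (fun z => chartRep x₀ η z (fun s => b (r.removeNth J s))) y (b (J r))) := by
      intro J r
      refine integrable_of_zero_off hK (continuous_of_zero_off hTo hK.isClosed hKT
        ((hWs J).continuous.continuousOn.mul
          (((hηc _).continuousOn_fderiv_of_isOpen hTo le_rfl).clm_apply
            continuousOn_const)) ?_) ?_ <;>
      · intro y hy; rw [hW0 J y hy, zero_mul]
    have hR : ∫ y in T, formInner (ψ ((extChartAt (𝓡 n) x₀).symm y))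
        (extD η ((extChartAt (𝓡 n) x₀).symm y)) * volDensity x₀ y =
        ∫ y, ((k + 1).factorial : ℝ)⁻¹ * ∑ J : Fin (k + 1) → Fin n, ∑ r : Fin (k + 1),
          (-1) ^ r.val * (W J y *
            fderiv ℝ (fun z => chartRep x₀ η z (fun s => b (r.removeNth J s))) y (b (J r))) := by
      refine Eq.trans ?_ (setIntegral_eq_integral_of_forall_compl_eq_zero (s := T) ?_)
      · refine setIntegral_congr_fun hTo.measurableSet fun y hy => ?_
        rw [formInner_mul_volDensity b hy, Finset.sum_comm, chartRep_extD hη hy]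
        congr 1
        refine Finset.sum_congr rfl fun J _ => ?_
        have hd : DifferentiableAt ℝ (chartRep x₀ η) y :=
          ((hη x₀).contDiffAt (hTo.mem_nhds hy)).differentiableAt (by simp)
        rw [extDeriv_basis hd b J]
        simp only [hW, indicator_of_mem hy]
        simp only [← mul_assoc, ← Finset.sum_mul]
        rw [Finset.mul_sum]
        refine Finset.sum_congr rfl fun r _ => by ring
      · intro y hy
        simp [hW, indicator_of_notMem hy]
    rw [hR, integral_const_mul, integral_finsetSum]
    · rw [neg_mul, ← mul_neg]
      congr 1
      rw [← Finset.sum_neg_distrib]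
      refine Finset.sum_congr rfl fun J _ => ?_
      rw [integral_finsetSum]
      · rw [← Finset.sum_neg_distrib]
        refine Finset.sum_congr rfl fun r _ => ?_
        rw [integral_const_mul, integral_mul_fderiv_of_zero_off hTo hK hKT
          ((hWs J).of_le (by simp)) (hW0 J) (hηc _), mul_neg]
      · exact fun r _ => (hWint J r).const_mul _
    · exact fun J _ => integrable_finsetSum _ fun r _ => (hWint J r).const_mul _
  · intro p hp
    have : ψ p = 0 := by by_contra h; exact hp (hsub (subset_closure h))
    rw [this, formInner_zero_left]

/-- The formal adjoint of `d` exists on all smooth forms. -/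
theorem exists_adjoint {θ : Form n M (k + 1)} (hθ : IsSmoothForm θ) :
    ∃ ζ : Form n M k, IsSmoothForm ζ ∧ ∀ η : Form n M k, IsSmoothForm η →
      ∫ x, formInner (ζ x) (η x) ∂(riemVol n M) =
        ∫ x, formInner (θ x) (extD η x) ∂(riemVol n M) := by
  obtain ⟨t, ht⟩ := exists_finite_chartDom_cover (n := n) (M := M)
  -- The required identity is linear in `θ`, so it is enough to treat the pieces `f i • θ`, each
  -- supported in one chart.
  obtain ⟨f, hf⟩ := SmoothPartitionOfUnity.exists_isSubordinate (𝓡 n) (isClosed_univ (X := M))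
    (fun x : t => chartDom n (x : M)) (fun x => isOpen_chartDom _)
    (by rw [ht]; simp [iUnion_subtype])
  have hsm : ∀ i : t, IsSmoothForm (fun p => f i p • θ p : Form n M (k + 1)) :=
    fun i => hθ.mul_fun (f i).contMDiff
  have hsp : ∀ i : t, closure {p | (fun p => f i p • θ p : Form n M (k + 1)) p ≠ 0} ⊆
      chartDom n (i : M) := fun i => by
    refine Subset.trans (closure_mono fun p hp => ?_) (hf i)
    by_contra h0
    refine hp ?_
    have : f i p = 0 := by simpa using h0
    simp only [this, zero_smul]
  choose ζ hζs hζ using fun i : t => exists_adjoint_of_chart (hsm i) (hsp i)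
  refine ⟨∑ i, ζ i, isSmoothForm_sum _ fun i _ => hζs i, fun η hη => ?_⟩
  have hdη := isSmoothForm_extD hη
  simp only [Finset.sum_apply, formInner_sum_left]
  rw [integral_finsetSum _ fun i _ =>
    integrable_formInner (hζs i).mem_sqIntegrable hη.mem_sqIntegrable]
  simp only [hζ _ η hη]
  rw [← integral_finsetSum _ fun i _ =>
    integrable_formInner (hsm i).mem_sqIntegrable hdη.mem_sqIntegrable]
  refine integral_congr_ae (Eventually.of_forall fun p => ?_)
  simp only [formInner_smul_left]
  rw [← Finset.sum_mul, ← finsum_eq_sum_of_fintype, f.sum_eq_one (mem_univ p), one_mul]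

theorem isSmoothForm_adjD {θ : Form n M (k + 1)} (hθ : IsSmoothForm θ) :
    IsSmoothForm (adjD θ) := by
  rw [adjD, dif_pos (exists_adjoint hθ)]
  exact (exists_adjoint hθ).choose_spec.1

theorem integral_adjD {θ : Form n M (k + 1)} (hθ : IsSmoothForm θ) {η : Form n M k}
    (hη : IsSmoothForm η) : ∫ x, formInner (adjD θ x) (η x) ∂(riemVol n M) =
      ∫ x, formInner (θ x) (extD η x) ∂(riemVol n M) := by
  rw [adjD, dif_pos (exists_adjoint hθ)]
  exact (exists_adjoint hθ).choose_spec.2 η hη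
end Adjoint
end KreinFeller

namespace KreinFeller

/-! ### Weak derivatives of test forms and their uniqueness. -/

section Weak
variable {n : ℕ} {M : Type*} [TopologicalSpace M] [ChartedSpace (EuclideanSpace ℝ (Fin n)) M]
  [IsManifold (𝓡 n) ∞ M] {k : ℕ}
  [RiemannianBundle (fun x : M => TangentSpace (𝓡 n) x)]
  [IsContMDiffRiemannianBundle (𝓡 n) ∞ (EuclideanSpace ℝ (Fin n))
    (fun x : M => TangentSpace (𝓡 n) x)]
  [T2Space M] [CompactSpace M] [MeasurableSpace M] [BorelSpace M] {Ω : Set M}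

theorem eq_zero_of_notMem_testForms {φ : Form n M k} (hφ : φ ∈ testForms n Ω k) {p : M}
    (hp : p ∉ Ω) : φ p = 0 := by
  by_contra h; exact hp (hφ.2.2 (subset_closure h))

theorem setIntegral_testForms {ν : Measure M} {φ : Form n M k} (hφ : φ ∈ testForms n Ω k)
    (η : Form n M k) :
    ∫ x in Ω, formInner (φ x) (η x) ∂ν = ∫ x, formInner (φ x) (η x) ∂ν :=
  setIntegral_eq_integral_of_forall_compl_eq_zero fun p hp => by
    rw [eq_zero_of_notMem_testForms hφ hp, formInner_zero_left]

/-- The adjoint relation holds over `M`, and both integrands vanish off `Ω` because `φ` and `dφ` do.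
No support condition on `ψ` is needed, which allows use on sets other than a neighbourhood of its
support. -/
theorem integral_adjD_testForms {φ : Form n M k} {ψ : Form n M (k + 1)} (hφ : φ ∈ testForms n Ω k)
    (hψ : IsSmoothForm ψ) :
    ∫ x in Ω, formInner (adjD ψ x) (φ x) ∂(riemVol n M) =
      ∫ x in Ω, formInner (ψ x) (extD φ x) ∂(riemVol n M) := by
  have hcl : ∀ p, p ∉ Ω → formInner (ψ p) (extD φ p) = 0 := fun p hp => by
    rw [extD_eq_zero_of_notMem fun hc => hp (hφ.2.2 hc), formInner_zero_right]
  rw [setIntegral_eq_integral_of_forall_compl_eq_zero hcl, ← integral_adjD hψ hφ.1]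
  refine setIntegral_eq_integral_of_forall_compl_eq_zero fun p hp => ?_
  rw [eq_zero_of_notMem_testForms hφ hp, formInner_zero_right]

theorem isSmoothForm_coD : ∀ {k : ℕ} {θ : Form n M k}, IsSmoothForm θ → IsSmoothForm (coD θ)
  | 0, _, _ => isSmoothForm_zero
  | _ + 1, _, h => isSmoothForm_adjD h

theorem isWeakD_of_isClassOf {φ : Form n M k} (hφ : φ ∈ testForms n Ω k)
    {u : L2Form n ((riemVol n M).restrict Ω) k} {a : L2Form n ((riemVol n M).restrict Ω) (k + 1)}
    (hu : IsClassOf φ u) (ha : IsClassOf (extD φ) a) : IsWeakD u a := by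
  intro ψ hψ p q hp hq
  rw [ha.inner_eq hp, hu.inner_eq hq]
  simp only [formInner_comm (φ _), formInner_comm (extD φ _)]
  exact (integral_adjD_testForms hφ hψ.1).symm

theorem isWeakCoD_of_isClassOf : ∀ {k : ℕ} {φ : Form n M k}, φ ∈ testForms n Ω k →
    ∀ {u : L2Form n ((riemVol n M).restrict Ω) k}
      {a : L2Form n ((riemVol n M).restrict Ω) (k - 1)},
    IsClassOf φ u → IsClassOf (coD φ) a → IsWeakCoD u a
  | 0, _, _, _, _, _, ha => ha.unique (IsClassOf.zero _)
  | k + 1, φ, hφ, u, a, hu, ha => by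
    intro ψ hψ p q hp hq
    have ha' : IsClassOf (adjD φ) (show L2Form n ((riemVol n M).restrict Ω) k from a) := ha
    rw [ha'.inner_eq hp, hu.inner_eq hq]
    exact integral_adjD_testForms hψ hφ.1

/-- A smooth form with compact support as an element of the Sobolev space. -/
noncomputable def testLift (φ : Form n M k) (hφ : IsSmoothForm φ) : SobolevAmbient n Ω k :=
  WithLp.toLp 2 (toL2 φ hφ.mem_sqIntegrable,
    WithLp.toLp 2 (toL2 (extD φ) (isSmoothForm_extD hφ).mem_sqIntegrable,
      toL2 (coD φ) (isSmoothForm_coD hφ).mem_sqIntegrable))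

theorem testLift_mem_sobolev {φ : Form n M k} (hφ : φ ∈ testForms n Ω k) :
    testLift (Ω := Ω) φ hφ.1 ∈ sobolev n Ω k :=
  ⟨isWeakD_of_isClassOf hφ (isClassOf_toL2 _) (isClassOf_toL2 _),
    isWeakCoD_of_isClassOf hφ (isClassOf_toL2 _) (isClassOf_toL2 _)⟩

/-- `IsWeakD` constrains only those test forms whose adjoint has an L² class. Adjoints of test forms
are smooth, so this is all of them, and the test forms are total. -/
theorem eq_of_isWeakD (hΩ : IsOpen Ω) {u : L2Form n ((riemVol n M).restrict Ω) k}
    {a a' : L2Form n ((riemVol n M).restrict Ω) (k + 1)} (h : IsWeakD u a) (h' : IsWeakD u a') :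
    a = a' := by
  rw [← sub_eq_zero]
  refine eq_zero_of_inner_framePair hΩ _ fun x₀ ρ v hρ h1 h2 p hp => ?_
  have ht : framePair x₀ ρ v ∈ testForms n Ω (k + 1) :=
    framePair_mem_testForms hρ.contMDiffOn h1 h2 v
  have hq := isClassOf_toL2 (ν := (riemVol n M).restrict Ω) (isSmoothForm_adjD ht.1).mem_sqIntegrable
  rw [inner_sub_left, h _ ht _ _ hp hq, h' _ ht _ _ hp hq, sub_self]

theorem eq_of_isWeakCoD (hΩ : IsOpen Ω) : ∀ {k : ℕ} {u : L2Form n ((riemVol n M).restrict Ω) k}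
    {a a' : L2Form n ((riemVol n M).restrict Ω) (k - 1)}, IsWeakCoD u a → IsWeakCoD u a' → a = a'
  | 0, _, _, _, h, h' => Eq.trans h (Eq.symm h')
  | k + 1, u, a, a', h, h' => by
    have key : (show L2Form n ((riemVol n M).restrict Ω) k from a) -
        (show L2Form n ((riemVol n M).restrict Ω) k from a') = 0 := by
      refine eq_zero_of_inner_framePair hΩ _ fun x₀ ρ v hρ h1 h2 p hp => ?_
      have ht : framePair x₀ ρ v ∈ testForms n Ω k :=
        framePair_mem_testForms hρ.contMDiffOn h1 h2 v
      have hq := isClassOf_toL2 (ν := (riemVol n M).restrict Ω)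
        (isSmoothForm_extD ht.1).mem_sqIntegrable
      have e1 := h _ ht _ _ hp hq
      have e2 := h' _ ht _ _ hp hq
      rw [inner_sub_left, e1]
      exact sub_eq_zero.2 e2.symm
    exact sub_eq_zero.1 key

/-- The weak derivatives of a test form are its classical ones. -/
theorem eq_testLift (hΩ : IsOpen Ω) {w : SobolevAmbient n Ω k} (hw : w ∈ sobolev n Ω k)
    {φ : Form n M k} (hφ : φ ∈ testForms n Ω k) (h : IsClassOf φ w.fst) :
    w = testLift φ hφ.1 := by
  have h0 : w.fst = (testLift (Ω := Ω) φ hφ.1).fst := h.unique (isClassOf_toL2 _)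
  have h1 : w.snd.fst = (testLift (Ω := Ω) φ hφ.1).snd.fst :=
    eq_of_isWeakD hΩ hw.1 (isWeakD_of_isClassOf hφ h (isClassOf_toL2 _))
  have h2 : w.snd.snd = (testLift (Ω := Ω) φ hφ.1).snd.snd :=
    eq_of_isWeakCoD hΩ hw.2 (isWeakCoD_of_isClassOf hφ h (isClassOf_toL2 _))
  refine WithLp.ofLp_injective 2 (Prod.ext h0 (WithLp.ofLp_injective 2 (Prod.ext h1 h2)))

theorem energy_testLift (φ : Form n M k) (hφ : IsSmoothForm φ) :
    energy (testLift (Ω := Ω) φ hφ) (testLift (Ω := Ω) φ hφ) =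
      ∫ x in Ω, (formInner (extD φ x) (extD φ x) + formInner (coD φ x) (coD φ x))
        ∂(riemVol n M) := by
  have h1 := isSmoothForm_extD hφ
  have h2 := isSmoothForm_coD hφ
  rw [integral_add (integrable_formInner h1.mem_sqIntegrable h1.mem_sqIntegrable)
    (integrable_formInner h2.mem_sqIntegrable h2.mem_sqIntegrable)]
  rfl

/-- The Poincaré inequality on the graph of the test forms. -/
theorem PoincareInequality.norm_sq_le {μ : Measure M} (hΩ : IsOpen Ω) {C : ℝ}
    (h : PoincareInequality n μ Ω k C) {z : SobolevAmbient n Ω k × L2Form n (μ.restrict Ω) k}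
    (hz : z ∈ testGraph n μ Ω k) : ‖z.2‖ ^ 2 ≤ C * energy z.1 z.1 := by
  obtain ⟨h1, φ, hφ, h2, h3⟩ := hz
  rw [h3.norm_sq_eq, eq_testLift hΩ h1 hφ h2, energy_testLift]
  exact h φ hφ

/-- The test forms are total in `L²(μ)`. -/
theorem eq_zero_of_inner_testGraph {μ : Measure M} [IsFiniteMeasure μ] (hΩ : IsOpen Ω)
    (a : L2Form n (μ.restrict Ω) k) (h : ∀ z ∈ testGraph n μ Ω k, inner ℝ a z.2 = 0) : a = 0 := by
  refine eq_zero_of_inner_framePair hΩ _ fun x₀ ρ v hρ h1 h2 p hp => ?_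
  have ht : framePair x₀ ρ v ∈ testForms n Ω k := framePair_mem_testForms hρ.contMDiffOn h1 h2 v
  exact h (testLift _ ht.1, p) ⟨testLift_mem_sobolev ht, _, ht, isClassOf_toL2 _, hp⟩

theorem exists_mem_testGraph (μ : Measure M) [IsFiniteMeasure μ] {w : SobolevAmbient n Ω k}
    (hw : w ∈ sobolevTest n Ω k) : ∃ a, (w, a) ∈ testGraph n μ Ω k := by
  obtain ⟨h1, φ, hφ, h2⟩ := hw
  exact ⟨toL2 φ hφ.1.mem_sqIntegrable, h1, φ, hφ, h2, isClassOf_toL2 _⟩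
end Weak
end KreinFeller

namespace KreinFeller

/-! ### Completeness of the spaces of square integrable forms. -/

section AlternatingLimit
variable {V : Type*} [NormedAddCommGroup V] [InnerProductSpace ℝ V] [FiniteDimensional ℝ V]
  {k : ℕ}

theorem tendsto_alternating_of_apply {E : Type*} [NormedAddCommGroup E] [NormedSpace ℝ E]
    [FiniteDimensional ℝ E] {β : ℕ → E [⋀^Fin k]→L[ℝ] ℝ} {γ : E [⋀^Fin k]→L[ℝ] ℝ}
    (h : ∀ v, Tendsto (fun N => β N v) atTop (𝓝 (γ v))) : Tendsto β atTop (𝓝 γ) := by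
  obtain ⟨G, hG⟩ := exists_leftInverse_evalBasis (k := k) (Module.finBasis ℝ E)
  rw [← hG γ]
  refine Tendsto.congr (fun N => hG (β N)) ?_
  exact (G.continuous.tendsto _).comp (tendsto_pi_nhds.2 fun J => h _)

theorem exists_alternating_limit {E : Type*} [NormedAddCommGroup E] [NormedSpace ℝ E]
    [FiniteDimensional ℝ E] {β : ℕ → E [⋀^Fin k]→L[ℝ] ℝ}
    (h : ∀ v, CauchySeq fun N => β N v) :
    ∃ γ : E [⋀^Fin k]→L[ℝ] ℝ, ∀ v, Tendsto (fun N => β N v) atTop (𝓝 (γ v)) := by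
  obtain ⟨G, hG⟩ := exists_leftInverse_evalBasis (k := k) (Module.finBasis ℝ E)
  choose l hl using fun v => cauchySeq_tendsto_of_complete (h v)
  refine ⟨G fun J => l fun r => Module.finBasis ℝ E (J r), fun v => ?_⟩
  have h1 : Tendsto β atTop (𝓝 (G fun J => l fun r => Module.finBasis ℝ E (J r))) := by
    refine Tendsto.congr (fun N => hG (β N)) ?_
    exact (G.continuous.tendsto _).comp (tendsto_pi_nhds.2 fun J => hl _)
  exact ((ContinuousAlternatingMap.apply ℝ E ℝ v).continuous.tendsto _).comp h1

theorem tendsto_formInner {β : ℕ → V [⋀^Fin k]→L[ℝ] ℝ} {γ : V [⋀^Fin k]→L[ℝ] ℝ}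
    (h : ∀ v, Tendsto (fun N => β N v) atTop (𝓝 (γ v))) (δ : V [⋀^Fin k]→L[ℝ] ℝ) :
    Tendsto (fun N => formInner (β N - δ) (β N - δ)) atTop (𝓝 (formInner (γ - δ) (γ - δ))) := by
  simp only [formInner, ContinuousAlternatingMap.sub_apply]
  exact tendsto_const_nhds.mul (tendsto_finsetSum _ fun J _ =>
    ((h _).sub tendsto_const_nhds).mul ((h _).sub tendsto_const_nhds))

/-- By `sq_apply_le` the increments of each evaluation are at most a constant times `√(1/2) ^ N`.
The weight `2 ^ N` thus turns a bound on squares into a geometric rate for the values. -/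
theorem cauchySeq_apply_of_formInner_le {β : ℕ → V [⋀^Fin k]→L[ℝ] ℝ} {S : ℝ}
    (h : ∀ N, (2 : ℝ) ^ N * formInner (β (N + 1) - β N) (β (N + 1) - β N) ≤ S) (v : Fin k → V) :
    CauchySeq fun N => β N v := by
  set D := Matrix.det (Matrix.of fun a b => inner ℝ (v a) (v b))
  have hD : 0 ≤ D := by
    have : D = formInner (flatWedge v) (flatWedge v) := by
      rw [formInner_flatWedge, flatWedge_apply]
    rw [this]; exact formInner_self_nonneg _
  set r := Real.sqrt (1 / 2) with hr
  have hr2 : r ^ 2 = 1 / 2 := Real.sq_sqrt (by norm_num)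
  have hr0 : 0 ≤ r := Real.sqrt_nonneg _
  have hr1 : r < 1 := by nlinarith
  refine cauchySeq_of_le_geometric r (Real.sqrt (D * S)) hr1 fun N => ?_
  rw [dist_comm, Real.dist_eq, ← ContinuousAlternatingMap.sub_apply]
  have h1 := sq_apply_le v (β (N + 1) - β N)
  have h2 : formInner (β (N + 1) - β N) (β (N + 1) - β N) ≤ S * (1 / 2) ^ N := by
    have := h N
    rw [one_div, inv_pow, ← div_eq_mul_inv, le_div_iff₀ (by positivity)]
    linarith
  have h3 : ((β (N + 1) - β N) v) ^ 2 ≤ D * S * (1 / 2) ^ N :=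
    h1.trans (by rw [mul_assoc]; exact mul_le_mul_of_nonneg_left h2 hD)
  have h4 : Real.sqrt (D * S * (1 / 2) ^ N) = Real.sqrt (D * S) * r ^ N := by
    rw [Real.sqrt_mul' _ (by positivity), ← hr2, ← pow_mul, mul_comm 2 N, pow_mul,
      Real.sqrt_sq (by positivity)]
  rw [← h4]
  exact Real.abs_le_sqrt h3
end AlternatingLimit

section Complete
variable {n : ℕ} {M : Type*} [TopologicalSpace M] [ChartedSpace (EuclideanSpace ℝ (Fin n)) M]
  [IsManifold (𝓡 n) ∞ M] {k : ℕ}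
  [RiemannianBundle (fun x : M => TangentSpace (𝓡 n) x)]
  [IsContMDiffRiemannianBundle (𝓡 n) ∞ (EuclideanSpace ℝ (Fin n))
    (fun x : M => TangentSpace (𝓡 n) x)]
  [T2Space M] [CompactSpace M] [MeasurableSpace M] [BorelSpace M] {ν : Measure M}

theorem isMeasurableForm_sub {θ η : Form n M k}
    (hθ : IsMeasurableForm ν θ) (hη : IsMeasurableForm ν η) : IsMeasurableForm ν (θ - η) := by
  have := isMeasurableForm_add hθ (isMeasurableForm_smul (-1) hη)
  have e1 : θ - η = θ + (-1 : ℝ) • η := by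
    funext x
    ext v
    simp [sub_eq_add_neg]
  rwa [e1]

theorem lintegral_formInner_eq {θ : Form n M k} (h : θ ∈ sqIntegrable n ν k) :
    ∫⁻ x, ENNReal.ofReal (formInner (θ x) (θ x)) ∂ν =
      ENNReal.ofReal (∫ x, formInner (θ x) (θ x) ∂ν) :=
  (ofReal_integral_eq_lintegral_ofReal h.2
    (Eventually.of_forall fun _ => formInner_self_nonneg _)).symm

theorem exists_form_limit_at {U : ℕ → Form n M k} {x : M} {S : ℝ} (hS : ∀ N, (2 : ℝ) ^ N *
    formInner (U (N + 1) x - U N x) (U (N + 1) x - U N x) ≤ S) :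
    ∃ γ : TangentSpace (𝓡 n) x [⋀^Fin k]→L[ℝ] ℝ,
      ∀ v : Fin k → TangentSpace (𝓡 n) x, Tendsto (fun N => U N x v) atTop (𝓝 (γ v)) := by
  have h1 : ∀ v : Fin k → TangentSpace (𝓡 n) x, CauchySeq (fun N => U N x v) := fun v =>
    cauchySeq_apply_of_formInner_le (V := TangentSpace (𝓡 n) x) (β := fun N => U N x) hS v
  exact exists_alternating_limit (E := TangentSpace (𝓡 n) x) (β := fun N => U N x) h1

/-- The Riesz–Fischer theorem for square integrable forms. -/
instance completeSpace_preL2Form : CompleteSpace (PreL2Form n ν k) := by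
  classical
  -- Distances below `2⁻ᴺ` give squared norms below `4⁻ᴺ`, which remain summable after
  -- multiplication by the weight `2ᴺ`.
  refine Metric.complete_of_convergent_controlled_sequences (fun N => (1 / 2 : ℝ) ^ N)
    (fun N => by positivity) fun u hu => ?_
  set U : ℕ → Form n M k := fun N => (u N).1 with hU
  have hUs : ∀ N, U N ∈ sqIntegrable n ν k := fun N => (u N).2
  have hsub : ∀ a b, U a - U b ∈ sqIntegrable n ν k := fun a b => sub_mem (hUs a) (hUs b)
  have hdist : ∀ N a b, N ≤ a → N ≤ b →
      ∫⁻ x, ENNReal.ofReal (formInner ((U a - U b) x) ((U a - U b) x)) ∂ν ≤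
        ENNReal.ofReal ((1 / 4 : ℝ) ^ N) := by
    intro N a b ha hb
    rw [lintegral_formInner_eq (hsub a b)]
    refine ENNReal.ofReal_le_ofReal ?_
    have h1 := hu N a b ha hb
    rw [dist_eq_norm] at h1
    have h2 : ∫ x, formInner ((U a - U b) x) ((U a - U b) x) ∂ν = ‖u a - u b‖ ^ 2 :=
      real_inner_self_eq_norm_sq (u a - u b)
    rw [h2]
    calc ‖u a - u b‖ ^ 2 ≤ ((1 / 2 : ℝ) ^ N) ^ 2 := by gcongr
      _ = (1 / 4 : ℝ) ^ N := by rw [← pow_mul, mul_comm, pow_mul]; norm_num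
  have hmeas : ∀ a b, AEMeasurable
      (fun x => ENNReal.ofReal (formInner ((U a - U b) x) ((U a - U b) x))) ν :=
    fun a b => (hsub a b).2.1.aemeasurable.ennreal_ofReal
  -- almost everywhere bound on the weighted sum of the increments
  have hsum : ∫⁻ x, ∑' N, ENNReal.ofReal ((2 : ℝ) ^ N) *
      ENNReal.ofReal (formInner ((U (N + 1) - U N) x) ((U (N + 1) - U N) x)) ∂ν ≠ ⊤ := by
    rw [lintegral_tsum fun N => (hmeas _ _).const_mul _]
    have hle : ∀ N, ∫⁻ x, ENNReal.ofReal ((2 : ℝ) ^ N) *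
        ENNReal.ofReal (formInner ((U (N + 1) - U N) x) ((U (N + 1) - U N) x)) ∂ν ≤
        ENNReal.ofReal ((1 / 2 : ℝ) ^ N) := by
      intro N
      rw [lintegral_const_mul' _ _ ENNReal.ofReal_ne_top]
      refine (mul_le_mul_right (hdist N (N + 1) N (by omega) le_rfl) _).trans ?_
      rw [← ENNReal.ofReal_mul (by positivity), ← mul_pow]
      norm_num
    refine ne_top_of_le_ne_top ?_ (ENNReal.tsum_le_tsum hle)
    rw [← ENNReal.ofReal_tsum_of_nonneg (fun N => by positivity) summable_geometric_two]
    exact ENNReal.ofReal_ne_top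
  have hae : ∀ᵐ x ∂ν, ∃ S : ℝ, ∀ N, (2 : ℝ) ^ N *
      formInner (U (N + 1) x - U N x) (U (N + 1) x - U N x) ≤ S := by
    have h1 := ae_lt_top' (AEMeasurable.tsum fun N => (hmeas (N + 1) N).const_mul _) hsum
    filter_upwards [h1] with x hx
    refine ⟨(∑' N, ENNReal.ofReal ((2 : ℝ) ^ N) *
      ENNReal.ofReal (formInner ((U (N + 1) - U N) x) ((U (N + 1) - U N) x))).toReal, fun N => ?_⟩
    rw [← ENNReal.ofReal_le_iff_le_toReal hx.ne, ENNReal.ofReal_mul (by positivity)]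
    exact ENNReal.le_tsum (f := fun N => ENNReal.ofReal ((2 : ℝ) ^ N) *
      ENNReal.ofReal (formInner ((U (N + 1) - U N) x) ((U (N + 1) - U N) x))) N
  have hlim : ∀ x, ∃ γ : TangentSpace (𝓡 n) x [⋀^Fin k]→L[ℝ] ℝ,
      (∃ S : ℝ, ∀ N, (2 : ℝ) ^ N *
        formInner (U (N + 1) x - U N x) (U (N + 1) x - U N x) ≤ S) →
      ∀ v, Tendsto (fun N => U N x v) atTop (𝓝 (γ v)) := by
    intro x
    by_cases hx : ∃ S : ℝ, ∀ N, (2 : ℝ) ^ N *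
        formInner (U (N + 1) x - U N x) (U (N + 1) x - U N x) ≤ S
    · obtain ⟨S, hS⟩ := hx
      obtain ⟨γ, hγ⟩ := exists_form_limit_at hS
      exact ⟨γ, fun _ => hγ⟩
    -- On the null set without a bound the value of the limit form is irrelevant.
    · exact ⟨0, fun h => absurd h hx⟩
  choose θ hθ using hlim
  have hθ' : ∀ᵐ x ∂ν, ∀ v, Tendsto (fun N => U N x v) atTop (𝓝 (θ x v)) :=
    hae.mono fun x hx => hθ x hx
  have hθm : IsMeasurableForm ν θ := by
    intro x₀
    refine aestronglyMeasurable_of_tendsto_ae atTop (fun N => (hUs N).1 x₀) ?_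
    filter_upwards [ae_restrict_of_ae hθ', ae_restrict_mem (isOpen_chartDom x₀).measurableSet]
      with x hx hxs
    refine tendsto_alternating_of_apply fun v => ?_
    simp only [chartRep_ext hxs]
    exact hx _
  -- Fatou's lemma, in the sequence index with `m` fixed. The bound yields both the square
  -- integrability of the limit and the convergence in norm.
  have hfatou : ∀ m, ∫⁻ x, ENNReal.ofReal (formInner ((θ - U m) x) ((θ - U m) x)) ∂ν ≤
      ENNReal.ofReal ((1 / 4 : ℝ) ^ m) := by
    intro m
    have h1 : ∫⁻ x, ENNReal.ofReal (formInner ((θ - U m) x) ((θ - U m) x)) ∂ν ≤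
        ∫⁻ x, liminf (fun N =>
          ENNReal.ofReal (formInner ((U N - U m) x) ((U N - U m) x))) atTop ∂ν := by
      refine lintegral_mono_ae ?_
      filter_upwards [hθ'] with x hx
      have := (ENNReal.continuous_ofReal.tendsto _).comp (tendsto_formInner hx (U m x))
      exact this.liminf_eq.symm.le
    refine h1.trans ((lintegral_liminf_le' fun N => hmeas N m).trans ?_)
    refine liminf_le_of_frequently_le' (Eventually.frequently ?_)
    filter_upwards [eventually_ge_atTop m] with N hN using hdist m N m hN le_rfl
  have hdiff : ∀ m, θ - U m ∈ sqIntegrable n ν k := by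
    intro m
    have hm := isMeasurableForm_sub hθm (hUs m).1
    refine ⟨hm, aestronglyMeasurable_formInner hm hm, ?_⟩
    rw [hasFiniteIntegral_iff_ofReal (Eventually.of_forall fun x => formInner_self_nonneg _)]
    exact (hfatou m).trans_lt ENNReal.ofReal_lt_top
  have hθs : θ ∈ sqIntegrable n ν k := by
    have := add_mem (hdiff 0) (hUs 0)
    rwa [sub_add_cancel] at this
  refine ⟨toPreL2 θ hθs, ?_⟩
  rw [tendsto_iff_dist_tendsto_zero]
  refine squeeze_zero (fun _ => dist_nonneg) (fun m => ?_)
    (tendsto_pow_atTop_nhds_zero_of_lt_one (by norm_num : (0 : ℝ) ≤ 1 / 2) (by norm_num))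
  rw [dist_comm, dist_eq_norm]
  refine abs_le_of_sq_le_sq' ?_ (by positivity) |>.2
  have h2 : ∫ x, formInner ((θ - U m) x) ((θ - U m) x) ∂ν = ‖toPreL2 θ hθs - u m‖ ^ 2 :=
    real_inner_self_eq_norm_sq (toPreL2 θ hθs - u m)
  refine h2.symm.le.trans ?_
  have h3 := hfatou m
  rw [lintegral_formInner_eq (hdiff m), ENNReal.ofReal_le_ofReal_iff (by positivity)] at h3
  refine h3.trans (le_of_eq ?_)
  rw [← pow_mul, mul_comm, pow_mul]; norm_num

instance completeSpace_l2Form : CompleteSpace (L2Form n ν k) :=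
  SeparationQuotient.instCompleteSpace
end Complete
end KreinFeller

namespace KreinFeller

/-! ### Combinatorics of Gaffney's identity. -/

section Algebra
variable {ι : Type*} [Fintype ι]

/-- Summation over multi-indices with a distinguished entry, moved to the front. -/
theorem sum_sum_removeNth {k : ℕ} (G : ι → (Fin (k + 1) → ι) → (Fin k → ι) → ℝ)
    (hG : ∀ i (r : Fin (k + 1)) j J K,
      G i (r.insertNth j J) K = (-1) ^ r.val * G i (Fin.cons j J) K) :
    ∑ I : Fin (k + 1) → ι, ∑ r : Fin (k + 1), (-1) ^ r.val * G (I r) I (r.removeNth I) =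
      (k + 1) * ∑ i, ∑ J, G i (Fin.cons i J) J := by
  rw [Finset.sum_comm]
  -- Every position `r` contributes the same amount: moving the entry to the front produces a second
  -- `(-1) ^ r`, and the two signs cancel.
  have h : ∀ r : Fin (k + 1), ∑ I : Fin (k + 1) → ι, (-1) ^ r.val * G (I r) I (r.removeNth I) =
      ∑ i, ∑ J, G i (Fin.cons i J) J := by
    intro r
    rw [← Fintype.sum_prod_type', ← (Fin.insertNthEquiv (fun _ => ι) r).sum_comp]
    refine Finset.sum_congr rfl fun p _ => ?_
    change (-1) ^ r.val * G ((r.insertNth p.1 p.2 : Fin (k + 1) → ι) r) (r.insertNth p.1 p.2)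
      (r.removeNth (r.insertNth p.1 p.2 : Fin (k + 1) → ι)) = _
    rw [Fin.insertNth_apply_same, Fin.removeNth_insertNth, hG, ← mul_assoc, ← mul_pow]
    norm_num
  rw [Finset.sum_congr rfl fun r _ => h r]
  simp

/-- The algebraic part of Gaffney's identity. -/
theorem sum_sq_alternation {m : ℕ} (A : ι → (Fin (m + 1) → ι) → ℝ) (D : (Fin (m + 2) → ι) → ℝ)
    (hA : ∀ i (r : Fin (m + 1)) j J, A i (r.insertNth j J) = (-1) ^ r.val * A i (Fin.cons j J))
    (hD : ∀ (r : Fin (m + 2)) j J, D (r.insertNth j J) = (-1) ^ r.val * D (Fin.cons j J))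
    (hDA : ∀ I, D I = ∑ r : Fin (m + 2), (-1) ^ r.val * A (I r) (r.removeNth I)) :
    ∑ I, D I ^ 2 = (m + 2) * (∑ i, ∑ J, A i J ^ 2 -
      (m + 1) * ∑ i, ∑ j, ∑ K, A i (Fin.cons j K) * A j (Fin.cons i K)) := by
  -- Only one factor of the square is expanded; the alternation of the other brings the
  -- distinguished index to the front.
  have h1 : ∑ I, D I ^ 2 = (m + 2) * ∑ i, ∑ J, D (Fin.cons i J) * A i J := by
    have := sum_sum_removeNth (fun i I J => D I * A i J) (fun i r j J K => by
      simp only [hD]; ring)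
    push_cast at this
    rw [show (m : ℝ) + 2 = m + 1 + 1 by ring, ← this]
    refine Finset.sum_congr rfl fun I _ => ?_
    rw [sq]; conv_lhs => rw [hDA I]
    rw [mul_comm, ← hDA I, Finset.sum_congr rfl fun r _ => mul_left_comm _ _ _, ← Finset.mul_sum,
      ← hDA I]
  -- Now the other factor is expanded. Removing the leading entry gives the diagonal term, removing
  -- any later one gives a cross term in which the differentiation index and a form index are
  -- exchanged.
  have h2 : ∀ i J, D (Fin.cons i J) = A i J -
      ∑ s : Fin (m + 1), (-1) ^ s.val * A (J s) (Fin.cons i (s.removeNth J)) := by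
    intro i J
    rw [hDA, Fin.sum_univ_succ, sub_eq_add_neg, ← Finset.sum_neg_distrib]
    congr 1
    · simp
    · refine Finset.sum_congr rfl fun s _ => ?_
      have : Fin.removeNth s.succ (Fin.cons i J : Fin (m + 2) → ι) = Fin.cons i (s.removeNth J) := by
        funext t
        refine Fin.cases ?_ (fun t => ?_) t
        · simp [Fin.removeNth]
        · simp [Fin.removeNth]
      rw [this, Fin.cons_succ, Fin.val_succ, pow_succ]; ring
  have h3 : ∀ i, ∑ J, (∑ s : Fin (m + 1), (-1) ^ s.val * A (J s) (Fin.cons i (s.removeNth J))) *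
      A i J = (m + 1) * ∑ j, ∑ K, A i (Fin.cons j K) * A j (Fin.cons i K) := by
    intro i
    rw [← sum_sum_removeNth (fun j J K => A i J * A j (Fin.cons i K)) (fun j r l J K => by
      simp only [hA]; ring)]
    refine Finset.sum_congr rfl fun J _ => ?_
    rw [Finset.sum_mul]
    exact Finset.sum_congr rfl fun s _ => by ring
  rw [h1]
  congr 1
  rw [Finset.mul_sum, ← Finset.sum_sub_distrib]
  refine Finset.sum_congr rfl fun i _ => ?_
  rw [← h3, ← Finset.sum_sub_distrib]
  exact Finset.sum_congr rfl fun J _ => by rw [h2]; ring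
end Algebra

/-! ### Gaffney's identity for compactly supported forms on a vector space. -/

section Flat
variable {E ι : Type*} [NormedAddCommGroup E] [NormedSpace ℝ E] [Fintype ι] {k m : ℕ} (b : ι → E)

/-- The coefficients of a form with respect to a family of vectors. -/
def coeff (u : E → E [⋀^Fin k]→L[ℝ] ℝ) (J : Fin k → ι) (y : E) : ℝ := u y (fun r => b (J r))

/-- The Euclidean codifferential (up to sign) of a form with respect to a family of vectors. -/
noncomputable def flatDiv (u : E → E [⋀^Fin (m + 1)]→L[ℝ] ℝ) (y : E) : E [⋀^Fin m]→L[ℝ] ℝ :=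
  ∑ i, (fderiv ℝ u y (b i)).curryLeft (b i)

variable {b} [FiniteDimensional ℝ E] {u : E → E [⋀^Fin k]→L[ℝ] ℝ} {U : E → E [⋀^Fin (m + 1)]→L[ℝ] ℝ}

theorem vecCons_family (i : ι) (J : Fin k → ι) :
    (fun r => b ((Fin.cons i J : Fin (k + 1) → ι) r)) = Matrix.vecCons (b i) (fun r => b (J r)) := by
  funext r; refine Fin.cases ?_ (fun r => ?_) r <;> simp

theorem insertNth_family (r : Fin (k + 1)) (i : ι) (J : Fin k → ι) :
    (fun s => b ((r.insertNth i J : Fin (k + 1) → ι) s)) = r.insertNth (b i) (fun s => b (J s)) := by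
  funext s
  refine Fin.succAboveCases r ?_ (fun s => ?_) s <;> simp

theorem apply_insertNth_family (α : E [⋀^Fin (k + 1)]→L[ℝ] ℝ) (r : Fin (k + 1)) (i : ι)
    (J : Fin k → ι) : α (fun s => b ((r.insertNth i J : Fin (k + 1) → ι) s)) =
      (-1) ^ r.val * α (fun s => b ((Fin.cons i J : Fin (k + 1) → ι) s)) := by
  rw [insertNth_family, vecCons_family, ContinuousAlternatingMap.map_insertNth]
  simp

theorem contDiff_coeff {j : WithTop ℕ∞} (hu : ContDiff ℝ j u) (J : Fin k → ι) :
    ContDiff ℝ j (coeff b u J) := contDiff_alternating_apply hu _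

theorem fderiv_coeff {y : E} (hu : DifferentiableAt ℝ u y) (J : Fin k → ι) (v : E) :
    fderiv ℝ (coeff b u J) y v = fderiv ℝ u y v (fun r => b (J r)) := by
  have h := (ContinuousAlternatingMap.apply ℝ E ℝ (fun r => b (J r))).hasFDerivAt.comp y
    hu.hasFDerivAt
  have h2 : HasFDerivAt (coeff b u J) _ y := h
  rw [h2.fderiv]; rfl

theorem coeff_insertNth (r : Fin (m + 1)) (i : ι) (J : Fin m → ι) (y : E) :
    coeff b U (r.insertNth i J) y = (-1) ^ r.val * coeff b U (Fin.cons i J) y :=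
  apply_insertNth_family _ _ _ _

theorem fderiv_coeff_insertNth {y : E} (hu : DifferentiableAt ℝ U y) (v : E) (r : Fin (m + 1))
    (i : ι) (J : Fin m → ι) : fderiv ℝ (coeff b U (r.insertNth i J)) y v =
      (-1) ^ r.val * fderiv ℝ (coeff b U (Fin.cons i J)) y v := by
  rw [fderiv_coeff hu, fderiv_coeff hu]
  exact apply_insertNth_family _ _ _ _

theorem coeff_extDeriv {y : E} (hu : DifferentiableAt ℝ u y) (I : Fin (k + 1) → ι) :
    coeff b (extDeriv u) I y =
      ∑ r : Fin (k + 1), (-1) ^ r.val * fderiv ℝ (coeff b u (r.removeNth I)) y (b (I r)) :=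
  extDeriv_basis hu b I

theorem coeff_flatDiv {y : E} (hu : DifferentiableAt ℝ U y) (K : Fin m → ι) :
    coeff b (flatDiv b U) K y = ∑ i, fderiv ℝ (coeff b U (Fin.cons i K)) y (b i) := by
  simp only [coeff, flatDiv]
  rw [ContinuousAlternatingMap.sum_apply]
  refine Finset.sum_congr rfl fun i _ => ?_
  rw [ContinuousAlternatingMap.curryLeft_apply_apply, ← vecCons_family]
  exact (fderiv_coeff hu _ _).symm

theorem contDiff_flatDiv (hu : ContDiff ℝ ∞ U) : ContDiff ℝ ∞ (flatDiv b U) := by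
  have h : ContDiff ℝ ∞ (fderiv ℝ U) := hu.fderiv_right (m := ∞) (by simp)
  unfold flatDiv
  refine ContDiff.sum fun i _ => ?_
  have h1 : ContDiff ℝ ∞ (fun y => fderiv ℝ U y (b i)) := h.clm_apply contDiff_const
  have h2 : ContDiff ℝ ∞ (fun y =>
      (ContinuousAlternatingMap.curryLeftLI (𝕜 := ℝ) (E := E) (F := ℝ) (n := m)).toContinuousLinearMap
        (fderiv ℝ U y (b i))) := ContinuousLinearMap.contDiff _ |>.comp h1
  exact h2.clm_apply contDiff_const

variable {K : Set E}

theorem flatDiv_zero_off (hK : IsClosed K) (h0 : ∀ y ∉ K, U y = 0) :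
    ∀ y ∉ K, flatDiv b U y = 0 := by
  intro y hy
  have := fderiv_zero_off hK h0 y hy
  simp only [flatDiv, this]
  ext v; simp

theorem coeff_zero_off (h0 : ∀ y ∉ K, u y = 0) (J : Fin k → ι) : ∀ y ∉ K, coeff b u J y = 0 := by
  intro y hy; simp [coeff, h0 y hy]

variable [MeasurableSpace E] [BorelSpace E] {μ : Measure E}
  [μ.IsAddHaarMeasure]

/-- Integration by parts puts both derivatives on `w`, where their order does not matter. -/
theorem integral_fderiv_mul_fderiv_swap {v w : E → ℝ} (hK : IsCompact K) (hv : ContDiff ℝ 2 v)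
    (hw : ContDiff ℝ 2 w) (hv0 : ∀ y ∉ K, v y = 0) (e f : E) :
    ∫ y, fderiv ℝ v y e * fderiv ℝ w y f ∂μ = ∫ y, fderiv ℝ v y f * fderiv ℝ w y e ∂μ := by
  have hdw : ∀ g : E, ContDiff ℝ 1 (fun y => fderiv ℝ w y g) := fun g =>
    (hw.fderiv_right (m := 1) (by norm_num)).clm_apply contDiff_const
  have h : ∀ e f : E, ∫ y, fderiv ℝ v y e * fderiv ℝ w y f ∂μ =
      -∫ y, v y * fderiv ℝ (fun z => fderiv ℝ w z f) y e ∂μ := by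
    intro e f
    rw [integral_mul_fderiv_of_zero_off isOpen_univ hK (subset_univ _) (hv.of_le (by norm_num)) hv0
      (hdw f).contDiffOn e, neg_neg]
  rw [h e f, h f e]
  congr 1
  refine integral_congr_ae (Eventually.of_forall fun y => ?_)
  have hs : IsSymmSndFDerivAt ℝ w y := hw.contDiffAt.isSymmSndFDerivAt (by simp)
  have hd : DifferentiableAt ℝ (fderiv ℝ w) y :=
    ((hw.fderiv_right (m := 1) (by norm_num)).differentiable one_ne_zero) y
  have e1 : ∀ a c : E, fderiv ℝ (fun z => fderiv ℝ w z a) y c = fderiv ℝ (fderiv ℝ w) y c a := by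
    intro a c
    rw [fderiv_clm_apply hd (differentiableAt_const a)]
    simp
  simp only [e1]
  rw [hs.eq]

/-- **Gaffney's identity** in a flat space. -/
theorem integral_gaffney (hK : IsCompact K) (hU : ContDiff ℝ ∞ U) (h0 : ∀ y ∉ K, U y = 0) :
    ∫ y, ∑ I, coeff b (extDeriv U) I y ^ 2 ∂μ = (m + 2) *
      (∫ y, ∑ i, ∑ J, fderiv ℝ (coeff b U J) y (b i) ^ 2 ∂μ -
        (m + 1) * ∫ y, ∑ K, coeff b (flatDiv b U) K y ^ 2 ∂μ) := by
  have hd : ∀ y, DifferentiableAt ℝ U y := fun y => (hU.differentiable (by simp)) y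
  have hpt : ∀ y, ∑ I, coeff b (extDeriv U) I y ^ 2 = (m + 2) *
      (∑ i, ∑ J, fderiv ℝ (coeff b U J) y (b i) ^ 2 - (m + 1) * ∑ i, ∑ j, ∑ K,
        fderiv ℝ (coeff b U (Fin.cons j K)) y (b i) *
          fderiv ℝ (coeff b U (Fin.cons i K)) y (b j)) := fun y =>
    sum_sq_alternation (fun i J => fderiv ℝ (coeff b U J) y (b i))
      (fun I => coeff b (extDeriv U) I y)
      (fun i r j J => fderiv_coeff_insertNth (hd y) _ _ _ _)
      (fun r j J => coeff_insertNth _ _ _ _) (fun I => coeff_extDeriv (hd y) I)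
  have hc : ∀ J (v : E), Continuous fun y => fderiv ℝ (coeff b U J) y v := fun J v =>
    ((contDiff_coeff hU J).continuous_fderiv (by simp)).clm_apply continuous_const
  have hz : ∀ J (v : E), ∀ y ∉ K, fderiv ℝ (coeff b U J) y v = 0 := fun J v y hy => by
    rw [fderiv_zero_off hK.isClosed (coeff_zero_off h0 J) y hy]; rfl
  have hi : ∀ J J' (v w : E), Integrable
      (fun y => fderiv ℝ (coeff b U J) y v * fderiv ℝ (coeff b U J') y w) μ := fun J J' v w =>
    integrable_of_zero_off hK ((hc J v).mul (hc J' w)) fun y hy => by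
      simp [hz J v y hy]
  have hi2 : Integrable (fun y => ∑ i, ∑ J, fderiv ℝ (coeff b U J) y (b i) ^ 2) μ :=
    integrable_finsetSum _ fun i _ => integrable_finsetSum _ fun J _ => by
      simpa only [sq] using hi J J (b i) (b i)
  simp only [hpt]
  rw [integral_const_mul, integral_sub hi2, integral_const_mul]
  · congr 3
    -- The cross terms of `sum_sq_alternation` differ from the square of the divergence only in
    -- which coefficient each derivative falls on, and exchanging the derivatives does not change
    -- the integral.
    have hr : ∀ y, ∑ L, coeff b (flatDiv b U) L y ^ 2 = ∑ i, ∑ j, ∑ L,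
        fderiv ℝ (coeff b U (Fin.cons j L)) y (b j) *
          fderiv ℝ (coeff b U (Fin.cons i L)) y (b i) := by
      intro y
      simp only [coeff_flatDiv (hd y), sq, Finset.sum_mul_sum]
      rw [Finset.sum_comm]
      refine Finset.sum_congr rfl fun i _ => ?_
      rw [Finset.sum_comm]
      exact Finset.sum_congr rfl fun j _ => Finset.sum_congr rfl fun L _ => mul_comm _ _
    have hsum : ∀ f : ι → ι → (Fin m → ι) → E → ℝ, (∀ i j L, Integrable (f i j L) μ) →
        ∫ y, ∑ i, ∑ j, ∑ L, f i j L y ∂μ = ∑ i, ∑ j, ∑ L, ∫ y, f i j L y ∂μ := by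
      intro f hf
      rw [integral_finsetSum _ fun i _ => integrable_finsetSum _ fun j _ =>
        integrable_finsetSum _ fun L _ => hf i j L]
      refine Finset.sum_congr rfl fun i _ => ?_
      rw [integral_finsetSum _ fun j _ => integrable_finsetSum _ fun L _ => hf i j L]
      exact Finset.sum_congr rfl fun j _ => integral_finsetSum _ fun L _ => hf i j L
    simp only [hr]
    rw [hsum _ fun i j L => hi _ _ _ _, hsum _ fun i j L => hi _ _ _ _]
    refine Finset.sum_congr rfl fun i _ => Finset.sum_congr rfl fun j _ =>
      Finset.sum_congr rfl fun L _ => ?_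
    exact integral_fderiv_mul_fderiv_swap hK ((contDiff_coeff hU _).of_le ENat.LEInfty.out)
      ((contDiff_coeff hU _).of_le ENat.LEInfty.out) (coeff_zero_off h0 _) _ _
  · exact (integrable_finsetSum _ fun i _ => integrable_finsetSum _ fun j _ =>
      integrable_finsetSum _ fun L _ => hi _ _ _ _).const_mul _
end Flat
end KreinFeller

namespace KreinFeller

/-! ### Absorption of errors and freezing of coefficients. -/

section Algebra
variable {ι : Type*} [Fintype ι] {m : ℕ}

theorem le_sum_sq {κ : Type*} [Fintype κ] (f : κ → ℝ) (i : κ) : f i ^ 2 ≤ ∑ j, f j ^ 2 :=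
  Finset.single_le_sum (f := fun j => f j ^ 2) (fun _ _ => sq_nonneg _) (Finset.mem_univ i)

/-- Gaffney's identity gives `(m+1)P ≤ G ≤ F + (m+1)P`. The values of `τ` and `η` make `(N+1)τ`
equal to `c₀/4` and `Nη` at most `c₀/8`, so the error in `hlow` uses up at most half of `c₀(m+1)P`,
plus an eighth of `c₀F`. Hence `(m+1)P` is bounded by `F` and the data, and so is `G`. -/
theorem gradient_bound_arith {m F G P Q N Y A τ η c₀ : ℝ} (hm : 0 ≤ m) (hP0 : 0 ≤ P) (hF0 : 0 ≤ F)
    (hN0 : 0 ≤ N) (hc : 0 < c₀) (hτ : τ = c₀ / (4 * (N + 1))) (hη : η = c₀ / (8 * (N + 1)))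
    (hgaff : F = (m + 2) * (G - (m + 1) * P))
    (hlow : c₀ * (m + 1) * P - N * (A ^ 2 / (4 * τ) * Q + (τ + η) * P + η * G) ≤
      Y + τ * P) :
    G ≤ 3 / 2 * F + 2 / c₀ * (Y + N * (A ^ 2 / (4 * τ) * Q)) := by
  have hY : 0 ≤ G - (m + 1) * P :=
    nonneg_of_mul_nonneg_right (hgaff ▸ hF0) (by positivity)
  have hG1 : (m + 1) * P ≤ G := by linarith
  have hG2 : G ≤ F + (m + 1) * P := by
    have : 1 * (G - (m + 1) * P) ≤ (m + 2) * (G - (m + 1) * P) := by gcongr; linarith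
    linarith
  have hPm : P ≤ (m + 1) * P := by linarith [mul_nonneg hm hP0]
  obtain ⟨X, hX⟩ : ∃ X, X = Y + N * (A ^ 2 / (4 * τ) * Q) := ⟨_, rfl⟩
  have hNτ : (N + 1) * τ = c₀ / 4 := by rw [hτ]; field_simp
  have hNη : N * η ≤ c₀ / 8 := by
    rw [hη, ← mul_div_assoc, div_le_div_iff₀ (by positivity) (by norm_num)]
    linarith
  have hX2 : 2 / c₀ * X * c₀ = 2 * X := by field_simp
  have h8 : N * η * (P + G) ≤ c₀ / 8 * (P + G) := by
    have : 0 ≤ (m + 1) * P := by positivity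
    gcongr; linarith
  have h9 : c₀ * ((m + 1) * P) ≤ X + (N + 1) * τ * P + N * η * (P + G) := by
    rw [hX]; linarith
  rw [hNτ] at h9
  have h10 : c₀ * P ≤ c₀ * ((m + 1) * P) := by gcongr
  have h11 : c₀ * G ≤ c₀ * (F + (m + 1) * P) := by gcongr
  have h12 : 0 ≤ c₀ * F := by positivity
  refine le_of_mul_le_mul_right ?_ hc
  rw [← hX, add_mul, hX2]
  linarith

theorem integral_combination {X : Type*} [MeasurableSpace X] {μ : Measure X} {f g h : X → ℝ}
    (hf : Integrable f μ) (hg : Integrable g μ) (hh : Integrable h μ) (a b c d e : ℝ) :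
    ∫ x, (a * f x - b * (c * g x + d * f x + e * h x)) ∂μ =
      a * ∫ x, f x ∂μ - b * (c * ∫ x, g x ∂μ + d * ∫ x, f x ∂μ + e * ∫ x, h x ∂μ) := by
  have h1 : Integrable (fun x => c * g x + d * f x) μ := (hg.const_mul c).add (hf.const_mul d)
  have h2 : Integrable (fun x => c * g x + d * f x + e * h x) μ := h1.add (hh.const_mul e)
  rw [integral_sub (hf.const_mul a) (h2.const_mul b), integral_const_mul, integral_const_mul,
    integral_add h1 (hh.const_mul e), integral_add (hg.const_mul c) (hf.const_mul d)]
  simp only [integral_const_mul]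

/-- Freezing the coefficients in the principal term of the weak codifferential. -/
theorem frozen_coefficients [DecidableEq ι] {ψ : (Fin m → ι) → ℝ} {u : (Fin (m + 1) → ι) → ℝ}
    {du : ι → (Fin (m + 1) → ι) → ℝ} {a : (Fin (m + 1) → ι) → (Fin (m + 1) → ι) → ℝ}
    {da : (Fin (m + 1) → ι) → (Fin (m + 1) → ι) → ι → ℝ} {c₀ η A τ N : ℝ}
    (hdu : ∀ i (r : Fin (m + 1)) j J, du i (r.insertNth j J) = (-1) ^ r.val * du i (Fin.cons j J))
    (hψ : ∀ K, ψ K = ∑ i, du i (Fin.cons i K))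
    (ha : ∀ I J, |a I J - if I = J then c₀ else 0| ≤ η) (hda : ∀ I J i, |da I J i| ≤ A)
    (hτ : 0 < τ)
    (hN : N = Fintype.card (Fin (m + 1) → ι) * Fintype.card (Fin (m + 1) → ι) * (m + 1)) :
    c₀ * (m + 1) * ∑ K, ψ K ^ 2 - N * (A ^ 2 / (4 * τ) * ∑ J, u J ^ 2 + (τ + η) * ∑ K, ψ K ^ 2 +
        η * ∑ i, ∑ J, du i J ^ 2) ≤
      ∑ I, ∑ J, ∑ r : Fin (m + 1), (-1) ^ r.val *
        (ψ (r.removeNth I) * (da I J (I r) * u J + a I J * du (I r) J)) := by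
  -- `B` bounds the error of a single triple `(I, J, r)`, and `N` is the number of triples.
  set B := A ^ 2 / (4 * τ) * ∑ J, u J ^ 2 + (τ + η) * ∑ K, ψ K ^ 2 + η * ∑ i, ∑ J, du i J ^ 2
  -- With the coefficients replaced by `c₀` times the identity, the sum over `I` reassembles the
  -- divergence `ψ`, once for each of the `m + 1` positions.
  have hmain : ∑ I, ∑ J, ∑ r : Fin (m + 1), (-1) ^ r.val *
      (ψ (r.removeNth I) * ((if I = J then c₀ else 0) * du (I r) J)) =
      c₀ * (m + 1) * ∑ K, ψ K ^ 2 := by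
    have h1 := sum_sum_removeNth (fun i I K => du i I * ψ K) (fun i r j J K => by
      simp only [hdu]; ring)
    calc _ = ∑ I, ∑ r : Fin (m + 1), (-1) ^ r.val * (ψ (r.removeNth I) * (c₀ * du (I r) I)) := by
          refine Finset.sum_congr rfl fun I _ => ?_
          rw [Finset.sum_eq_single I (fun J _ hJ => by simp [hJ.symm]) (by simp)]
          simp
      _ = c₀ * ∑ I, ∑ r : Fin (m + 1), (-1) ^ r.val * (du (I r) I * ψ (r.removeNth I)) := by
          simp only [Finset.mul_sum]
          exact Finset.sum_congr rfl fun I _ => Finset.sum_congr rfl fun r _ => by ring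
      _ = _ := by
          rw [h1, Finset.sum_comm, mul_assoc]
          congr 2
          refine Finset.sum_congr rfl fun K _ => ?_
          rw [← Finset.sum_mul, ← hψ, sq]
  have hterm : ∀ I J (r : Fin (m + 1)), (-1) ^ r.val *
      (ψ (r.removeNth I) * ((if I = J then c₀ else 0) * du (I r) J)) - B ≤ (-1) ^ r.val *
        (ψ (r.removeNth I) * (da I J (I r) * u J + a I J * du (I r) J)) := by
    intro I J r
    set p := ψ (r.removeNth I)
    have hp : p ^ 2 ≤ ∑ K, ψ K ^ 2 := le_sum_sq ψ _
    have hu : u J ^ 2 ≤ ∑ J, u J ^ 2 := le_sum_sq u _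
    have hd : du (I r) J ^ 2 ≤ ∑ i, ∑ J, du i J ^ 2 := by
      refine (le_sum_sq (du (I r)) J).trans ?_
      exact Finset.single_le_sum (f := fun i => ∑ J, du i J ^ 2)
        (fun _ _ => Finset.sum_nonneg fun _ _ => sq_nonneg _) (Finset.mem_univ _)
    have hη : 0 ≤ η := (abs_nonneg _).trans (ha I J)
    have hA : 0 ≤ A := (abs_nonneg _).trans (hda I J (I r))
    set d := a I J - if I = J then c₀ else 0 with hd'
    -- Young's inequality: the term of order zero costs `τ p²` and a multiple of `u²`, the deviation
    -- `d` of the coefficient costs `η (p² + du²)`.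
    have key : |p * (da I J (I r) * u J + d * du (I r) J)| ≤ B := by
      rw [mul_add]
      refine (abs_add_le _ _).trans ?_
      have e1 : |p * (da I J (I r) * u J)| ≤ A ^ 2 / (4 * τ) * u J ^ 2 + τ * p ^ 2 := by
        rw [abs_mul, abs_mul]
        have : |p| * (|da I J (I r)| * |u J|) ≤ |p| * (A * |u J|) := by gcongr; exact hda _ _ _
        refine this.trans ?_
        have h3 : A ^ 2 / (4 * τ) * u J ^ 2 + τ * p ^ 2 - |p| * (A * |u J|) =
            (A * |u J| / (2 * τ) - |p|) ^ 2 * τ := by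
          rw [← sq_abs (u J), ← sq_abs p]; field_simp; ring
        have : 0 ≤ (A * |u J| / (2 * τ) - |p|) ^ 2 * τ := by positivity
        linarith
      have e2 : |p * (d * du (I r) J)| ≤ η * (p ^ 2 + du (I r) J ^ 2) := by
        rw [abs_mul, abs_mul]
        have : |p| * (|d| * |du (I r) J|) ≤ |p| * (η * |du (I r) J|) := by gcongr; exact ha _ _
        refine this.trans ?_
        rw [← sq_abs p, ← sq_abs (du (I r) J)]
        nlinarith [sq_nonneg (|p| - |du (I r) J|), mul_nonneg hη (sq_nonneg (|p| - |du (I r) J|)),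
          mul_nonneg hη (sq_nonneg (|p| + |du (I r) J|)), abs_nonneg p]
      have f1 : A ^ 2 / (4 * τ) * u J ^ 2 ≤ A ^ 2 / (4 * τ) * ∑ J, u J ^ 2 := by gcongr
      have f2 : (τ + η) * p ^ 2 ≤ (τ + η) * ∑ K, ψ K ^ 2 := by gcongr
      have f3 : η * du (I r) J ^ 2 ≤ η * ∑ i, ∑ J, du i J ^ 2 := by gcongr
      simp only [B]; linarith
    have hsgn : |(-1) ^ r.val * (p * (da I J (I r) * u J + d * du (I r) J))| ≤ B := by
      rw [abs_mul, abs_pow, abs_neg, abs_one, one_pow, one_mul]; exact key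
    have h5 := (abs_le.1 hsgn).1
    have h6 : a I J = d + if I = J then c₀ else 0 := by rw [hd']; ring
    rw [h6]
    linarith [h5, show (-1) ^ r.val * (p * (da I J (I r) * u J +
      (d + if I = J then c₀ else 0) * du (I r) J)) =
      (-1) ^ r.val * (p * (da I J (I r) * u J + d * du (I r) J)) +
      (-1) ^ r.val * (p * ((if I = J then c₀ else 0) * du (I r) J)) by ring]
  rw [← hmain]
  have := Finset.sum_le_sum fun I (_ : I ∈ Finset.univ) => Finset.sum_le_sum
    fun J (_ : J ∈ Finset.univ) => Finset.sum_le_sum fun r (_ : r ∈ Finset.univ) => hterm I J r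
  simp only [Finset.sum_sub_distrib, Finset.sum_const, Finset.card_univ, nsmul_eq_mul,
    Fintype.card_fin] at this
  refine le_trans (le_of_eq ?_) this
  rw [hN]; push_cast; ring
end Algebra

/-! ### A local Gårding inequality for nearly constant coefficients. -/

section Flat
variable {E ι : Type*} [NormedAddCommGroup E] [NormedSpace ℝ E] [FiniteDimensional ℝ E]
  [Fintype ι] [DecidableEq ι] {m : ℕ} {b : ι → E} {U : E → E [⋀^Fin (m + 1)]→L[ℝ] ℝ} {K T : Set E}
  [MeasurableSpace E] [BorelSpace E] {μ : Measure E} [μ.IsAddHaarMeasure]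

/-- A local Gårding inequality: the full gradient is controlled by the exterior derivative and by
the weak codifferential for a metric that is nearly constant. -/
theorem integral_sq_fderiv_le {a : (Fin (m + 1) → ι) → (Fin (m + 1) → ι) → E → ℝ}
    {c₀ η A τ N Y : ℝ} (hK : IsCompact K) (hT : IsOpen T) (hKT : K ⊆ T) (hU : ContDiff ℝ ∞ U)
    (h0 : ∀ y ∉ K, U y = 0) (haT : ∀ I J, ContDiffOn ℝ 1 (a I J) T)
    (ha : ∀ y ∈ K, ∀ I J, |a I J y - if I = J then c₀ else 0| ≤ η)
    (hda : ∀ y ∈ K, ∀ I J i, |fderiv ℝ (a I J) y (b i)| ≤ A) (hc : 0 < c₀)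
    (hN : N = Fintype.card (Fin (m + 1) → ι) * Fintype.card (Fin (m + 1) → ι) * (m + 1))
    (hτ : τ = c₀ / (4 * (N + 1))) (hη : η = c₀ / (8 * (N + 1)))
    (hY : -∫ y, ∑ I, ∑ J, a I J y * (coeff b U J y * coeff b (extDeriv (flatDiv b U)) I y) ∂μ ≤
      Y + τ * ∫ y, ∑ L, coeff b (flatDiv b U) L y ^ 2 ∂μ) :
    ∫ y, ∑ i, ∑ J, fderiv ℝ (coeff b U J) y (b i) ^ 2 ∂μ ≤
      3 / 2 * ∫ y, ∑ I, coeff b (extDeriv U) I y ^ 2 ∂μ +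
      2 / c₀ * (Y + N * (A ^ 2 / (4 * τ) * ∫ y, ∑ J, coeff b U J y ^ 2 ∂μ)) := by
  have hd : ∀ y, DifferentiableAt ℝ U y := fun y => (hU.differentiable (by simp)) y
  -- The weak codifferential is tested against the Euclidean divergence of `U`: after integration by
  -- parts, the principal part of the pairing is `c₀ (m + 1)` times the squared norm of `ψ`, the
  -- quantity missing in Gaffney's identity.
  set ψ := flatDiv b U with hψdef
  have hψ : ContDiff ℝ ∞ ψ := contDiff_flatDiv hU
  have hψ0 : ∀ y ∉ K, ψ y = 0 := flatDiv_zero_off hK.isClosed h0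
  have hN0 : 0 ≤ N := by rw [hN]; positivity
  have hτ0 : 0 < τ := by rw [hτ]; positivity
  have hcU : ∀ J, ContDiff ℝ ∞ (coeff b U J) := contDiff_coeff hU
  have hcψ : ∀ L, ContDiff ℝ ∞ (coeff b ψ L) := contDiff_coeff hψ
  have hzU : ∀ J, ∀ y ∉ K, coeff b U J y = 0 := coeff_zero_off h0
  have hzψ : ∀ L, ∀ y ∉ K, coeff b ψ L y = 0 := coeff_zero_off hψ0
  have hdz : ∀ J (v : E), ∀ y ∉ K, fderiv ℝ (coeff b U J) y v = 0 := fun J v y hy => by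
    rw [fderiv_zero_off hK.isClosed (hzU J) y hy]; rfl
  have hdc : ∀ J (v : E), Continuous fun y => fderiv ℝ (coeff b U J) y v := fun J v =>
    ((hcU J).continuous_fderiv (by simp)).clm_apply continuous_const
  have hdψc : ∀ J (v : E), Continuous fun y => fderiv ℝ (coeff b ψ J) y v := fun J v =>
    ((hcψ J).continuous_fderiv (by simp)).clm_apply continuous_const
  have haU : ∀ I J, ContDiffOn ℝ 1 (fun y => a I J y * coeff b U J y) T := fun I J =>
    (haT I J).mul ((hcU J).of_le (one_le_two.trans ENat.LEInfty.out)).contDiffOn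
  have hint : ∀ {f : E → ℝ}, ContinuousOn f T → (∀ y ∉ K, f y = 0) → Integrable f μ :=
    fun hf hf0 => integrable_of_zero_off hK (continuous_of_zero_off hT hK.isClosed hKT hf hf0) hf0
  -- the weak codifferential, integrated by parts
  have hparts : ∫ y, ∑ I, ∑ J, a I J y * (coeff b U J y * coeff b (extDeriv ψ) I y) ∂μ =
      -∫ y, ∑ I, ∑ J, ∑ r : Fin (m + 1), (-1) ^ r.val * (coeff b ψ (r.removeNth I) y *
        fderiv ℝ (fun z => a I J z * coeff b U J z) y (b (I r))) ∂μ := by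
    have hi1 : ∀ I J (r : Fin (m + 1)), Integrable (fun y => (-1) ^ r.val *
        (fderiv ℝ (coeff b ψ (r.removeNth I)) y (b (I r)) * (a I J y * coeff b U J y))) μ := by
      intro I J r
      refine (hint ?_ ?_).const_mul _
      · exact (hdψc _ _).continuousOn.mul (haU I J).continuousOn
      · intro y hy; rw [hzU J y hy, mul_zero, mul_zero]
    have hi2 : ∀ I J (r : Fin (m + 1)), Integrable (fun y => (-1) ^ r.val *
        (coeff b ψ (r.removeNth I) y *
          fderiv ℝ (fun z => a I J z * coeff b U J z) y (b (I r)))) μ := by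
      intro I J r
      refine (hint ?_ ?_).const_mul _
      · exact (hcψ _).continuous.continuousOn.mul
          (((haU I J).continuousOn_fderiv_of_isOpen hT le_rfl).clm_apply continuousOn_const)
      · intro y hy; rw [hzψ _ y hy, zero_mul]
    have e1 : ∀ y, ∑ I, ∑ J, a I J y * (coeff b U J y * coeff b (extDeriv ψ) I y) =
        ∑ I, ∑ J, ∑ r : Fin (m + 1), (-1) ^ r.val *
          (fderiv ℝ (coeff b ψ (r.removeNth I)) y (b (I r)) * (a I J y * coeff b U J y)) := by
      intro y
      refine Finset.sum_congr rfl fun I _ => Finset.sum_congr rfl fun J _ => ?_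
      rw [coeff_extDeriv ((hψ.differentiable (by simp)) y), Finset.mul_sum, Finset.mul_sum]
      exact Finset.sum_congr rfl fun r _ => by ring
    simp only [e1]
    rw [integral_finsetSum _ fun I _ => integrable_finsetSum _ fun J _ =>
        integrable_finsetSum _ fun r _ => hi1 I J r,
      integral_finsetSum _ fun I _ => integrable_finsetSum _ fun J _ =>
        integrable_finsetSum _ fun r _ => hi2 I J r, ← Finset.sum_neg_distrib]
    refine Finset.sum_congr rfl fun I _ => ?_
    rw [integral_finsetSum _ fun J _ => integrable_finsetSum _ fun r _ => hi1 I J r,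
      integral_finsetSum _ fun J _ => integrable_finsetSum _ fun r _ => hi2 I J r,
      ← Finset.sum_neg_distrib]
    refine Finset.sum_congr rfl fun J _ => ?_
    rw [integral_finsetSum _ fun r _ => hi1 I J r, integral_finsetSum _ fun r _ => hi2 I J r,
      ← Finset.sum_neg_distrib]
    refine Finset.sum_congr rfl fun r _ => ?_
    rw [integral_const_mul, integral_const_mul, integral_mul_fderiv_of_zero_off hT hK hKT
      ((hcψ _).of_le (one_le_two.trans ENat.LEInfty.out)) (hzψ _) (haU I J)]
    ring
  set P := ∫ y, ∑ L, coeff b ψ L y ^ 2 ∂μ with hP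
  set G := ∫ y, ∑ i, ∑ J, fderiv ℝ (coeff b U J) y (b i) ^ 2 ∂μ with hG
  set Q := ∫ y, ∑ J, coeff b U J y ^ 2 ∂μ with hQ
  set F := ∫ y, ∑ I, coeff b (extDeriv U) I y ^ 2 ∂μ with hF
  have hPi : Integrable (fun y => ∑ L, coeff b ψ L y ^ 2) μ :=
    integrable_finsetSum _ fun L _ => hint ((hcψ L).continuous.pow 2).continuousOn
      fun y hy => by simp [hzψ L y hy]
  have hQi : Integrable (fun y => ∑ J, coeff b U J y ^ 2) μ :=
    integrable_finsetSum _ fun L _ => hint ((hcU L).continuous.pow 2).continuousOn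
      fun y hy => by simp [hzU L y hy]
  have hGi : Integrable (fun y => ∑ i, ∑ J, fderiv ℝ (coeff b U J) y (b i) ^ 2) μ :=
    integrable_finsetSum _ fun i _ => integrable_finsetSum _ fun J _ =>
      hint ((hdc J _).pow 2).continuousOn fun y hy => by simp [hdz J _ y hy]
  have hP0 : 0 ≤ P := integral_nonneg fun y => Finset.sum_nonneg fun _ _ => sq_nonneg _
  have hF0 : 0 ≤ F := integral_nonneg fun y => Finset.sum_nonneg fun _ _ => sq_nonneg _
  have hgaff : F = (m + 2) * (G - (m + 1) * P) := integral_gaffney hK hU h0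
  -- The pointwise inequality `frozen_coefficients` is integrated over `K`, where the coefficients
  -- are controlled; off `K` both integrands vanish.
  have hlow : c₀ * (m + 1) * P - N * (A ^ 2 / (4 * τ) * Q + (τ + η) * P + η * G) ≤
      ∫ y, ∑ I, ∑ J, ∑ r : Fin (m + 1), (-1) ^ r.val * (coeff b ψ (r.removeNth I) y *
        fderiv ℝ (fun z => a I J z * coeff b U J z) y (b (I r))) ∂μ := by
    have e2 : c₀ * (m + 1) * P - N * (A ^ 2 / (4 * τ) * Q + (τ + η) * P + η * G) =
        ∫ y, (c₀ * (m + 1) * ∑ L, coeff b ψ L y ^ 2 - N * (A ^ 2 / (4 * τ) *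
          ∑ J, coeff b U J y ^ 2 + (τ + η) * ∑ L, coeff b ψ L y ^ 2 +
          η * ∑ i, ∑ J, fderiv ℝ (coeff b U J) y (b i) ^ 2)) ∂μ := by
      exact (integral_combination hPi hQi hGi _ _ _ _ _).symm
    rw [e2]
    refine integral_mono (((hPi.const_mul _).sub ((((hQi.const_mul _).add (hPi.const_mul _)).add
        (hGi.const_mul _)).const_mul _))) ?_ fun y => ?_
    · refine integrable_finsetSum _ fun I _ => integrable_finsetSum _ fun J _ =>
        integrable_finsetSum _ fun r _ => (hint ?_ ?_).const_mul _
      · exact (hcψ _).continuous.continuousOn.mul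
          (((haU I J).continuousOn_fderiv_of_isOpen hT le_rfl).clm_apply continuousOn_const)
      · intro y hy; rw [hzψ _ y hy, zero_mul]
    · by_cases hy : y ∈ K
      · have hfd : ∀ I J v, fderiv ℝ (fun z => a I J z * coeff b U J z) y v =
            fderiv ℝ (a I J) y v * coeff b U J y + a I J y * fderiv ℝ (coeff b U J) y v := by
          intro I J v
          have h1 : DifferentiableAt ℝ (a I J) y :=
            ((haT I J).differentiableOn one_ne_zero).differentiableAt (hT.mem_nhds (hKT hy))
          have h2 : DifferentiableAt ℝ (coeff b U J) y := ((hcU J).differentiable (by simp)) y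
          rw [fderiv_fun_mul h1 h2]
          simp only [add_apply, smul_apply, smul_eq_mul]
          ring
        simp only [hfd]
        exact frozen_coefficients (ψ := fun L => coeff b ψ L y) (u := fun J => coeff b U J y)
          (du := fun i J => fderiv ℝ (coeff b U J) y (b i)) (a := fun I J => a I J y)
          (da := fun I J i => fderiv ℝ (a I J) y (b i))
          (fun i r j J => fderiv_coeff_insertNth (hd y) _ _ _ _)
          (fun L => coeff_flatDiv (hd y) L) (ha y hy) (hda y hy) hτ0 hN
      · simp [hzψ _ y hy, hzU _ y hy, hdz _ _ y hy]
  rw [hparts, neg_neg] at hY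
  exact gradient_bound_arith (Nat.cast_nonneg m) hP0 hF0 hN0 hc hτ hη hgaff (hlow.trans hY)
end Flat
end KreinFeller

namespace KreinFeller

/-! ### The exterior derivative of a cut-off form. -/

section Commutator
variable {E ι : Type*} [NormedAddCommGroup E] [NormedSpace ℝ E] [FiniteDimensional ℝ E]
  [Fintype ι] {k : ℕ} {b : ι → E}

theorem coeff_smul (χ : E → ℝ) (u : E → E [⋀^Fin k]→L[ℝ] ℝ) (J : Fin k → ι) (y : E) :
    coeff b (fun z => χ z • u z) J y = χ y * coeff b u J y := rfl

/-- Leibniz rule for the exterior derivative of a product with a function. -/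
theorem coeff_extDeriv_smul {χ : E → ℝ} {u : E → E [⋀^Fin k]→L[ℝ] ℝ} {y : E}
    (hχ : DifferentiableAt ℝ χ y) (hu : DifferentiableAt ℝ u y) (I : Fin (k + 1) → ι) :
    coeff b (extDeriv fun z => χ z • u z) I y = χ y * coeff b (extDeriv u) I y +
      ∑ r : Fin (k + 1), (-1) ^ r.val * (fderiv ℝ χ y (b (I r)) * coeff b u (r.removeNth I) y) := by
  rw [coeff_extDeriv (u := fun z => χ z • u z) (hχ.smul hu), coeff_extDeriv hu, Finset.mul_sum, ← Finset.sum_add_distrib]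
  refine Finset.sum_congr rfl fun r _ => ?_
  have h2 : DifferentiableAt ℝ (coeff b u (r.removeNth I)) y :=
    ((ContinuousAlternatingMap.apply ℝ E ℝ fun s => b (r.removeNth I s)).differentiableAt).comp y hu
  have h1 : fderiv ℝ (coeff b (fun z => χ z • u z) (r.removeNth I)) y (b (I r)) =
      χ y * fderiv ℝ (coeff b u (r.removeNth I)) y (b (I r)) +
        fderiv ℝ χ y (b (I r)) * coeff b u (r.removeNth I) y := by
    rw [show coeff b (fun z => χ z • u z) (r.removeNth I) =
      fun z => χ z * coeff b u (r.removeNth I) z from rfl, fderiv_fun_mul hχ h2]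
    simp only [add_apply, smul_apply, smul_eq_mul]
    ring
  rw [h1]
  ring

theorem sq_coeff_extDeriv_smul_le {χ : E → ℝ} {u : E → E [⋀^Fin k]→L[ℝ] ℝ} {y : E} {B Q R : ℝ}
    (hχ : DifferentiableAt ℝ χ y) (hu : DifferentiableAt ℝ u y) (hχ1 : |χ y| ≤ 1)
    (hB : ∀ i, |fderiv ℝ χ y (b i)| ≤ B) (I : Fin (k + 1) → ι)
    (hQ : coeff b (extDeriv u) I y ^ 2 ≤ Q) (hR : ∀ J, coeff b u J y ^ 2 ≤ R) :
    coeff b (extDeriv fun z => χ z • u z) I y ^ 2 ≤ 2 * Q + 2 * ((k + 1) * (B * √R)) ^ 2 := by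
  rw [coeff_extDeriv_smul hχ hu]
  set c := coeff b (extDeriv u) I y
  set s := ∑ r : Fin (k + 1), (-1) ^ r.val * (fderiv ℝ χ y (b (I r)) * coeff b u (r.removeNth I) y)
  have hs : |s| ≤ (k + 1) * (B * √R) := by
    refine (Finset.abs_sum_le_sum_abs _ _).trans ?_
    refine (Finset.sum_le_card_nsmul _ _ (B * √R) fun r _ => ?_).trans ?_
    · rw [abs_mul, abs_pow, abs_neg, abs_one, one_pow, one_mul, abs_mul]
      exact mul_le_mul (hB _) (Real.abs_le_sqrt (hR _)) (abs_nonneg _)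
        ((abs_nonneg _).trans (hB (I r)))
    · simp
  have h1 : s ^ 2 ≤ ((k + 1) * (B * √R)) ^ 2 := by
    rw [← sq_abs]; exact pow_le_pow_left₀ (abs_nonneg _) hs 2
  have h2 : (χ y * c) ^ 2 ≤ Q := by
    rw [mul_pow, ← sq_abs (χ y)]
    refine (mul_le_of_le_one_left (sq_nonneg _) (pow_le_one₀ (abs_nonneg _) hχ1)).trans hQ
  nlinarith [sq_nonneg (χ y * c - s)]
end Commutator

/-! ### Comparison of coefficients in a chart with norms on the manifold. -/

section ChartBounds
variable {n : ℕ} {M : Type*} [TopologicalSpace M] [ChartedSpace (EuclideanSpace ℝ (Fin n)) M]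
  [IsManifold (𝓡 n) ∞ M] {k : ℕ}
  [RiemannianBundle (fun x : M => TangentSpace (𝓡 n) x)]
  [IsContMDiffRiemannianBundle (𝓡 n) ∞ (EuclideanSpace ℝ (Fin n))
    (fun x : M => TangentSpace (𝓡 n) x)]
  {ι : Type*} [Fintype ι] [DecidableEq ι] {x₀ : M}
  (b : Module.Basis ι ℝ (EuclideanSpace ℝ (Fin n))) {K : Set (EuclideanSpace ℝ (Fin n))}

/-- The square of the pointwise norm of a form times the volume density, in a chart. -/
noncomputable def densSq (x₀ : M) (θ : Form n M k) (y : EuclideanSpace ℝ (Fin n)) : ℝ :=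
  formInner (θ ((extChartAt (𝓡 n) x₀).symm y)) (θ ((extChartAt (𝓡 n) x₀).symm y)) *
    volDensity x₀ y

theorem densSq_nonneg (θ : Form n M k) (y : EuclideanSpace ℝ (Fin n)) : 0 ≤ densSq x₀ θ y :=
  mul_nonneg (formInner_self_nonneg _) (Real.sqrt_nonneg _)

theorem exists_bound_family {α β : Type*} [TopologicalSpace α] [Fintype β] {S : Set α}
    (hS : IsCompact S) {f : β → α → ℝ} (hf : ∀ i, ContinuousOn (f i) S) :
    ∃ A : ℝ, 0 ≤ A ∧ ∀ y ∈ S, ∀ i, |f i y| ≤ A := by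
  choose C hC using fun i => hS.exists_bound_of_continuousOn (hf i)
  refine ⟨∑ i, |C i|, Finset.sum_nonneg fun _ _ => abs_nonneg _, fun y hy i => ?_⟩
  exact ((hC i y hy).trans (le_abs_self _)).trans
    (Finset.single_le_sum (f := fun i => |C i|) (fun _ _ => abs_nonneg _) (Finset.mem_univ i))

/-- By `sq_apply_le` the constant is a bound for a Gram determinant divided by the density, both
continuous on `K`; it does not depend on the form. -/
theorem exists_sq_coeff_le (hK : IsCompact K) (hKt : K ⊆ (extChartAt (𝓡 n) x₀).target) (k : ℕ) :
    ∃ A : ℝ, 0 ≤ A ∧ ∀ θ : Form n M k, ∀ y ∈ K, ∀ J,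
      coeff b (chartRep x₀ θ) J y ^ 2 ≤ A * densSq x₀ θ y := by
  obtain ⟨A, hA, hb⟩ := exists_bound_family hK (f := fun (J : Fin k → ι) y =>
    (Matrix.of fun r s => metricMatrix x₀ b y (J r) (J s)).det / volDensity x₀ y) fun J =>
      ((contDiffOn_det fun r s => contDiffOn_metricMatrix x₀ b (J r) (J s)).continuousOn.div
        (contDiffOn_volDensity x₀).continuousOn fun y hy => (volDensity_pos x₀ hy).ne').mono hKt
  refine ⟨A, hA, fun θ y hy J => ?_⟩
  have hv := volDensity_pos x₀ (hKt hy)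
  have h1 : coeff b (chartRep x₀ θ) J y ^ 2 ≤
      (Matrix.of fun r s => metricMatrix x₀ b y (J r) (J s)).det *
        formInner (θ ((extChartAt (𝓡 n) x₀).symm y)) (θ ((extChartAt (𝓡 n) x₀).symm y)) := by
    rw [coeff, chartRep_of_mem_target (hKt hy)]
    exact sq_apply_le (fun r => frame n x₀ ((extChartAt (𝓡 n) x₀).symm y) (b (J r))) _
  have h2 := (le_abs_self _).trans (hb y hy J)
  rw [div_le_iff₀ hv] at h2
  refine h1.trans ((mul_le_mul_of_nonneg_right h2 (formInner_self_nonneg _)).trans (le_of_eq ?_))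
  rw [densSq]; ring

/-- The converse comparison: `pairCoeff` is bounded on `K`, and a product of two coefficients is at
most the sum of all squares. -/
theorem exists_densSq_le (hK : IsCompact K) (hKt : K ⊆ (extChartAt (𝓡 n) x₀).target) (k : ℕ) :
    ∃ A : ℝ, 0 ≤ A ∧ ∀ θ : Form n M k, ∀ y ∈ K,
      densSq x₀ θ y ≤ A * ∑ J, coeff b (chartRep x₀ θ) J y ^ 2 := by
  obtain ⟨A, hA, hb⟩ := exists_bound_family hK (f := fun (p : (Fin k → ι) × (Fin k → ι)) y =>
    pairCoeff x₀ b p.1 p.2 y) fun p => (contDiffOn_pairCoeff x₀ b p.1 p.2).continuousOn.mono hKt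
  refine ⟨(k.factorial : ℝ)⁻¹ * (Fintype.card (Fin k → ι) * (Fintype.card (Fin k → ι) * A)),
    by positivity, fun θ y hy => ?_⟩
  set S := ∑ J, coeff b (chartRep x₀ θ) J y ^ 2
  rw [densSq, formInner_mul_volDensity b (hKt hy), mul_assoc]
  gcongr
  have : ∀ I J, pairCoeff x₀ b I J y * (coeff b (chartRep x₀ θ) I y * coeff b (chartRep x₀ θ) J y) ≤
      A * S := by
    intro I J
    have h1 := hb y hy (I, J)
    have h2 := le_sum_sq (fun J => coeff b (chartRep x₀ θ) J y) I
    have h3 := le_sum_sq (fun J => coeff b (chartRep x₀ θ) J y) J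
    set p := coeff b (chartRep x₀ θ) I y
    set q := coeff b (chartRep x₀ θ) J y
    have h4 : |p * q| ≤ S := by
      rw [abs_le]; constructor <;> nlinarith [sq_nonneg (p - q), sq_nonneg (p + q)]
    refine (le_abs_self _).trans ?_
    rw [abs_mul]
    exact mul_le_mul h1 h4 (abs_nonneg _) hA
  refine (Finset.sum_le_sum fun I _ => Finset.sum_le_sum fun J _ => this I J).trans (le_of_eq ?_)
  simp only [Finset.sum_const, Finset.card_univ, nsmul_eq_mul]
  ring

variable [T2Space M] [CompactSpace M] [MeasurableSpace M] [BorelSpace M]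

theorem integrableOn_densSq {θ : Form n M k} (hθ : IsSmoothForm θ) :
    IntegrableOn (densSq x₀ θ) (extChartAt (𝓡 n) x₀).target := by
  have := ChartedSpace.secondCountable_of_sigmaCompact (EuclideanSpace ℝ (Fin n)) M
  exact (integrableOn_chartDom_iff x₀ (continuous_formInner hθ hθ).aestronglyMeasurable).1
    (integrable_formInner hθ.mem_sqIntegrable hθ.mem_sqIntegrable).integrableOn

theorem setIntegral_densSq_le {θ : Form n M k} (hθ : IsSmoothForm θ) :
    ∫ y in (extChartAt (𝓡 n) x₀).target, densSq x₀ θ y ≤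
      ∫ p, formInner (θ p) (θ p) ∂(riemVol n M) := by
  have := ChartedSpace.secondCountable_of_sigmaCompact (EuclideanSpace ℝ (Fin n)) M
  have h2 : ∫ y in (extChartAt (𝓡 n) x₀).target, densSq x₀ θ y =
      ∫ p in chartDom n x₀, formInner (θ p) (θ p) ∂(riemVol n M) :=
    (integral_chartDom x₀ (continuous_formInner hθ hθ).aestronglyMeasurable).symm
  rw [h2]
  exact setIntegral_le_integral (integrable_formInner hθ.mem_sqIntegrable hθ.mem_sqIntegrable)
    (Eventually.of_forall fun p => formInner_self_nonneg _)

/-- Transfers a pointwise bound on `K` to integrals over `M`: the chart integral of `densSq` is the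
integral over the chart domain, a part of `M`. Two forms of different degrees are allowed because a
commutator with a cutoff involves both `φ` and `dφ`. -/
theorem integral_le_of_le_densSq_add {l : ℕ} {θ : Form n M k} (hθ : IsSmoothForm θ)
    {η : Form n M l} (hη : IsSmoothForm η) (hKt : K ⊆ (extChartAt (𝓡 n) x₀).target)
    {g : EuclideanSpace ℝ (Fin n) → ℝ} (hg : Integrable g) (hg0 : ∀ y ∉ K, g y = 0) {A B : ℝ}
    (hA : 0 ≤ A) (hB : 0 ≤ B) (hle : ∀ y ∈ K, g y ≤ A * densSq x₀ θ y + B * densSq x₀ η y) :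
    ∫ y, g y ≤ A * ∫ p, formInner (θ p) (θ p) ∂(riemVol n M) +
      B * ∫ p, formInner (η p) (η p) ∂(riemVol n M) := by
  have h1 := (integrableOn_densSq (x₀ := x₀) hθ).const_mul A
  have h2 := (integrableOn_densSq (x₀ := x₀) hη).const_mul B
  rw [← setIntegral_eq_integral_of_forall_compl_eq_zero (s := (extChartAt (𝓡 n) x₀).target)
    fun y hy => hg0 y fun h => hy (hKt h)]
  calc _ ≤ ∫ y in (extChartAt (𝓡 n) x₀).target, (A * densSq x₀ θ y + B * densSq x₀ η y) := by
        refine setIntegral_mono_on hg.integrableOn (h1.add h2)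
          (isOpen_target x₀).measurableSet fun y _ => ?_
        by_cases hy : y ∈ K
        · exact hle y hy
        · rw [hg0 y hy]
          exact add_nonneg (mul_nonneg hA (densSq_nonneg _ _)) (mul_nonneg hB (densSq_nonneg _ _))
    _ ≤ _ := by
        rw [integral_add h1 h2, integral_const_mul, integral_const_mul]
        exact add_le_add (mul_le_mul_of_nonneg_left (setIntegral_densSq_le hθ) hA)
          (mul_le_mul_of_nonneg_left (setIntegral_densSq_le hη) hB)

theorem integral_le_of_le_densSq {θ : Form n M k} (hθ : IsSmoothForm θ)
    (hKt : K ⊆ (extChartAt (𝓡 n) x₀).target) {g : EuclideanSpace ℝ (Fin n) → ℝ}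
    (hg : Integrable g) (hg0 : ∀ y ∉ K, g y = 0) {A : ℝ} (hA : 0 ≤ A)
    (hle : ∀ y ∈ K, g y ≤ A * densSq x₀ θ y) :
    ∫ y, g y ≤ A * ∫ p, formInner (θ p) (θ p) ∂(riemVol n M) := by
  have := integral_le_of_le_densSq_add hθ hθ hKt hg hg0 hA le_rfl fun y hy => by
    simpa using hle y hy
  simpa using this

theorem integral_fromChart_le {ψ : EuclideanSpace ℝ (Fin n) → EuclideanSpace ℝ (Fin n) [⋀^Fin k]→L[ℝ] ℝ}
    (hK : IsCompact K) (hKt : K ⊆ (extChartAt (𝓡 n) x₀).target) (hψ : ContDiff ℝ ∞ ψ)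
    (hψ0 : ∀ y ∉ K, ψ y = 0) {A : ℝ} (hA : ∀ θ : Form n M k, ∀ y ∈ K,
      densSq x₀ θ y ≤ A * ∑ J, coeff b (chartRep x₀ θ) J y ^ 2) :
    ∫ p, formInner (fromChart x₀ ψ p) (fromChart x₀ ψ p) ∂(riemVol n M) ≤
      A * ∫ y, ∑ J, coeff b ψ J y ^ 2 := by
  have hs := isSmoothForm_fromChart hK hKt hψ0 hψ.contDiffOn
  have hc := continuous_formInner hs hs
  have h0 : ∀ p ∉ chartDom n x₀, formInner (fromChart x₀ ψ p) (fromChart x₀ ψ p) = 0 := by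
    intro p hp
    have : fromChart x₀ ψ p = 0 := by
      by_contra h; exact hp (fromChart_apply_ne h).1
    rw [this, formInner_zero_left]
  rw [integral_riemVol_eq_chart x₀ hc h0]
  have hzero : ∀ y ∈ (extChartAt (𝓡 n) x₀).target, y ∉ K → densSq x₀ (fromChart x₀ ψ) y = 0 := by
    intro y hy hyK
    have : ∑ J : Fin k → ι, coeff b (chartRep x₀ (fromChart x₀ ψ)) J y ^ 2 = 0 :=
      Finset.sum_eq_zero fun J _ => by
        rw [coeff, chartRep_fromChart ψ hy, hψ0 y hyK]; simp
    rw [densSq, formInner_mul_volDensity b hy]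
    refine mul_eq_zero_of_right _ (Finset.sum_eq_zero fun I _ => Finset.sum_eq_zero fun J _ => ?_)
    rw [chartRep_fromChart ψ hy, hψ0 y hyK]; simp
  have hi : Integrable (fun y => ∑ J, coeff b ψ J y ^ 2) :=
    integrable_finsetSum _ fun J _ => integrable_of_zero_off hK
      ((contDiff_coeff hψ J).continuous.pow 2) fun y hy => by simp [coeff, hψ0 y hy]
  rw [← integral_const_mul, ← setIntegral_eq_integral_of_forall_compl_eq_zero
    (s := (extChartAt (𝓡 n) x₀).target) (f := fun y => A * ∑ J, coeff b ψ J y ^ 2)]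
  · refine setIntegral_mono_on ?_ (hi.const_mul A).integrableOn (isOpen_target x₀).measurableSet
      fun y hy => ?_
    · exact (integrableOn_chartDom_iff x₀ hc.aestronglyMeasurable).1
        (integrable_formInner hs.mem_sqIntegrable hs.mem_sqIntegrable).integrableOn
    · by_cases hyK : y ∈ K
      · refine (hA (fromChart x₀ ψ) y hyK).trans (le_of_eq ?_)
        simp only [coeff, chartRep_fromChart ψ hy]
      · refine (hzero y hy hyK).le.trans (le_of_eq ?_)
        simp [coeff, hψ0 y hyK]
  · intro y hy
    simp [coeff, hψ0 y fun h => hy (hKt h)]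
end ChartBounds
end KreinFeller

namespace KreinFeller

/-! ### The weak codifferential of a cut-off form. -/

section WeakBound
variable {n : ℕ} {M : Type*} [TopologicalSpace M] [ChartedSpace (EuclideanSpace ℝ (Fin n)) M]
  [IsManifold (𝓡 n) ∞ M] {k : ℕ}
  [RiemannianBundle (fun x : M => TangentSpace (𝓡 n) x)]
  [IsContMDiffRiemannianBundle (𝓡 n) ∞ (EuclideanSpace ℝ (Fin n))
    (fun x : M => TangentSpace (𝓡 n) x)]
  {ι : Type*} [Fintype ι] [DecidableEq ι] {x₀ : M}
  (b : Module.Basis ι ℝ (EuclideanSpace ℝ (Fin n))) {K : Set (EuclideanSpace ℝ (Fin n))}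
  [T2Space M] [CompactSpace M] [MeasurableSpace M] [BorelSpace M]

/-- Expand `|α + 2sβ|² ≥ 0` and divide by `4s`. The weight `s` lets the term in `β` be made as small
as desired. -/
theorem neg_formInner_le {V : Type*} [NormedAddCommGroup V] [InnerProductSpace ℝ V]
    [FiniteDimensional ℝ V] (α β : V [⋀^Fin k]→L[ℝ] ℝ) {s : ℝ} (hs : 0 < s) :
    -formInner α β ≤ (4 * s)⁻¹ * formInner α α + s * formInner β β := by
  have h := formInner_self_nonneg (α + (2 * s) • β)
  rw [formInner_add_left, formInner_add_right, formInner_add_right, formInner_smul_left,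
    formInner_smul_right, formInner_smul_left, formInner_smul_right, formInner_comm β α] at h
  have h2 : (4 * s)⁻¹ * (formInner α α + 2 * s * formInner α β + (2 * s * formInner α β +
      2 * s * (2 * s * formInner β β))) =
      (4 * s)⁻¹ * formInner α α + formInner α β + s * formInner β β := by
    field_simp; ring
  have h3 : 0 ≤ (4 * s)⁻¹ * (formInner α α + 2 * s * formInner α β + (2 * s * formInner α β +
      2 * s * (2 * s * formInner β β))) := mul_nonneg (by positivity) h
  linarith

/-- Integration by parts on the manifold against a form supported in a chart. -/
theorem integral_pairCoeff_extDeriv {φ : Form n M (k + 1)} (hφ : IsSmoothForm φ)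
    {ψ : EuclideanSpace ℝ (Fin n) → EuclideanSpace ℝ (Fin n) [⋀^Fin k]→L[ℝ] ℝ}
    (hK : IsCompact K) (hKt : K ⊆ (extChartAt (𝓡 n) x₀).target) (hψ : ContDiff ℝ ∞ ψ)
    (hψ0 : ∀ y ∉ K, ψ y = 0) :
    ∫ y, ∑ I, ∑ J, pairCoeff x₀ b I J y *
        (coeff b (chartRep x₀ φ) J y * coeff b (extDeriv ψ) I y) =
      (k + 1).factorial * ∫ p, formInner (adjD φ p) (fromChart x₀ ψ p) ∂(riemVol n M) := by
  have hs := isSmoothForm_fromChart hK hKt hψ0 hψ.contDiffOn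
  have hcl : closure {p | fromChart x₀ ψ p ≠ 0} ⊆ chartDom n x₀ := by
    refine (closure_fromChart_subset hK hKt hψ0).trans ?_
    rintro p ⟨z, hz, rfl⟩
    exact symm_mem_chartDom (hKt hz)
  -- Only the adjoint relation defining `d*` is used; the form carried over from the chart is
  -- extended by zero to a smooth form on `M`.
  rw [integral_adjD hφ hs]
  simp only [formInner_comm (φ _)]
  rw [integral_riemVol_eq_chart x₀ (continuous_formInner (isSmoothForm_extD hs) hφ) fun p hp => by
    rw [extD_eq_zero_of_notMem fun h => hp (hcl h), formInner_zero_left]]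
  rw [← integral_const_mul, ← setIntegral_eq_integral_of_forall_compl_eq_zero
    (s := (extChartAt (𝓡 n) x₀).target)]
  · refine setIntegral_congr_fun (isOpen_target x₀).measurableSet fun y hy => ?_
    have hev : chartRep x₀ (fromChart x₀ ψ) =ᶠ[𝓝 y] ψ := by
      filter_upwards [(isOpen_target x₀).mem_nhds hy] with z hz using chartRep_fromChart ψ hz
    rw [formInner_mul_volDensity b hy, chartRep_extD hs hy, hev.extDeriv_eq, ← mul_assoc,
      mul_inv_cancel₀ (by positivity), one_mul]
    refine Finset.sum_congr rfl fun I _ => Finset.sum_congr rfl fun J _ => ?_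
    simp only [coeff]; ring
  · intro y hy
    have hyK : y ∉ K := fun h => hy (hKt h)
    have hev : ψ =ᶠ[𝓝 y] fun _ => 0 := by
      filter_upwards [hK.isClosed.isOpen_compl.mem_nhds hyK] with z hz using hψ0 z hz
    have hd : DifferentiableAt ℝ ψ y := (hψ.differentiable (by simp)) y
    refine Finset.sum_eq_zero fun I _ => Finset.sum_eq_zero fun J _ => ?_
    rw [coeff_extDeriv hd, Finset.sum_eq_zero, mul_zero, mul_zero]
    intro r _
    rw [fderiv_zero_off hK.isClosed (coeff_zero_off hψ0 _) y hyK]; simp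

/-- A localized form has a weak codifferential that is controlled by the codifferential and the
norm of the form. -/
theorem exists_neg_integral_le (hK : IsCompact K) (hKt : K ⊆ (extChartAt (𝓡 n) x₀).target)
    {χ : EuclideanSpace ℝ (Fin n) → ℝ} (hχ : ContDiff ℝ ∞ χ) (hχ1 : ∀ y, |χ y| ≤ 1) {τ : ℝ}
    (hτ : 0 < τ) (k : ℕ) : ∃ A : ℝ, 0 ≤ A ∧ ∀ φ : Form n M (k + 1), IsSmoothForm φ →
      ∀ ψ : EuclideanSpace ℝ (Fin n) → EuclideanSpace ℝ (Fin n) [⋀^Fin k]→L[ℝ] ℝ,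
      ContDiff ℝ ∞ ψ → (∀ y ∉ K, ψ y = 0) →
      -∫ y, ∑ I, ∑ J, pairCoeff x₀ b I J y *
        (coeff b (fun z => χ z • chartRep x₀ φ z) J y * coeff b (extDeriv ψ) I y) ≤
      A * (∫ p, formInner (φ p) (φ p) ∂(riemVol n M) +
        ∫ p, formInner (adjD φ p) (adjD φ p) ∂(riemVol n M)) +
      τ * ∫ y, ∑ L, coeff b ψ L y ^ 2 := by
  obtain ⟨A₁, hA₁, hb₁⟩ := exists_densSq_le b hK hKt k
  obtain ⟨A₂, hA₂, hb₂⟩ := exists_sq_coeff_le (M := M) b hK hKt (k + 1)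
  obtain ⟨a, ha, hba⟩ := exists_bound_family hK
    (f := fun (p : ((Fin (k + 1) → ι) × (Fin (k + 1) → ι)) × ι) y =>
      pairCoeff x₀ b p.1.1 p.1.2 y * fderiv ℝ χ y (b p.2)) fun p =>
    ((contDiffOn_pairCoeff x₀ b p.1.1 p.1.2).continuousOn.mono hKt).mul
      ((hχ.continuous_fderiv (by simp)).clm_apply continuous_const).continuousOn
  set N : ℝ := Fintype.card (Fin (k + 1) → ι) * Fintype.card (Fin (k + 1) → ι) * (k + 1) with hN
  set c := ((k + 1).factorial : ℝ) with hc
  have hc0 : 0 < c := by positivity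
  have hN0 : 0 ≤ N := by positivity
  -- The weights `s` and `s'` allot half of `τ` each to the manifold pairing and to the commutator.
  set s := τ / (2 * c * (A₁ + 1)) with hs
  set s' := τ / (2 * (N + 1)) with hs'
  have hs0 : 0 < s := by positivity
  have hs0' : 0 < s' := by positivity
  refine ⟨c * (4 * s)⁻¹ + N * (a ^ 2 * A₂ / (4 * s')), by positivity, fun φ hφ ψ hψ hψ0 => ?_⟩
  -- The cutoff is moved from `φ` to `ψ`, so that the codifferential falls on the uncut form `φ`. By
  -- Leibniz this costs a term without derivatives of `φ` or `ψ`.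
  have hχψ : ContDiff ℝ ∞ fun z => χ z • ψ z := hχ.smul hψ
  have hχψ0 : ∀ y ∉ K, χ y • ψ y = 0 := fun y hy => by rw [hψ0 y hy, smul_zero]
  have hFs := isSmoothForm_fromChart hK hKt hχψ0 hχψ.contDiffOn
  set P := ∫ y, ∑ L, coeff b ψ L y ^ 2 with hP
  set Φ := ∫ p, formInner (φ p) (φ p) ∂(riemVol n M)
  set Φ' := ∫ p, formInner (adjD φ p) (adjD φ p) ∂(riemVol n M)
  have hzψ : ∀ L, ∀ y ∉ K, coeff b ψ L y = 0 := coeff_zero_off hψ0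
  have hcψ : ∀ L, ContDiff ℝ ∞ (coeff b ψ L) := contDiff_coeff hψ
  have hPi : Integrable fun y => ∑ L, coeff b ψ L y ^ 2 :=
    integrable_finsetSum _ fun L _ => integrable_of_zero_off hK ((hcψ L).continuous.pow 2)
      fun y hy => by simp [hzψ L y hy]
  have hcv : ∀ J, ContinuousOn (coeff b (chartRep x₀ φ) J) (extChartAt (𝓡 n) x₀).target :=
    fun J => (contDiffOn_alternating_apply (hφ x₀) _).continuousOn
  -- the term from the manifold
  have hfirst : -∫ y, ∑ I, ∑ J, pairCoeff x₀ b I J y * (coeff b (chartRep x₀ φ) J y *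
      coeff b (extDeriv fun z => χ z • ψ z) I y) ≤ c * (4 * s)⁻¹ * Φ' + τ / 2 * P := by
    rw [integral_pairCoeff_extDeriv b hφ hK hKt hχψ hχψ0, ← mul_neg, ← integral_neg]
    have hadj := isSmoothForm_adjD hφ
    have i1 := integrable_formInner (hadj.mem_sqIntegrable (ν := riemVol n M)) hadj.mem_sqIntegrable
    have i2 := integrable_formInner (hFs.mem_sqIntegrable (ν := riemVol n M)) hFs.mem_sqIntegrable
    have i3 := integrable_formInner (hadj.mem_sqIntegrable (ν := riemVol n M)) hFs.mem_sqIntegrable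
    have h1 := integral_mono i3.neg ((i1.const_mul (4 * s)⁻¹).add (i2.const_mul s))
      fun p => neg_formInner_le (adjD φ p) (fromChart x₀ (fun z => χ z • ψ z) p) hs0
    have h2 : ∫ p, ((4 * s)⁻¹ * formInner (adjD φ p) (adjD φ p) +
        s * formInner (fromChart x₀ (fun z => χ z • ψ z) p)
          (fromChart x₀ (fun z => χ z • ψ z) p)) ∂(riemVol n M) = (4 * s)⁻¹ * Φ' + s *
        ∫ p, formInner (fromChart x₀ (fun z => χ z • ψ z) p)
          (fromChart x₀ (fun z => χ z • ψ z) p) ∂(riemVol n M) := by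
      rw [integral_add (i1.const_mul _) (i2.const_mul s), integral_const_mul, integral_const_mul]
    have h3 := (integral_fromChart_le b hK hKt hχψ hχψ0 hb₁)
    have h4 : ∫ y, ∑ J, coeff b (fun z => χ z • ψ z) J y ^ 2 ≤ P := by
      refine integral_mono (integrable_finsetSum _ fun L _ => integrable_of_zero_off hK
        ((contDiff_coeff hχψ L).continuous.pow 2) fun y hy => by
          simp [coeff_smul, hzψ L y hy]) hPi fun y => Finset.sum_le_sum fun L _ => ?_
      rw [coeff_smul, mul_pow, ← sq_abs (χ y)]
      exact mul_le_of_le_one_left (sq_nonneg _) (pow_le_one₀ (abs_nonneg _) (hχ1 y))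
    have hP0 : 0 ≤ P := integral_nonneg fun y => Finset.sum_nonneg fun _ _ => sq_nonneg _
    have h5 : c * (s * (A₁ * P)) ≤ τ / 2 * P := by
      have : c * (s * (A₁ + 1)) = τ / 2 := by rw [hs]; field_simp
      rw [← this]
      have : 0 ≤ c * s * P := by positivity
      nlinarith
    have h6 : s * ∫ p, formInner (fromChart x₀ (fun z => χ z • ψ z) p)
        (fromChart x₀ (fun z => χ z • ψ z) p) ∂(riemVol n M) ≤ s * (A₁ * P) := by
      gcongr
      exact h3.trans (mul_le_mul_of_nonneg_left h4 hA₁)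
    have h7 := mul_le_mul_of_nonneg_left ((h1.trans h2.le).trans (add_le_add_right h6 _)) hc0.le
    refine h7.trans ?_
    rw [mul_add, ← mul_assoc]
    linarith
  -- the commutator
  set R : EuclideanSpace ℝ (Fin n) → ℝ := fun y => ∑ I, ∑ J, ∑ r : Fin (k + 1),
    (-1) ^ r.val * (pairCoeff x₀ b I J y * fderiv ℝ χ y (b (I r)) *
      (coeff b (chartRep x₀ φ) J y * coeff b ψ (r.removeNth I) y)) with hR
  have hR0 : ∀ y ∉ K, R y = 0 := fun y hy => by simp [hR, hzψ _ y hy]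
  have hRc : Continuous R := by
    refine continuous_of_zero_off (isOpen_target x₀) hK.isClosed hKt ?_ hR0
    refine continuousOn_finsetSum _ fun I _ => continuousOn_finsetSum _ fun J _ =>
      continuousOn_finsetSum _ fun r _ => continuousOn_const.mul ?_
    exact ((contDiffOn_pairCoeff x₀ b I J).continuousOn.mul
      ((hχ.continuous_fderiv (by simp)).clm_apply continuous_const).continuousOn).mul
      ((hcv J).mul (hcψ _).continuous.continuousOn)
  have hRi := integrable_of_zero_off (μ := volume) hK hRc hR0
  have hsecond : ∫ y, R y ≤ N * (a ^ 2 * A₂ / (4 * s')) * Φ + τ / 2 * P := by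
    have h1 : ∫ y, (R y - N * s' * ∑ L, coeff b ψ L y ^ 2) ≤
        N * (a ^ 2 * A₂ / (4 * s')) * Φ := by
      refine integral_le_of_le_densSq hφ hKt (hRi.sub (hPi.const_mul _)) (fun y hy => ?_)
        (by positivity) fun y hy => ?_
      · simp [hR0 y hy, hzψ _ y hy]
      · have hterm : ∀ I J (r : Fin (k + 1)), (-1) ^ r.val *
            (pairCoeff x₀ b I J y * fderiv ℝ χ y (b (I r)) *
              (coeff b (chartRep x₀ φ) J y * coeff b ψ (r.removeNth I) y)) ≤
            a ^ 2 * A₂ / (4 * s') * densSq x₀ φ y + s' * ∑ L, coeff b ψ L y ^ 2 := by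
          intro I J r
          have e1 := hba y hy ((I, J), I r)
          have e2 := hb₂ φ y hy J
          have e3 := le_sum_sq (fun L => coeff b ψ L y) (r.removeNth I)
          refine (le_abs_self _).trans ?_
          rw [abs_mul, abs_pow, abs_neg, abs_one, one_pow, one_mul, abs_mul (pairCoeff x₀ b I J y * _),
            abs_mul (coeff b (chartRep x₀ φ) J y)]
          simp only at e1 e3
          set v := coeff b (chartRep x₀ φ) J y
          set q := coeff b ψ (r.removeNth I) y
          have e4 : |pairCoeff x₀ b I J y * fderiv ℝ χ y (b (I r))| * (|v| * |q|) ≤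
              a * (|v| * |q|) := by gcongr
          refine e4.trans ?_
          have e5 : a * (|v| * |q|) = a ^ 2 / (4 * s') * v ^ 2 + s' * q ^ 2 -
              s' * (a * |v| / (2 * s') - |q|) ^ 2 := by
            rw [← sq_abs v, ← sq_abs q]; field_simp; ring
          have e6 : 0 ≤ s' * (a * |v| / (2 * s') - |q|) ^ 2 := by positivity
          have e7 : a ^ 2 / (4 * s') * v ^ 2 ≤ a ^ 2 / (4 * s') * (A₂ * densSq x₀ φ y) := by gcongr
          have e8 : s' * q ^ 2 ≤ s' * ∑ L, coeff b ψ L y ^ 2 := by gcongr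
          have e9 : a ^ 2 / (4 * s') * (A₂ * densSq x₀ φ y) =
            a ^ 2 * A₂ / (4 * s') * densSq x₀ φ y := by ring
          linarith
        have hsum := Finset.sum_le_sum fun I (_ : I ∈ Finset.univ) => Finset.sum_le_sum
          fun J (_ : J ∈ Finset.univ) => Finset.sum_le_sum fun r (_ : r ∈ Finset.univ) =>
            hterm I J r
        simp only [Finset.sum_const, Finset.card_univ, nsmul_eq_mul, Fintype.card_fin] at hsum
        push_cast at hsum
        simp only [hR]
        refine (sub_le_sub_right hsum _).trans (le_of_eq ?_)
        rw [hN]; push_cast; ring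
    rw [integral_sub hRi (hPi.const_mul _), integral_const_mul] at h1
    have h2 : N * s' * P ≤ τ / 2 * P := by
      have hP0 : 0 ≤ P := integral_nonneg fun y => Finset.sum_nonneg fun _ _ => sq_nonneg _
      have : (N + 1) * s' = τ / 2 := by rw [hs']; field_simp
      have h3 : 0 ≤ s' * P := by positivity
      rw [← this]; linarith
    linarith
  have hi1 : Integrable fun y => ∑ I, ∑ J, pairCoeff x₀ b I J y * (coeff b (chartRep x₀ φ) J y *
      coeff b (extDeriv fun z => χ z • ψ z) I y) := by
    have hz : ∀ I, ∀ y ∉ K, coeff b (extDeriv fun z => χ z • ψ z) I y = 0 := by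
      intro I y hy
      rw [coeff_extDeriv ((hχψ.differentiable (by simp)) y)]
      refine Finset.sum_eq_zero fun r _ => ?_
      rw [fderiv_zero_off hK.isClosed (coeff_zero_off hχψ0 _) y hy]; simp
    refine integrable_finsetSum _ fun I _ => integrable_finsetSum _ fun J _ =>
      integrable_of_zero_off hK (continuous_of_zero_off (isOpen_target x₀) hK.isClosed hKt ?_ ?_) ?_
    · refine (contDiffOn_pairCoeff x₀ b I J).continuousOn.mul ((hcv J).mul ?_)
      exact ((contDiffOn_alternating_apply (contDiffOn_extDeriv isOpen_univ
        hχψ.contDiffOn) _).continuousOn).mono (subset_univ _)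
    · intro y hy; rw [hz I y hy, mul_zero, mul_zero]
    · intro y hy; rw [hz I y hy, mul_zero, mul_zero]
  have hsplit : ∫ y, ∑ I, ∑ J, pairCoeff x₀ b I J y *
      (coeff b (fun z => χ z • chartRep x₀ φ z) J y * coeff b (extDeriv ψ) I y) =
      (∫ y, ∑ I, ∑ J, pairCoeff x₀ b I J y * (coeff b (chartRep x₀ φ) J y *
        coeff b (extDeriv fun z => χ z • ψ z) I y)) - ∫ y, R y := by
    rw [← integral_sub hi1 hRi]
    refine integral_congr_ae (Eventually.of_forall fun y => ?_)
    simp only [hR]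
    rw [← Finset.sum_sub_distrib]
    refine Finset.sum_congr rfl fun I _ => ?_
    rw [← Finset.sum_sub_distrib]
    refine Finset.sum_congr rfl fun J _ => ?_
    rw [coeff_extDeriv_smul ((hχ.differentiable (by simp)) y) ((hψ.differentiable (by simp)) y),
      coeff_smul, mul_add, mul_add, Finset.mul_sum, Finset.mul_sum, add_sub_assoc,
      ← Finset.sum_sub_distrib, Finset.sum_eq_zero, add_zero]
    · ring
    · intro r _; ring
  rw [hsplit, neg_sub]
  have hΦ : 0 ≤ Φ := integral_nonneg fun y => formInner_self_nonneg _
  have hΦ' : 0 ≤ Φ' := integral_nonneg fun y => formInner_self_nonneg _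
  have h1 : 0 ≤ c * (4 * s)⁻¹ * Φ := by positivity
  have h2 : 0 ≤ N * (a ^ 2 * A₂ / (4 * s')) * Φ' := by positivity
  linarith
end WeakBound
end KreinFeller

namespace KreinFeller

/-! ### Gaffney's inequality near a point of the manifold. -/

section GradientBound
variable {n : ℕ} {M : Type*} [TopologicalSpace M] [ChartedSpace (EuclideanSpace ℝ (Fin n)) M]
  [IsManifold (𝓡 n) ∞ M] {k : ℕ}
  [RiemannianBundle (fun x : M => TangentSpace (𝓡 n) x)]
  {x₀ : M} {K : Set (EuclideanSpace ℝ (Fin n))}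

/-- Pull an orthonormal basis of the tangent space back through the coordinate frame. In this basis
the principal coefficients at `y` are a multiple of the identity, so they are close to it nearby. -/
theorem exists_basis_metricMatrix_eq_one {y : EuclideanSpace ℝ (Fin n)}
    (hy : y ∈ (extChartAt (𝓡 n) x₀).target) :
    ∃ b : Module.Basis (Fin n) ℝ (EuclideanSpace ℝ (Fin n)), metricMatrix x₀ b y = 1 := by
  have hp := symm_mem_chartDom hy
  have hf : Module.finrank ℝ (TangentSpace (𝓡 n) ((extChartAt (𝓡 n) x₀).symm y)) = n :=
    finrank_euclideanSpace_fin (𝕜 := ℝ)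
  set o := (stdOrthonormalBasis ℝ (TangentSpace (𝓡 n) ((extChartAt (𝓡 n) x₀).symm y))).reindex
    (finCongr hf)
  refine ⟨o.toBasis.map (frameEquiv hp).symm, ?_⟩
  have h : ∀ i, frame n x₀ ((extChartAt (𝓡 n) x₀).symm y)
      (o.toBasis.map (frameEquiv hp).symm i) = o i := fun i => by
    rw [Module.Basis.map_apply]
    exact ((frameEquiv hp).apply_symm_apply _).trans (congrFun (OrthonormalBasis.coe_toBasis o) i)
  ext i j
  rw [metricMatrix, Matrix.of_apply, h, h, o.inner_eq_ite, Matrix.one_apply]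

theorem pairCoeff_of_metricMatrix_eq_one {b : Module.Basis (Fin n) ℝ (EuclideanSpace ℝ (Fin n))}
    {y : EuclideanSpace ℝ (Fin n)} (h : metricMatrix x₀ b y = 1) (I J : Fin k → Fin n) :
    pairCoeff x₀ b I J y = if I = J then volDensity x₀ y else 0 := by
  rw [pairCoeff, h, inv_one]
  split_ifs with hIJ
  · subst hIJ; simp
  · obtain ⟨r, hr⟩ := Function.ne_iff.1 hIJ
    rw [Finset.prod_eq_zero (Finset.mem_univ r) (by rw [Matrix.one_apply, if_neg hr]), mul_zero]

/-- For functions the gradient is `d` itself; degree zero thus needs neither a codifferential nor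
the divergence argument. -/
theorem sum_sq_fderiv_zeroForm {E ι : Type*} [NormedAddCommGroup E] [NormedSpace ℝ E]
    [FiniteDimensional ℝ E] [Fintype ι] {b : ι → E} {u : E → E [⋀^Fin 0]→L[ℝ] ℝ} {y : E}
    (hu : DifferentiableAt ℝ u y) :
    ∑ i, ∑ J, fderiv ℝ (coeff b u J) y (b i) ^ 2 = ∑ I, coeff b (extDeriv u) I y ^ 2 := by
  rw [← Fintype.sum_prod_type', ← (Fin.insertNthEquiv (fun _ => ι) (0 : Fin 1)).sum_comp]
  refine Finset.sum_congr rfl fun p _ => ?_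
  change _ = coeff b (extDeriv u) (Fin.insertNth (0 : Fin 1) p.1 p.2 : Fin 1 → ι) y ^ 2
  rw [coeff_extDeriv hu, Fin.sum_univ_one, Fin.insertNth_apply_same, Fin.removeNth_insertNth]
  simp

variable [IsContMDiffRiemannianBundle (𝓡 n) ∞ (EuclideanSpace ℝ (Fin n))
    (fun x : M => TangentSpace (𝓡 n) x)]
  {ι : Type*} [Fintype ι] [DecidableEq ι] 
  (b : Module.Basis ι ℝ (EuclideanSpace ℝ (Fin n)))

theorem contDiff_cutoff {φ : Form n M k} (hφ : IsSmoothForm φ) (hK : IsCompact K)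
    (hKt : K ⊆ (extChartAt (𝓡 n) x₀).target) {χ : EuclideanSpace ℝ (Fin n) → ℝ}
    (hχ : ContDiff ℝ ∞ χ) (hχ0 : ∀ y ∉ K, χ y = 0) :
    ContDiff ℝ ∞ fun y => χ y • chartRep x₀ φ y :=
  contDiff_of_zero_off (isOpen_target x₀) hK.isClosed hKt (hχ.contDiffOn.smul (hφ x₀))
    fun y hy => by rw [hχ0 y hy, zero_smul]

variable [T2Space M] [CompactSpace M] [MeasurableSpace M] [BorelSpace M]

theorem exists_integral_sq_coeff_le (hK : IsCompact K)
    (hKt : K ⊆ (extChartAt (𝓡 n) x₀).target) {χ : EuclideanSpace ℝ (Fin n) → ℝ}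
    (hχ : ContDiff ℝ ∞ χ) (hχ0 : ∀ y ∉ K, χ y = 0) (hχ1 : ∀ y, |χ y| ≤ 1) (k : ℕ) :
    ∃ A : ℝ, 0 ≤ A ∧ ∀ φ : Form n M k, IsSmoothForm φ →
      ∫ y, ∑ J, coeff b (fun z => χ z • chartRep x₀ φ z) J y ^ 2 ≤
        A * ∫ p, formInner (φ p) (φ p) ∂(riemVol n M) := by
  obtain ⟨A, hA, hb⟩ := exists_sq_coeff_le (M := M) b hK hKt k
  refine ⟨Fintype.card (Fin k → ι) * A, by positivity, fun φ hφ => ?_⟩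
  have hU := contDiff_cutoff hφ hK hKt hχ hχ0
  have h0 : ∀ y ∉ K, χ y • chartRep x₀ φ y = 0 := fun y hy => by rw [hχ0 y hy, zero_smul]
  refine integral_le_of_le_densSq hφ hKt (integrable_finsetSum _ fun J _ =>
    integrable_of_zero_off hK ((contDiff_coeff hU J).continuous.pow 2) fun y hy => by
      simp [coeff, h0 y hy]) (fun y hy => by simp [coeff, h0 y hy]) (by positivity) fun y hy => ?_
  refine (Finset.sum_le_card_nsmul _ _ (A * densSq x₀ φ y) fun J _ => ?_).trans ?_
  · rw [Pi.pow_apply, coeff_smul, mul_pow, ← sq_abs (χ y)]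
    exact (mul_le_of_le_one_left (sq_nonneg _) (pow_le_one₀ (abs_nonneg _) (hχ1 y))).trans
      (hb φ y hy J)
  · rw [Finset.card_univ, nsmul_eq_mul, mul_assoc]

theorem exists_integral_sq_extDeriv_le (hK : IsCompact K)
    (hKt : K ⊆ (extChartAt (𝓡 n) x₀).target) {χ : EuclideanSpace ℝ (Fin n) → ℝ}
    (hχ : ContDiff ℝ ∞ χ) (hχ0 : ∀ y ∉ K, χ y = 0) (hχ1 : ∀ y, |χ y| ≤ 1) (k : ℕ) :
    ∃ A : ℝ, 0 ≤ A ∧ ∀ φ : Form n M k, IsSmoothForm φ →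
      ∫ y, ∑ I, coeff b (extDeriv fun z => χ z • chartRep x₀ φ z) I y ^ 2 ≤
        A * (∫ p, formInner (φ p) (φ p) ∂(riemVol n M) +
          ∫ p, formInner (extD φ p) (extD φ p) ∂(riemVol n M)) := by
  obtain ⟨A, hA, hb⟩ := exists_sq_coeff_le (M := M) b hK hKt k
  obtain ⟨A', hA', hb'⟩ := exists_sq_coeff_le (M := M) b hK hKt (k + 1)
  obtain ⟨B, hB, hbB⟩ := exists_bound_family hK (f := fun i y => fderiv ℝ χ y (b i)) fun i =>
    ((hχ.continuous_fderiv (by simp)).clm_apply continuous_const).continuousOn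
  set N := (Fintype.card (Fin (k + 1) → ι) : ℝ)
  refine ⟨N * (2 * ((k + 1) * B) ^ 2 * A) + N * (2 * A'), by positivity, fun φ hφ => ?_⟩
  have hU := contDiff_cutoff hφ hK hKt hχ hχ0
  have h0 : ∀ y ∉ K, χ y • chartRep x₀ φ y = 0 := fun y hy => by rw [hχ0 y hy, zero_smul]
  have hz : ∀ I, ∀ y ∉ K, coeff b (extDeriv fun z => χ z • chartRep x₀ φ z) I y = 0 := by
    intro I y hy
    rw [coeff_extDeriv ((hU.differentiable (by simp)) y)]
    refine Finset.sum_eq_zero fun r _ => ?_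
    rw [fderiv_zero_off hK.isClosed (coeff_zero_off h0 _) y hy]; simp
  have hc : ∀ I, Continuous (coeff b (extDeriv fun z => χ z • chartRep x₀ φ z) I) := fun I =>
    continuousOn_univ.1 (contDiffOn_alternating_apply (contDiffOn_extDeriv isOpen_univ
      hU.contDiffOn) _).continuousOn
  have h1 : 0 ≤ ∫ p, formInner (φ p) (φ p) ∂(riemVol n M) :=
    integral_nonneg fun p => formInner_self_nonneg _
  have h2 : 0 ≤ ∫ p, formInner (extD φ p) (extD φ p) ∂(riemVol n M) :=
    integral_nonneg fun p => formInner_self_nonneg _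
  refine (integral_le_of_le_densSq_add (A := N * (2 * ((k + 1) * B) ^ 2 * A)) (B := N * (2 * A'))
    hφ (isSmoothForm_extD hφ) hKt
    (integrable_finsetSum _ fun I _ => integrable_of_zero_off hK ((hc I).pow 2) fun y hy => by
      simp [hz I y hy]) (fun y hy => by simp [hz _ y hy]) (by positivity) (by positivity)
    fun y hy => ?_).trans ?_
  · refine (Finset.sum_le_card_nsmul _ _ ((2 * ((k + 1) * B) ^ 2 * A) * densSq x₀ φ y +
      (2 * A') * densSq x₀ (extD φ) y) fun I _ => ?_).trans ?_
    · have hd : DifferentiableAt ℝ (chartRep x₀ φ) y :=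
        ((hφ x₀).contDiffAt ((isOpen_target x₀).mem_nhds (hKt hy))).differentiableAt (by simp)
      have hI := hb' (extD φ) y hy I
      rw [coeff, chartRep_extD hφ (hKt hy)] at hI
      refine (sq_coeff_extDeriv_smul_le ((hχ.differentiable (by simp)) y) hd (hχ1 y) (hbB y hy) I
        hI (hb φ y hy)).trans (le_of_eq ?_)
      rw [mul_pow, mul_pow, Real.sq_sqrt (mul_nonneg hA (densSq_nonneg _ _))]
      ring
    · rw [Finset.card_univ, nsmul_eq_mul]
      exact le_of_eq (by ring)
  · have h3 : 0 ≤ N * (2 * ((k + 1) * B) ^ 2 * A) := by positivity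
    have h4 : 0 ≤ N * (2 * A') := by positivity
    nlinarith [mul_nonneg h3 h2, mul_nonneg h4 h1]

/-- The squared `W^{1,2}`-norm of a smooth form. -/
noncomputable def sobSq (φ : Form n M k) : ℝ :=
  ∫ p, formInner (φ p) (φ p) ∂(riemVol n M) +
    (∫ p, formInner (extD φ p) (extD φ p) ∂(riemVol n M) +
      ∫ p, formInner (coD φ p) (coD φ p) ∂(riemVol n M))

theorem integral_formInner_self_nonneg (φ : Form n M k) :
    0 ≤ ∫ p, formInner (φ p) (φ p) ∂(riemVol n M) :=
  integral_nonneg fun _ => formInner_self_nonneg _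

/-- **Gaffney's inequality**, localized near a point. -/
theorem exists_gradient_bound (x₀ : M) : ∀ k : ℕ,
    ∃ (b : Module.Basis (Fin n) ℝ (EuclideanSpace ℝ (Fin n))) (K : Set (EuclideanSpace ℝ (Fin n)))
      (χ : EuclideanSpace ℝ (Fin n) → ℝ) (A : ℝ),
      IsCompact K ∧ K ⊆ (extChartAt (𝓡 n) x₀).target ∧ ContDiff ℝ ∞ χ ∧ (∀ y ∉ K, χ y = 0) ∧
      (∀ y, |χ y| ≤ 1) ∧ (∀ᶠ y in 𝓝 (extChartAt (𝓡 n) x₀ x₀), χ y = 1) ∧ 0 ≤ A ∧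
      ∀ φ : Form n M k, IsSmoothForm φ →
        ∫ y, ∑ i, ∑ J, fderiv ℝ (coeff b (fun z => χ z • chartRep x₀ φ z) J) y (b i) ^ 2 ≤
          A * sobSq φ := by
  intro k
  set y₀ := extChartAt (𝓡 n) x₀ x₀ with hy₀
  have hy₀t : y₀ ∈ (extChartAt (𝓡 n) x₀).target := mem_extChartAt_target x₀
  obtain ⟨b, hb⟩ := exists_basis_metricMatrix_eq_one hy₀t
  set c₀ := volDensity x₀ y₀
  have hc₀ : 0 < c₀ := volDensity_pos x₀ hy₀t
  -- The last factor counts the positions `r` in `frozen_coefficients`, where the degree is written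
  -- `m + 1`. The formula for `η` is the one required by `gradient_bound_arith`.
  set N : ℝ := Fintype.card (Fin k → Fin n) * Fintype.card (Fin k → Fin n) * k with hN
  have hN0 : 0 ≤ N := by positivity
  set η := c₀ / (8 * (N + 1)) with hη
  have hη0 : 0 < η := by positivity
  -- Continuity of the finitely many coefficients fixes the radius of the ball on which freezing
  -- them is permitted.
  have hnear : ∀ᶠ y in 𝓝 y₀, y ∈ (extChartAt (𝓡 n) x₀).target ∧ ∀ I J : Fin k → Fin n,
      |pairCoeff x₀ b I J y - if I = J then c₀ else 0| ≤ η := by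
    refine (eventually_mem_set.2 ((isOpen_target x₀).mem_nhds hy₀t)).and (eventually_all.2 fun I => eventually_all.2
      fun J => ?_)
    have hc : ContinuousAt (pairCoeff x₀ b I J) y₀ :=
      (contDiffOn_pairCoeff x₀ b I J).continuousOn.continuousAt ((isOpen_target x₀).mem_nhds hy₀t)
    have := hc.eventually (Metric.ball_mem_nhds _ hη0)
    rw [pairCoeff_of_metricMatrix_eq_one hb] at this
    filter_upwards [this] with y hy
    rw [Real.dist_eq] at hy
    exact hy.le
  obtain ⟨r, hr, hball⟩ := Metric.nhds_basis_closedBall.eventually_iff.1 hnear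
  set f : ContDiffBump y₀ := ⟨r / 2, r, by positivity, by linarith⟩
  set K := Metric.closedBall y₀ r
  have hK : IsCompact K := isCompact_closedBall _ _
  have hKt : K ⊆ (extChartAt (𝓡 n) x₀).target := fun y hy => (hball hy).1
  have hχ : ContDiff ℝ ∞ f := f.contDiff
  have hχ0 : ∀ y ∉ K, f y = 0 := fun y hy => f.zero_of_le_dist (by
    rw [Metric.mem_closedBall, not_le] at hy; exact hy.le)
  have hχ1 : ∀ y, |f y| ≤ 1 := fun y => by rw [abs_of_nonneg f.nonneg]; exact f.le_one
  have hχe : ∀ᶠ y in 𝓝 y₀, f y = 1 := f.eventuallyEq_one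
  obtain ⟨A₁, hA₁, hb₁⟩ := exists_integral_sq_extDeriv_le (M := M) b hK hKt hχ hχ0 hχ1 k
  obtain ⟨A₂, hA₂, hb₂⟩ := exists_integral_sq_coeff_le (M := M) b hK hKt hχ hχ0 hχ1 k
  cases k with
  | zero =>
    refine ⟨b, K, f, A₁, hK, hKt, hχ, hχ0, hχ1, hχe, hA₁, fun φ hφ => ?_⟩
    have hU := contDiff_cutoff hφ hK hKt hχ hχ0
    refine (integral_congr_ae (Eventually.of_forall fun y =>
      sum_sq_fderiv_zeroForm ((hU.differentiable (by simp)) y))).le.trans ((hb₁ φ hφ).trans ?_)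
    refine mul_le_mul_of_nonneg_left ?_ hA₁
    rw [sobSq]
    linarith [integral_formInner_self_nonneg (coD φ)]
  | succ m =>
    set τ := c₀ / (4 * (N + 1)) with hτ
    have hτ0 : 0 < τ := by positivity
    obtain ⟨A₃, hA₃, hb₃⟩ := exists_neg_integral_le (M := M) b hK hKt hχ hχ1 hτ0 m
    obtain ⟨A, hA, hbA⟩ := exists_bound_family hK
      (f := fun (p : ((Fin (m + 1) → Fin n) × (Fin (m + 1) → Fin n)) × Fin n) y =>
        fderiv ℝ (pairCoeff x₀ b p.1.1 p.1.2) y (b p.2)) fun p =>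
      ((((contDiffOn_pairCoeff x₀ b p.1.1 p.1.2).continuousOn_fderiv_of_isOpen
        (isOpen_target x₀) (by simp)).clm_apply continuousOn_const).mono hKt)
    refine ⟨b, K, f, 3 / 2 * A₁ + 2 / c₀ * (A₃ + N * (A ^ 2 / (4 * τ) * A₂)), hK, hKt, hχ, hχ0,
      hχ1, hχe, by positivity, fun φ hφ => ?_⟩
    have hU := contDiff_cutoff hφ hK hKt hχ hχ0
    have h0 : ∀ y ∉ K, f y • chartRep x₀ φ y = 0 := fun y hy => by rw [hχ0 y hy, zero_smul]
    have key := integral_sq_fderiv_le (μ := volume) (b := b) (a := pairCoeff x₀ b) hK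
      (isOpen_target x₀) hKt hU h0
      (fun I J => (contDiffOn_pairCoeff x₀ b I J).of_le (one_le_two.trans ENat.LEInfty.out))
      (fun y hy => (hball hy).2) (fun y hy I J i => hbA y hy ((I, J), i)) hc₀
      (by rw [hN]; push_cast; rfl) hτ hη (hb₃ φ hφ _ (contDiff_flatDiv hU)
        (flatDiv_zero_off hK.isClosed h0))
    have hΦ := integral_formInner_self_nonneg φ
    have hd := integral_formInner_self_nonneg (extD φ)
    have hc := integral_formInner_self_nonneg (adjD φ)
    have hsob : sobSq φ = ∫ p, formInner (φ p) (φ p) ∂(riemVol n M) +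
      (∫ p, formInner (extD φ p) (extD φ p) ∂(riemVol n M) +
      ∫ p, formInner (adjD φ p) (adjD φ p) ∂(riemVol n M)) := rfl
    rw [hsob]
    set a1 := ∫ p, formInner (φ p) (φ p) ∂(riemVol n M)
    set a2 := ∫ p, formInner (extD φ p) (extD φ p) ∂(riemVol n M)
    set a3 := ∫ p, formInner (adjD φ p) (adjD φ p) ∂(riemVol n M)
    refine key.trans ?_
    have e1 : 3 / 2 * ∫ y, ∑ I, coeff b (extDeriv fun z => f z • chartRep x₀ φ z) I y ^ 2 ≤
        3 / 2 * (A₁ * (a1 + (a2 + a3))) := by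
      refine mul_le_mul_of_nonneg_left ((hb₁ φ hφ).trans ?_) (by norm_num)
      exact mul_le_mul_of_nonneg_left (by linarith) hA₁
    have e2 : 2 / c₀ * (A₃ * (a1 + a3) + N * (A ^ 2 / (4 * τ) *
        ∫ y, ∑ J, coeff b (fun z => f z • chartRep x₀ φ z) J y ^ 2)) ≤
        2 / c₀ * (A₃ * (a1 + (a2 + a3)) + N * (A ^ 2 / (4 * τ) * (A₂ * (a1 + (a2 + a3))))) := by
      gcongr
      · linarith
      · exact (hb₂ φ hφ).trans (mul_le_mul_of_nonneg_left (by linarith) hA₂)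
    refine (add_le_add e1 e2).trans (le_of_eq ?_)
    ring
end GradientBound
end KreinFeller

namespace KreinFeller

/-! ### Translation estimates and the Poincaré inequality on small sets. -/

section Translation
variable {E : Type*} [NormedAddCommGroup E] [NormedSpace ℝ E] [MeasurableSpace E] [BorelSpace E]
  [FiniteDimensional ℝ E] {μ : Measure E} [μ.IsAddHaarMeasure]

/-- The fundamental theorem of calculus along the segment from `x` to `x + h`, followed by
Cauchy–Schwarz on the unit interval. -/
theorem ofReal_sq_sub_le {v : E → ℝ} (hv : ContDiff ℝ 1 v) (x h : E) :
    ENNReal.ofReal ((v (x + h) - v x) ^ 2) ≤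
      ∫⁻ t in Ioc (0 : ℝ) 1, ENNReal.ofReal (fderiv ℝ v (x + t • h) h ^ 2) := by
  set g : ℝ → ℝ := fun t => fderiv ℝ v (x + t • h) h with hg
  have hgc : Continuous g := ((hv.continuous_fderiv one_ne_zero).comp
    (by fun_prop : Continuous fun t : ℝ => x + t • h)).clm_apply continuous_const
  have hd : ∀ t : ℝ, HasDerivAt (fun t : ℝ => v (x + t • h)) (g t) t := by
    intro t
    have h1 : HasDerivAt (fun t : ℝ => x + t • h) h t := by
      simpa using ((hasDerivAt_id t).smul_const h).const_add x
    exact ((hv.differentiable one_ne_zero) _).hasFDerivAt.comp_hasDerivAt t h1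
  have hint : v (x + h) - v x = ∫ t in (0 : ℝ)..1, g t := by
    rw [intervalIntegral.integral_eq_sub_of_hasDerivAt (fun t _ => hd t)
      (hgc.intervalIntegrable _ _)]
    simp
  set m := ∫ t in (0 : ℝ)..1, g t with hm
  -- Cauchy–Schwarz in the form that the variance of `g` on an interval of length one is
  -- nonnegative.
  have hcs : m ^ 2 ≤ ∫ t in (0 : ℝ)..1, g t ^ 2 := by
    have h0 : 0 ≤ ∫ t in (0 : ℝ)..1, (g t - m) ^ 2 :=
      intervalIntegral.integral_nonneg zero_le_one fun t _ => sq_nonneg _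
    have h1 : ∀ t, (g t - m) ^ 2 = g t ^ 2 - 2 * m * g t + m ^ 2 := fun t => by ring
    simp only [h1] at h0
    have i1 : Continuous fun t => g t ^ 2 - 2 * m * g t := by fun_prop
    have i2 : Continuous fun t => g t ^ 2 := by fun_prop
    rw [intervalIntegral.integral_add (i1.intervalIntegrable _ _)
      (continuous_const.intervalIntegrable _ _), intervalIntegral.integral_sub
      (i2.intervalIntegrable _ _) ((hgc.const_mul _).intervalIntegrable _ _),
      intervalIntegral.integral_const_mul, intervalIntegral.integral_const] at h0
    simp only [sub_zero, one_smul] at h0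
    rw [← hm] at h0
    linarith
  rw [hint]
  refine (ENNReal.ofReal_le_ofReal hcs).trans ?_
  rw [intervalIntegral.integral_of_le zero_le_one, ofReal_integral_eq_lintegral_ofReal]
  · exact ((hgc.pow 2).integrableOn_Icc (a := 0) (b := 1)).mono_set Ioc_subset_Icc_self
  · exact Eventually.of_forall fun t => sq_nonneg _

/-- Translations move a function in `L²` by at most the directional derivative. -/
theorem lintegral_sq_sub_le {v : E → ℝ} (hv : ContDiff ℝ 1 v) (h : E) :
    ∫⁻ x, ENNReal.ofReal ((v (x + h) - v x) ^ 2) ∂μ ≤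
      ∫⁻ x, ENNReal.ofReal (fderiv ℝ v x h ^ 2) ∂μ := by
  refine (lintegral_mono fun x => ofReal_sq_sub_le hv x h).trans ?_
  have hc : Continuous fun p : E × ℝ => fderiv ℝ v (p.1 + p.2 • h) h :=
    ((hv.continuous_fderiv one_ne_zero).comp (by fun_prop)).clm_apply continuous_const
  -- After Tonelli's theorem the inner integral does not depend on `t`, by translation invariance.
  rw [lintegral_lintegral_swap]
  · have : ∀ t : ℝ, ∫⁻ x, ENNReal.ofReal (fderiv ℝ v (x + t • h) h ^ 2) ∂μ =
        ∫⁻ x, ENNReal.ofReal (fderiv ℝ v x h ^ 2) ∂μ := fun t =>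
      lintegral_add_right_eq_self (fun x => ENNReal.ofReal (fderiv ℝ v x h ^ 2)) (t • h)
    simp only [this]
    simp
  · exact ((hc.pow 2).measurable.ennreal_ofReal).aemeasurable

/-- The variance of a function on a set of finite measure as a double integral. -/
theorem lintegral_lintegral_sq_sub {X : Type*} [MeasurableSpace X] {ν : Measure X}
    [IsFiniteMeasure ν] {v : X → ℝ} (hv : Integrable v ν) (hv2 : Integrable (fun x => v x ^ 2) ν) :
    ∫⁻ x, ∫⁻ y, ENNReal.ofReal ((v y - v x) ^ 2) ∂ν ∂ν =
        ENNReal.ofReal (2 * (ν.real univ * ∫ x, v x ^ 2 ∂ν - (∫ x, v x ∂ν) ^ 2)) ∧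
      0 ≤ ν.real univ * ∫ x, v x ^ 2 ∂ν - (∫ x, v x ∂ν) ^ 2 := by
  set S := ∫ x, v x ^ 2 ∂ν with hS
  set I := ∫ x, v x ∂ν with hI
  set c := ν.real univ with hc
  have e : ∀ x y, (v y - v x) ^ 2 = v y ^ 2 - 2 * v x * v y + v x ^ 2 := fun x y => by ring
  have h1 : ∀ x, Integrable (fun y => (v y - v x) ^ 2) ν := fun x => by
    simp only [e]
    exact (hv2.sub (hv.const_mul _)).add (integrable_const _)
  have h2 : ∀ x, ∫ y, (v y - v x) ^ 2 ∂ν = S - 2 * I * v x + c * v x ^ 2 := fun x => by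
    simp only [e]
    have i1 : Integrable (fun y => v y ^ 2 - 2 * v x * v y) ν := hv2.sub (hv.const_mul _)
    rw [integral_add i1 (integrable_const _),
      integral_sub hv2 (hv.const_mul _), integral_const_mul, integral_const, smul_eq_mul]
    ring
  have h3 : Integrable (fun x => S - 2 * I * v x + c * v x ^ 2) ν :=
    ((integrable_const _).sub (hv.const_mul _)).add (hv2.const_mul _)
  have h4 : ∫ x, (S - 2 * I * v x + c * v x ^ 2) ∂ν = 2 * (c * S - I ^ 2) := by
    have i1 : Integrable (fun x => S - 2 * I * v x) ν := (integrable_const _).sub (hv.const_mul _)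
    rw [integral_add i1 (hv2.const_mul _),
      integral_sub (integrable_const _) (hv.const_mul _), integral_const_mul, integral_const_mul,
      integral_const, smul_eq_mul]
    ring
  have h5 : ∀ x, 0 ≤ S - 2 * I * v x + c * v x ^ 2 := fun x => by
    rw [← h2]; exact integral_nonneg fun y => sq_nonneg _
  constructor
  · rw [← h4, ofReal_integral_eq_lintegral_ofReal h3 (Eventually.of_forall h5)]
    refine lintegral_congr fun x => ?_
    rw [← h2, ofReal_integral_eq_lintegral_ofReal (h1 x) (Eventually.of_forall fun y => sq_nonneg _)]
  · have : 0 ≤ 2 * (c * S - I ^ 2) := h4 ▸ integral_nonneg h5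
    linarith

/-- Poincaré inequality on a disjoint family of sets of equal measure. -/
theorem sum_variance_le {κ : Type*} {s : Finset κ} {Q : κ → Set E} {W : Set E} {ρ : ℝ} {v : E → ℝ}
    (hQ : ∀ z, MeasurableSet (Q z)) (hdisj : Pairwise (Function.onFun Disjoint Q))
    (hW : MeasurableSet W) (hQW : ∀ z, ∀ x ∈ Q z, ∀ y ∈ Q z, y - x ∈ W)
    (hWρ : ∀ h ∈ W, ‖h‖ ≤ ρ) (hv : ContDiff ℝ 1 v) :
    ∑ z ∈ s, ∫⁻ x in Q z, ∫⁻ y in Q z, ENNReal.ofReal ((v y - v x) ^ 2) ∂μ ∂μ ≤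
      μ W * ∫⁻ x, ENNReal.ofReal (ρ ^ 2 * ‖fderiv ℝ v x‖ ^ 2) ∂μ := by
  have hm : Measurable fun p : E × E => ENNReal.ofReal ((v (p.1 + p.2) - v p.1) ^ 2) := by
    have := hv.continuous
    exact (Continuous.measurable (by fun_prop)).ennreal_ofReal
  calc _ ≤ ∑ z ∈ s, ∫⁻ x in Q z, ∫⁻ h in W, ENNReal.ofReal ((v (x + h) - v x) ^ 2) ∂μ ∂μ := by
        refine Finset.sum_le_sum fun z _ => setLIntegral_mono' (hQ z) fun x hx => ?_
        -- Substitute `y = x + h`; the differences of two points of `Q z` lie in `W`, so the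
        -- integral over `h` may be enlarged to `W`.
        rw [← lintegral_indicator (hQ z), ← lintegral_indicator hW,
          ← lintegral_add_left_eq_self _ x]
        refine lintegral_mono fun h => ?_
        by_cases hh : x + h ∈ Q z
        · have : h ∈ W := by simpa using hQW z x hx _ hh
          rw [indicator_of_mem hh, indicator_of_mem this]
        · rw [indicator_of_notMem hh]; exact zero_le
    _ ≤ ∫⁻ x, ∫⁻ h in W, ENNReal.ofReal ((v (x + h) - v x) ^ 2) ∂μ ∂μ := by
        -- Disjointness keeps the constant independent of the number of sets.
        rw [← lintegral_biUnion_finset (fun a _ c _ hac => hdisj hac) fun z _ => hQ z]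
        exact setLIntegral_le_lintegral _ _
    _ = ∫⁻ h in W, ∫⁻ x, ENNReal.ofReal ((v (x + h) - v x) ^ 2) ∂μ ∂μ :=
        lintegral_lintegral_swap hm.aemeasurable
    _ ≤ ∫⁻ _ in W, ∫⁻ x, ENNReal.ofReal (ρ ^ 2 * ‖fderiv ℝ v x‖ ^ 2) ∂μ ∂μ := by
        refine setLIntegral_mono' hW fun h hh => (lintegral_sq_sub_le hv h).trans ?_
        refine lintegral_mono fun x => ENNReal.ofReal_le_ofReal ?_
        rw [← sq_abs, ← mul_pow]
        refine pow_le_pow_left₀ (abs_nonneg _) ?_ 2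
        refine ((fderiv ℝ v x).le_opNorm h).trans ?_
        rw [mul_comm]
        gcongr
        exact hWρ h hh
    _ = _ := by rw [setLIntegral_const, mul_comm]
end Translation

/-! ### Cubes and the quantitative Rellich theorem. -/

section Cubes
variable {n : ℕ}

/-- The half-open cubes of side `δ`. -/
def cube (δ : ℝ) (z : Fin n → ℤ) : Set (EuclideanSpace ℝ (Fin n)) := {x | ∀ i, ⌊x i / δ⌋ = z i}

theorem measurableSet_cube (δ : ℝ) (z : Fin n → ℤ) : MeasurableSet (cube δ z) := by
  have : cube δ z = ⋂ i, (fun x : EuclideanSpace ℝ (Fin n) => ⌊x i / δ⌋) ⁻¹' {z i} := by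
    ext x; simp [cube]
  rw [this]
  refine MeasurableSet.iInter fun i => ?_
  have hc : Continuous fun x : EuclideanSpace ℝ (Fin n) => x i / δ := by fun_prop
  exact (Int.measurable_floor.comp hc.measurable) (measurableSet_singleton _)

theorem volume_cube {δ : ℝ} (hδ : 0 < δ) (z : Fin n → ℤ) :
    volume (cube δ z) = ENNReal.ofReal (δ ^ n) := by
  have : cube δ z = WithLp.ofLp ⁻¹' (univ.pi fun i => Ico (δ * z i) (δ * z i + δ)) := by
    ext x
    simp only [cube, mem_ofPred_eq, mem_preimage, mem_univ_pi, mem_Ico]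
    refine forall_congr' fun i => ?_
    rw [Int.floor_eq_iff, le_div_iff₀ hδ, div_lt_iff₀ hδ]
    constructor <;> rintro ⟨h1, h2⟩ <;> constructor <;> nlinarith
  rw [this, (PiLp.volume_preserving_ofLp (Fin n)).measure_preimage
    (MeasurableSet.univ_pi fun i => measurableSet_Ico).nullMeasurableSet, Real.volume_pi_Ico]
  simp [ENNReal.ofReal_pow hδ.le]

/-- The open cube of vectors with coordinates of absolute value less than `δ`. -/
def cubeDiff (n : ℕ) (δ : ℝ) : Set (EuclideanSpace ℝ (Fin n)) := {h | ∀ i, |h i| < δ}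

theorem cubeDiff_eq (δ : ℝ) :
    cubeDiff n δ = WithLp.ofLp ⁻¹' (univ.pi fun _ => Ioo (-δ) δ) := by
  ext x; simp [cubeDiff, abs_lt]

theorem measurableSet_cubeDiff (δ : ℝ) : MeasurableSet (cubeDiff n δ) := by
  rw [cubeDiff_eq]
  exact (PiLp.volume_preserving_ofLp (Fin n)).measurable
    (MeasurableSet.univ_pi fun i => measurableSet_Ioo)

theorem volume_cubeDiff {δ : ℝ} (hδ : 0 < δ) :
    volume (cubeDiff n δ) = ENNReal.ofReal (2 ^ n * δ ^ n) := by
  rw [cubeDiff_eq, (PiLp.volume_preserving_ofLp (Fin n)).measure_preimage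
    (MeasurableSet.univ_pi fun i => measurableSet_Ioo).nullMeasurableSet, Real.volume_pi_Ioo]
  simp only [Finset.prod_const, Finset.card_univ, Fintype.card_fin]
  rw [← ENNReal.ofReal_pow (by linarith), ← mul_pow]
  congr 2; ring

theorem sub_mem_cubeDiff {δ : ℝ} (hδ : 0 < δ) {z : Fin n → ℤ} {x y : EuclideanSpace ℝ (Fin n)}
    (hx : x ∈ cube δ z) (hy : y ∈ cube δ z) : y - x ∈ cubeDiff n δ := by
  intro i
  have h1 := Int.abs_sub_lt_one_of_floor_eq_floor ((hy i).trans (hx i).symm)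
  rw [← sub_div, abs_div, abs_of_pos hδ, div_lt_one hδ] at h1
  exact h1

theorem norm_le_of_mem_cubeDiff {δ : ℝ} (hδ : 0 < δ) {h : EuclideanSpace ℝ (Fin n)}
    (hh : h ∈ cubeDiff n δ) : ‖h‖ ≤ √n * δ := by
  rw [EuclideanSpace.norm_eq]
  refine Real.sqrt_le_iff.2 ⟨by positivity, ?_⟩
  rw [mul_pow, Real.sq_sqrt (Nat.cast_nonneg n)]
  refine (Finset.sum_le_card_nsmul _ _ (δ ^ 2) fun i _ => ?_).trans (by simp)
  rw [Real.norm_eq_abs]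
  exact pow_le_pow_left₀ (abs_nonneg _) (hh i).le 2

/-- **Rellich's theorem** in quantitative form: up to a small multiple of the Dirichlet integral, the
`L²`-norm is controlled by finitely many averages. -/
theorem exists_finite_averages {K : Set (EuclideanSpace ℝ (Fin n))} (hK : IsCompact K) {ε : ℝ}
    (hε : 0 < ε) : ∃ (δ : ℝ) (s : Finset (Fin n → ℤ)) (c : ℝ), 0 < δ ∧ 0 ≤ c ∧
      ∀ v : EuclideanSpace ℝ (Fin n) → ℝ, ContDiff ℝ 1 v → (∀ y ∉ K, v y = 0) →
        ∫ y, v y ^ 2 ≤ ε * (∫ y, ‖fderiv ℝ v y‖ ^ 2) + c * ∑ z ∈ s, (∫ y in cube δ z, v y) ^ 2 := by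
  -- On the left is the volume of the difference cube over that of a cube, times the squared bound
  -- on its vectors; the factor 2 on the right is the one in `lintegral_lintegral_sq_sub`.
  obtain ⟨δ, hδ, hδε⟩ : ∃ δ : ℝ, 0 < δ ∧ 2 ^ n * (√n * δ) ^ 2 ≤ 2 * ε := by
    refine ⟨√(2 * ε / (2 ^ n * (n + 1))), by positivity, ?_⟩
    rw [mul_pow, Real.sq_sqrt (Nat.cast_nonneg n), Real.sq_sqrt (by positivity)]
    have : (2 : ℝ) ^ n * (n * (2 * ε / (2 ^ n * (n + 1)))) = 2 * ε * (n / (n + 1)) := by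
      field_simp
    rw [this]
    refine mul_le_of_le_one_right (by positivity) ?_
    rw [div_le_one (by positivity)]; linarith
  obtain ⟨R, hR⟩ := hK.isBounded.exists_norm_le
  refine ⟨δ, Fintype.piFinset fun _ => Finset.Icc ⌊-R / δ⌋ ⌊R / δ⌋, (δ ^ n)⁻¹, hδ, by positivity,
    fun v hv hv0 => ?_⟩
  set s := Fintype.piFinset fun _ : Fin n => Finset.Icc ⌊-R / δ⌋ ⌊R / δ⌋ with hs
  -- Compactness of `K` enters here: only finitely many cubes are needed to cover a bounded set.
  have hKs : K ⊆ ⋃ z ∈ s, cube δ z := by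
    intro x hx
    refine mem_biUnion (x := fun i => ⌊x i / δ⌋) ?_ fun i => rfl
    simp only [hs, Finset.mem_coe, Fintype.mem_piFinset, Finset.mem_Icc]
    intro i
    have h1 : |x i| ≤ R := ((EuclideanSpace.norm_eq x ▸ Real.abs_le_sqrt (by
      have := Finset.single_le_sum (f := fun i => ‖x i‖ ^ 2) (fun _ _ => sq_nonneg _)
        (Finset.mem_univ i)
      simpa using this)) : |x i| ≤ ‖x‖).trans (hR x hx)
    have h2 := abs_le.1 h1
    exact ⟨Int.floor_le_floor (by gcongr; exact h2.1), Int.floor_le_floor (by gcongr; exact h2.2)⟩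
  have hdisj : Pairwise (Function.onFun Disjoint (cube (n := n) δ)) := fun z w hzw =>
    disjoint_left.2 fun x hx hy => hzw (funext fun i => (hx i).symm.trans (hy i))
  have hvi : Integrable v := integrable_of_zero_off hK hv.continuous hv0
  have hvi2 : Integrable fun y => v y ^ 2 :=
    integrable_of_zero_off hK (hv.continuous.pow 2) fun y hy => by simp [hv0 y hy]
  have hDi : Integrable fun y => ‖fderiv ℝ v y‖ ^ 2 :=
    integrable_of_zero_off hK ((hv.continuous_fderiv one_ne_zero).norm.pow 2) fun y hy => by
      simp [fderiv_zero_off hK.isClosed hv0 y hy]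
  have hsum : ∫ y, v y ^ 2 = ∑ z ∈ s, ∫ y in cube δ z, v y ^ 2 := by
    rw [← integral_biUnion_finset s (fun z _ => measurableSet_cube δ z)
      (fun a _ c _ hac => hdisj hac) fun z _ => hvi2.integrableOn]
    refine (setIntegral_eq_integral_of_forall_compl_eq_zero fun y hy => ?_).symm
    simp [hv0 y fun h => hy (hKs h)]
  have hfin : ∀ z : Fin n → ℤ, IsFiniteMeasure (volume.restrict (cube δ z)) := fun z =>
    ⟨by rw [Measure.restrict_apply_univ, volume_cube hδ]; exact ENNReal.ofReal_lt_top⟩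
  have hreal : ∀ z : Fin n → ℤ, (volume.restrict (cube δ z)).real univ = δ ^ n := fun z => by
    rw [measureReal_def, Measure.restrict_apply_univ, volume_cube hδ,
      ENNReal.toReal_ofReal (by positivity)]
  have hvar := fun z : Fin n → ℤ => lintegral_lintegral_sq_sub (hvi.integrableOn (s := cube δ z))
    (hvi2.integrableOn (s := cube δ z))
  have key := sum_variance_le (μ := volume) (s := s) (measurableSet_cube δ) hdisj
    (measurableSet_cubeDiff δ) (fun z x hx y hy => sub_mem_cubeDiff hδ hx hy)
    (fun h hh => norm_le_of_mem_cubeDiff hδ hh) hv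
  simp only [hreal] at hvar
  rw [Finset.sum_congr rfl fun z _ => (hvar z).1, ← ENNReal.ofReal_sum_of_nonneg
    fun z _ => mul_nonneg zero_le_two (hvar z).2, volume_cubeDiff hδ,
    ← ofReal_integral_eq_lintegral_ofReal (hDi.const_mul _)
      (Eventually.of_forall fun x => by positivity), ← ENNReal.ofReal_mul (by positivity),
    ENNReal.ofReal_le_ofReal_iff (mul_nonneg (by positivity)
      (integral_nonneg fun x => by positivity)), integral_const_mul, ← Finset.mul_sum,
    Finset.sum_sub_distrib, ← Finset.mul_sum, ← hsum] at key
  set D := ∫ y, ‖fderiv ℝ v y‖ ^ 2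
  have hD : 0 ≤ D := integral_nonneg fun x => by positivity
  set V := ∫ y, v y ^ 2
  set T := ∑ z ∈ s, (∫ y in cube δ z, v y) ^ 2
  have hδn : 0 < δ ^ n := by positivity
  have h1 : δ ^ n * (2 ^ n * (√n * δ) ^ 2 * D) ≤ δ ^ n * (2 * ε * D) := by gcongr
  -- The sum of the variances is `δⁿ V - T`, up to the common factor 2, so dividing by `δⁿ` explains
  -- the constant `(δⁿ)⁻¹` in front of the averages.
  have h2 : δ ^ n * V ≤ δ ^ n * (ε * D) + T := by linarith
  refine le_of_mul_le_mul_left ?_ hδn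
  rw [mul_add, ← mul_assoc (δ ^ n) (δ ^ n)⁻¹, mul_inv_cancel₀ hδn.ne', one_mul]
  exact h2
end Cubes
end KreinFeller

namespace KreinFeller

/-! ### Rellich's theorem for test forms, by localization. -/

section Functionals
variable {n : ℕ} {M : Type*} [TopologicalSpace M] [ChartedSpace (EuclideanSpace ℝ (Fin n)) M]
  [IsManifold (𝓡 n) ∞ M] {k : ℕ}
  [RiemannianBundle (fun x : M => TangentSpace (𝓡 n) x)]
  [IsContMDiffRiemannianBundle (𝓡 n) ∞ (EuclideanSpace ℝ (Fin n))
    (fun x : M => TangentSpace (𝓡 n) x)]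
  [T2Space M] [CompactSpace M] [MeasurableSpace M] [BorelSpace M] {Ω : Set M}
  {x₀ : M} {K : Set (EuclideanSpace ℝ (Fin n))} {χ : EuclideanSpace ℝ (Fin n) → ℝ}

theorem measurableSet_chartDom_inter_preimage (x₀ : M) {Q : Set (EuclideanSpace ℝ (Fin n))}
    (hQ : MeasurableSet Q) : MeasurableSet (chartDom n x₀ ∩ extChartAt (𝓡 n) x₀ ⁻¹' Q) := by
  have hc : ContinuousOn (extChartAt (𝓡 n) x₀) (chartDom n x₀) := by
    have := continuousOn_extChartAt (I := 𝓡 n) x₀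
    rwa [extChartAt_source] at this
  have h : Measurable ((chartDom n x₀).domRestrict (extChartAt (𝓡 n) x₀)) :=
    (continuousOn_iff_continuous_domRestrict.1 hc).measurable
  have := (isOpen_chartDom x₀).measurableSet.subtype_image (h hQ)
  convert this using 1
  ext y
  simp [and_comm]

theorem indicator_mem_sqIntegrable {ν : Measure M} {θ : Form n M k} (h : θ ∈ sqIntegrable n ν k)
    {S : Set M} [DecidablePred (· ∈ S)] (hS : MeasurableSet S) :
    (fun p => if p ∈ S then θ p else 0 : Form n M k) ∈ sqIntegrable n ν k := by
  refine ⟨fun x₁ => ?_, ?_⟩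
  · refine ((h.1 x₁).indicator hS).congr ?_
    filter_upwards [ae_restrict_mem (isOpen_chartDom (n := n) x₁).measurableSet] with p hp
    rw [chartRep_ext hp]
    by_cases hpS : p ∈ S
    · rw [indicator_of_mem hpS, if_pos hpS, chartRep_ext hp]
    · rw [indicator_of_notMem hpS, if_neg hpS]; rfl
  · refine (h.2.indicator hS).congr (Eventually.of_forall fun p => ?_)
    by_cases hpS : p ∈ S
    · simp only [indicator_of_mem hpS, if_pos hpS]
    · simp only [indicator_of_notMem hpS, if_neg hpS, formInner_zero_left]

/-- Averages of the coefficients of a form in a chart are bounded functionals on `L²`. -/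
theorem exists_chart_functional (hK : IsCompact K) (hKt : K ⊆ (extChartAt (𝓡 n) x₀).target)
    (hχ : ContDiff ℝ ∞ χ) (hχ0 : ∀ y ∉ K, χ y = 0) (v : Fin k → EuclideanSpace ℝ (Fin n))
    {Q : Set (EuclideanSpace ℝ (Fin n))} (hQ : MeasurableSet Q) :
    ∃ ℓ : L2Form n ((riemVol n M).restrict Ω) k →L[ℝ] ℝ, ∀ φ ∈ testForms n Ω k, ∀ a,
      IsClassOf φ a → ℓ a = ∫ y in Q, χ y * chartRep x₀ φ y v := by
  classical
  -- Dividing by the density converts the Riemannian pairing with `framePair` into a Lebesgue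
  -- integral in the chart.
  set ρ : M → ℝ := (chartDom n x₀).indicator fun p =>
    χ (extChartAt (𝓡 n) x₀ p) / volDensity x₀ (extChartAt (𝓡 n) x₀ p) with hρ
  have hρs : ContMDiffOn (𝓡 n) 𝓘(ℝ, ℝ) ∞ ρ (chartDom n x₀) := by
    have h1 : ContDiffOn ℝ ∞ (fun y => χ y / volDensity x₀ y) (extChartAt (𝓡 n) x₀).target :=
      hχ.contDiffOn.div (contDiffOn_volDensity x₀) fun y hy => (volDensity_pos x₀ hy).ne'
    refine ((contMDiffOn_iff_contDiffOn.2 h1).comp (contMDiffOn_extChartAt (I := 𝓡 n) (n := ∞)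
      (x := x₀)) fun p hp => ext_mem_target hp).congr fun p hp => ?_
    rw [hρ, indicator_of_mem hp]; rfl
  have hsub : tsupport ρ ⊆ chartDom n x₀ := by
    have h1 : tsupport ρ ⊆ (extChartAt (𝓡 n) x₀).symm '' K := by
      refine closure_minimal (fun p hp => ?_) (isCompact_image_symm hK hKt).isClosed
      have hpd : p ∈ chartDom n x₀ := by
        by_contra h; exact hp (indicator_of_notMem h _)
      refine ⟨_, by_contra fun h => hp ?_, ext_left_inv hpd⟩
      rw [hρ, indicator_of_mem hpd, hχ0 _ h, zero_div]
    refine h1.trans ?_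
    rintro p ⟨z, hz, rfl⟩
    exact symm_mem_chartDom (hKt hz)
  have hζ : IsSmoothForm (framePair x₀ ρ v) := isSmoothForm_framePair hρs hsub v
  set S := chartDom n x₀ ∩ extChartAt (𝓡 n) x₀ ⁻¹' Q with hS
  have hSm : MeasurableSet S := measurableSet_chartDom_inter_preimage x₀ hQ
  -- The representing form is cut off sharply to the points over `Q`; only square integrability is
  -- needed, not smoothness.
  set ξ : Form n M k := fun p => if p ∈ S then framePair x₀ ρ v p else 0 with hξ
  have hξΩ : ξ ∈ sqIntegrable n ((riemVol n M).restrict Ω) k :=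
    indicator_mem_sqIntegrable hζ.mem_sqIntegrable hSm
  have hξM : ξ ∈ sqIntegrable n (riemVol n M) k :=
    indicator_mem_sqIntegrable hζ.mem_sqIntegrable hSm
  refine ⟨innerSL ℝ (toL2 ξ hξΩ), fun φ hφ a ha => ?_⟩
  rw [innerSL_apply_apply, (isClassOf_toL2 hξΩ).inner_eq ha]
  simp only [formInner_comm (ξ _)]
  rw [setIntegral_testForms hφ]
  have hm := (integrable_formInner (hφ.1.mem_sqIntegrable (ν := riemVol n M)) hξM).1
  have h0 : ∀ p ∉ chartDom n x₀, formInner (φ p) (ξ p) = 0 := fun p hp => by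
    have : ξ p = 0 := if_neg fun h => hp h.1
    rw [this, formInner_zero_right]
  rw [← setIntegral_eq_integral_of_forall_compl_eq_zero h0, integral_chartDom x₀ hm.restrict,
    ← integral_indicator hQ, ← setIntegral_eq_integral_of_forall_compl_eq_zero
      (s := (extChartAt (𝓡 n) x₀).target) (f := Q.indicator _)]
  · refine setIntegral_congr_fun (isOpen_target x₀).measurableSet fun y hy => ?_
    have hd := symm_mem_chartDom hy
    by_cases hyQ : y ∈ Q
    · have hyS : (extChartAt (𝓡 n) x₀).symm y ∈ S := ⟨hd, by
        rw [mem_preimage, ext_right_inv hy]; exact hyQ⟩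
      simp only [hξ, if_pos hyS, indicator_of_mem hyQ]
      rw [formInner_comm, formInner_framePair, hρ, indicator_of_mem hd, ext_right_inv hy,
        chartRep_of_mem_target hy]
      have hv := (volDensity_pos x₀ hy).ne'
      rw [div_mul_eq_mul_div, div_mul_cancel₀ _ hv]
      rfl
    · have hyS : (extChartAt (𝓡 n) x₀).symm y ∉ S := fun h => hyQ (by
        have := h.2
        rwa [mem_preimage, ext_right_inv hy] at this)
      simp only [hξ, if_neg hyS, indicator_of_notMem hyQ, formInner_zero_right, zero_mul]
  · intro y hy
    by_cases hyQ : y ∈ Q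
    · rw [indicator_of_mem hyQ, hχ0 y fun h => hy (hKt h), zero_mul]
    · exact indicator_of_notMem hyQ _

variable (n k Ω) in
/-- The `L²`-norm on `V` of test forms is controlled by finitely many bounded functionals, up to a
small multiple of the `W^{1,2}`-norm. -/
def IsCompactlyControlled (V : Set M) : Prop :=
  ∀ ε > (0 : ℝ), ∃ (κ : Type) (_ : Fintype κ)
    (ℓ : κ → L2Form n ((riemVol n M).restrict Ω) k →L[ℝ] ℝ), ∀ φ ∈ testForms n Ω k, ∀ a,
      IsClassOf φ a → ∫ p in V, formInner (φ p) (φ p) ∂(riemVol n M) ≤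
        ε * sobSq φ + ∑ i, ℓ i a ^ 2

theorem sobSq_nonneg (φ : Form n M k) : 0 ≤ sobSq φ :=
  add_nonneg (integral_formInner_self_nonneg _)
    (add_nonneg (integral_formInner_self_nonneg _) (integral_formInner_self_nonneg _))

theorem integrable_formInner_self {ν : Measure M} [IsFiniteMeasure ν] {φ : Form n M k}
    (hφ : IsSmoothForm φ) : Integrable (fun p => formInner (φ p) (φ p)) ν :=
  integrable_formInner hφ.mem_sqIntegrable hφ.mem_sqIntegrable

theorem IsCompactlyControlled.mono {V W : Set M} (h : IsCompactlyControlled n k Ω W) (hVW : V ⊆ W) :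
    IsCompactlyControlled n k Ω V := by
  intro ε hε
  obtain ⟨κ, _, ℓ, hℓ⟩ := h ε hε
  refine ⟨κ, inferInstance, ℓ, fun φ hφ a ha => le_trans ?_ (hℓ φ hφ a ha)⟩
  exact setIntegral_mono_set (integrable_formInner_self hφ.1).integrableOn
    (Eventually.of_forall fun p => formInner_self_nonneg _) hVW.eventuallyLE

theorem IsCompactlyControlled.union {V W : Set M} (hV : IsCompactlyControlled n k Ω V)
    (hW : IsCompactlyControlled n k Ω W) : IsCompactlyControlled n k Ω (V ∪ W) := by
  intro ε hε
  obtain ⟨κ, _, ℓ, hℓ⟩ := hV (ε / 2) (by positivity)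
  obtain ⟨κ', _, ℓ', hℓ'⟩ := hW (ε / 2) (by positivity)
  refine ⟨κ ⊕ κ', inferInstance, Sum.elim ℓ ℓ', fun φ hφ a ha => ?_⟩
  have hi : ∀ {ν : Measure M} [IsFiniteMeasure ν], Integrable (fun p => formInner (φ p) (φ p)) ν :=
    integrable_formInner_self hφ.1
  have h1 : ∫ p in V ∪ W, formInner (φ p) (φ p) ∂(riemVol n M) ≤
      ∫ p in V, formInner (φ p) (φ p) ∂(riemVol n M) +
        ∫ p in W, formInner (φ p) (φ p) ∂(riemVol n M) := by
    rw [← integral_add_measure hi hi]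
    exact integral_mono_measure (Measure.restrict_union_le _ _)
      (Eventually.of_forall fun p => formInner_self_nonneg _) (hi.add_measure hi)
  rw [Fintype.sum_sum_type]
  simp only [Sum.elim_inl, Sum.elim_inr]
  linarith [hℓ φ hφ a ha, hℓ' φ hφ a ha]

/-- Where the cutoff equals one, the norm of `φ` is controlled by the coefficients of the localized
form. These are scalar functions with support in a fixed compact set, so `exists_finite_averages`
bounds them by averages and a small multiple of their gradients, and `exists_gradient_bound` bounds
the gradients by `sobSq φ`. -/
theorem exists_isCompactlyControlled_nhds (x₀ : M) :
    ∃ V ∈ 𝓝 x₀, IsCompactlyControlled n k Ω V := by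
  obtain ⟨b, K, χ, A, hK, hKt, hχ, hχ0, hχ1, hχe, hA, hgrad⟩ :=
    exists_gradient_bound (n := n) x₀ k
  obtain ⟨W, hW1, hWo, hWy⟩ := eventually_nhds_iff.1 hχe
  obtain ⟨A', hA', hdens⟩ := exists_densSq_le (M := M) b hK hKt k
  obtain ⟨B, hB, hop⟩ := b.exists_opNorm_le (F := ℝ)
  have hc : ContinuousOn (extChartAt (𝓡 n) x₀) (chartDom n x₀) := by
    have := continuousOn_extChartAt (I := 𝓡 n) x₀
    rwa [extChartAt_source] at this
  set V := chartDom n x₀ ∩ extChartAt (𝓡 n) x₀ ⁻¹' W with hV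
  have hVo : IsOpen V := hc.isOpen_inter_preimage (isOpen_chartDom x₀) hWo
  refine ⟨V, hVo.mem_nhds ⟨mem_chart_source _ x₀, hWy⟩, fun ε hε => ?_⟩
  -- `A'`, `B²` and `A` are the losses from coefficients to form, from operator norm to basis
  -- derivatives, and in Gaffney's inequality; the summand 1 only avoids dividing by zero.
  set ε' := ε / (A' * (B ^ 2 * A) + 1) with hε'
  have hε'0 : 0 < ε' := by positivity
  obtain ⟨δ, s, c, hδ, hc0, hrel⟩ := exists_finite_averages hK hε'0
  choose ℓ hℓ using fun q : (Fin k → Fin n) × s => exists_chart_functional (Ω := Ω) hK hKt hχ hχ0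
    (fun r => b (q.1 r)) (measurableSet_cube δ (q.2 : Fin n → ℤ))
  -- The square root absorbs the constants into the functionals, whose squares are summed.
  refine ⟨(Fin k → Fin n) × s, inferInstance, fun q => √(A' * c) • ℓ q, fun φ hφ a ha => ?_⟩
  have hU := contDiff_cutoff hφ.1 hK hKt hχ hχ0
  set u := fun z => χ z • chartRep x₀ φ z with hu
  have h0 : ∀ y ∉ K, u y = 0 := fun y hy => by rw [hu]; simp only [hχ0 y hy, zero_smul]
  have hcu : ∀ J, ContDiff ℝ ∞ (coeff b u J) := contDiff_coeff hU
  have hzu : ∀ J, ∀ y ∉ K, coeff b u J y = 0 := coeff_zero_off h0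
  have hdc : ∀ J (v : EuclideanSpace ℝ (Fin n)), Continuous fun y => fderiv ℝ (coeff b u J) y v :=
    fun J v => ((hcu J).continuous_fderiv (by simp)).clm_apply continuous_const
  have hdi : ∀ i J, Integrable fun y => fderiv ℝ (coeff b u J) y (b i) ^ 2 := fun i J =>
    integrable_of_zero_off hK ((hdc J (b i)).pow 2) fun y hy => by
      simp [fderiv_zero_off hK.isClosed (hzu J) y hy]
  have hui : ∀ J, Integrable fun y => coeff b u J y ^ 2 := fun J =>
    integrable_of_zero_off hK ((hcu J).continuous.pow 2) fun y hy => by simp [hzu J y hy]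
  -- localization
  have hloc : ∫ p in V, formInner (φ p) (φ p) ∂(riemVol n M) ≤
      A' * ∫ y, ∑ J, coeff b u J y ^ 2 := by
    have := ChartedSpace.secondCountable_of_sigmaCompact (EuclideanSpace ℝ (Fin n)) M
    have hm : AEStronglyMeasurable (V.indicator fun p => formInner (φ p) (φ p)) (riemVol n M) :=
      (continuous_formInner hφ.1 hφ.1).aestronglyMeasurable.indicator hVo.measurableSet
    rw [← integral_indicator hVo.measurableSet, ← setIntegral_eq_integral_of_forall_compl_eq_zero
      (s := chartDom n x₀) fun p hp => indicator_of_notMem (fun h => hp h.1) _,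
      integral_chartDom x₀ hm.restrict, ← integral_const_mul]
    have hsi : Integrable fun y => A' * ∑ J, coeff b u J y ^ 2 :=
      (integrable_finsetSum _ fun J _ => hui J).const_mul _
    have hle : ∀ y ∈ (extChartAt (𝓡 n) x₀).target,
        V.indicator (fun p => formInner (φ p) (φ p)) ((extChartAt (𝓡 n) x₀).symm y) *
          volDensity x₀ y ≤ A' * ∑ J, coeff b u J y ^ 2 := by
      intro y hy
      by_cases hyW : y ∈ W
      · have hyV : (extChartAt (𝓡 n) x₀).symm y ∈ V := ⟨symm_mem_chartDom hy, by
          rw [mem_preimage, ext_right_inv hy]; exact hyW⟩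
        have hyK : y ∈ K := by
          by_contra h; exact one_ne_zero ((hW1 y hyW).symm.trans (hχ0 y h))
        rw [indicator_of_mem hyV]
        refine (hdens φ y hyK).trans (le_of_eq ?_)
        simp only [hu, coeff_smul, hW1 y hyW, one_mul]
      · have hyV : (extChartAt (𝓡 n) x₀).symm y ∉ V := fun h => hyW (by
          have := h.2
          rwa [mem_preimage, ext_right_inv hy] at this)
        rw [indicator_of_notMem hyV, zero_mul]
        exact mul_nonneg hA' (Finset.sum_nonneg fun _ _ => sq_nonneg _)
    refine (setIntegral_mono_on ?_ hsi.integrableOn (isOpen_target x₀).measurableSet hle).trans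
      (setIntegral_le_integral hsi (Eventually.of_forall fun y =>
        mul_nonneg hA' (Finset.sum_nonneg fun _ _ => sq_nonneg _)))
    exact (integrableOn_chartDom_iff x₀ hm.restrict).1
      ((integrable_formInner_self hφ.1).indicator hVo.measurableSet).integrableOn
  have hop' : ∀ J y, ‖fderiv ℝ (coeff b u J) y‖ ^ 2 ≤
      B ^ 2 * ∑ i, fderiv ℝ (coeff b u J) y (b i) ^ 2 := by
    intro J y
    have h1 := hop (u := fderiv ℝ (coeff b u J) y) (Real.sqrt_nonneg
      (∑ i, fderiv ℝ (coeff b u J) y (b i) ^ 2)) fun i => Real.abs_le_sqrt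
        (le_sum_sq (fun i => fderiv ℝ (coeff b u J) y (b i)) i)
    have h2 := pow_le_pow_left₀ (norm_nonneg _) h1 2
    rwa [mul_pow, Real.sq_sqrt (Finset.sum_nonneg fun _ _ => sq_nonneg _)] at h2
  have hgradJ : ∑ J, ∫ y, ‖fderiv ℝ (coeff b u J) y‖ ^ 2 ≤ B ^ 2 * (A * sobSq φ) := by
    have h1 : ∀ J, ∫ y, ‖fderiv ℝ (coeff b u J) y‖ ^ 2 ≤
        B ^ 2 * ∑ i, ∫ y, fderiv ℝ (coeff b u J) y (b i) ^ 2 := by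
      intro J
      rw [← integral_finsetSum _ fun i _ => hdi i J, ← integral_const_mul]
      refine integral_mono (integrable_of_zero_off hK
        (((hcu J).continuous_fderiv (by simp)).norm.pow 2) fun y hy => by
          simp [fderiv_zero_off hK.isClosed (hzu J) y hy])
        ((integrable_finsetSum _ fun i _ => hdi i J).const_mul _) (hop' J)
    refine (Finset.sum_le_sum fun J _ => h1 J).trans ?_
    rw [← Finset.mul_sum, Finset.sum_comm]
    refine mul_le_mul_of_nonneg_left (le_trans (le_of_eq ?_) (hgrad φ hφ.1)) (by positivity)
    rw [integral_finsetSum _ fun i _ => integrable_finsetSum _ fun J _ => hdi i J]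
    exact Finset.sum_congr rfl fun i _ => (integral_finsetSum _ fun J _ => hdi i J).symm
  have hJ : ∀ J, ∫ y, coeff b u J y ^ 2 ≤ (ε' * ∫ y, ‖fderiv ℝ (coeff b u J) y‖ ^ 2) +
      c * ∑ z : s, ℓ (J, z) a ^ 2 := by
    intro J
    have h1 := hrel (coeff b u J) ((hcu J).of_le (one_le_two.trans ENat.LEInfty.out)) (hzu J)
    have h2 : ∀ z : s, ℓ (J, z) a = ∫ y in cube δ (z : Fin n → ℤ), coeff b u J y := fun z =>
      hℓ (J, z) φ hφ a ha
    simp only [h2]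
    rwa [← Finset.sum_coe_sort s] at h1
  refine hloc.trans ?_
  rw [integral_finsetSum _ fun J _ => hui J]
  have h3 := mul_le_mul_of_nonneg_left (Finset.sum_le_sum fun J (_ : J ∈ Finset.univ) => hJ J) hA'
  refine h3.trans ?_
  rw [Finset.sum_add_distrib, ← Finset.mul_sum, ← Finset.mul_sum, mul_add]
  refine add_le_add ?_ (le_of_eq ?_)
  · have h4 : A' * (ε' * ∑ J, ∫ y, ‖fderiv ℝ (coeff b u J) y‖ ^ 2) ≤
        A' * (ε' * (B ^ 2 * (A * sobSq φ))) := by gcongr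
    refine h4.trans ?_
    have h5 : A' * (ε' * (B ^ 2 * (A * sobSq φ))) = (A' * (B ^ 2 * A)) * ε' * sobSq φ := by ring
    rw [h5]
    refine mul_le_mul_of_nonneg_right ?_ (sobSq_nonneg φ)
    have h6 : (A' * (B ^ 2 * A) + 1) * ε' = ε := by
      rw [hε']; field_simp
    linarith
  · rw [Fintype.sum_prod_type]
    simp only [smul_apply, smul_eq_mul, mul_pow, Real.sq_sqrt (mul_nonneg hA' hc0),
      ← Finset.mul_sum]
    ring

/-- **Rellich's theorem** for test forms on a compact manifold. -/
theorem isCompactlyControlled_univ : IsCompactlyControlled n k Ω (univ : Set M) := by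
  refine isCompact_univ.induction_on (p := fun V => IsCompactlyControlled n k Ω V) ?_
    (fun s t hst ht => ht.mono hst) (fun s t hs ht => hs.union ht) fun x _ => ?_
  · intro ε hε
    refine ⟨Empty, inferInstance, Empty.elim, fun φ _ a _ => ?_⟩
    simp only [setIntegral_empty, Finset.univ_eq_empty, Finset.sum_empty, add_zero]
    exact mul_nonneg hε.le (sobSq_nonneg φ)
  · obtain ⟨V, hV, h⟩ := exists_isCompactlyControlled_nhds (n := n) (Ω := Ω) (k := k) x
    exact ⟨V, nhdsWithin_le_nhds hV, h⟩
end Functionals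
end KreinFeller

namespace KreinFeller

/-! ### From injectivity to a lower bound, by compactness. -/

section Abstract
variable {H H' F : Type*} [NormedAddCommGroup H] [NormedSpace ℝ H] [CompleteSpace H]
  [NormedAddCommGroup H'] [NormedSpace ℝ H'] [NormedAddCommGroup F] [NormedSpace ℝ F]
  [ProperSpace F]

/-- An injective bounded map which is bounded below up to a map of finite rank is bounded below. -/
theorem exists_le_mul_norm_of_injective (E : H →L[ℝ] H') (L : H →L[ℝ] F) {A : ℝ}
    (hA : ∀ w, ‖w‖ ≤ A * (‖E w‖ + ‖L w‖)) (hE : ∀ w, E w = 0 → w = 0) :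
    ∃ c > 0, ∀ w, ‖w‖ ≤ c * ‖E w‖ := by
  by_contra! hcon
  -- If there is no lower bound, some unit vectors have images under `E` tending to zero. Along a
  -- subsequence their images under `L` converge, since `F` is proper; then `hA` makes the
  -- subsequence Cauchy, and its limit is a unit vector killed by `E`.
  have h1 : ∀ m : ℕ, ∃ x : H, ‖x‖ = 1 ∧ ‖E x‖ ≤ 1 / ((m : ℝ) + 1) := by
    intro m
    obtain ⟨w, hw⟩ := hcon ((m : ℝ) + 1) (by positivity)
    have hw0 : 0 < ‖w‖ := lt_of_le_of_lt (by positivity) hw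
    refine ⟨‖w‖⁻¹ • w, ?_, ?_⟩
    · rw [norm_smul, norm_inv, norm_norm, inv_mul_cancel₀ hw0.ne']
    · rw [map_smul, norm_smul, norm_inv, norm_norm, le_div_iff₀ (by positivity),
        mul_assoc, inv_mul_le_iff₀ hw0]
      linarith
  choose x hx1 hxE using h1
  have hb : Bornology.IsBounded (range fun m => L (x m)) := by
    refine (isBounded_iff_forall_norm_le.2 ⟨‖L‖, ?_⟩)
    rintro _ ⟨m, rfl⟩
    simpa [hx1] using L.le_opNorm (x m)
  obtain ⟨y, -, σ, hσ, hy⟩ := tendsto_subseq_of_bounded hb fun m => mem_range_self m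
  have hE0 : Tendsto (fun m => E (x (σ m))) atTop (𝓝 0) :=
    squeeze_zero_norm (fun m => hxE (σ m))
      (tendsto_one_div_add_atTop_nhds_zero_nat.comp hσ.tendsto_atTop)
  have hc : CauchySeq (x ∘ σ) := by
    have h2 : Tendsto (fun p : ℕ × ℕ => A * (‖E (x (σ p.1)) - E (x (σ p.2))‖ +
        ‖L (x (σ p.1)) - L (x (σ p.2))‖)) atTop (𝓝 0) := by
      have e1 : Tendsto (fun p : ℕ × ℕ => ‖E (x (σ p.1)) - E (x (σ p.2))‖) atTop (𝓝 0) := by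
        simpa only [dist_eq_norm] using cauchySeq_iff_tendsto_dist_atTop_0.1 hE0.cauchySeq
      have e2 : Tendsto (fun p : ℕ × ℕ => ‖L (x (σ p.1)) - L (x (σ p.2))‖) atTop (𝓝 0) := by
        simpa only [dist_eq_norm, Function.comp_apply] using
          cauchySeq_iff_tendsto_dist_atTop_0.1 hy.cauchySeq
      simpa using (e1.add e2).const_mul A
    refine cauchySeq_iff_tendsto_dist_atTop_0.2 (squeeze_zero (fun _ => dist_nonneg)
      (fun p => ?_) h2)
    rw [dist_eq_norm, ← map_sub, ← map_sub]
    exact hA _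
  obtain ⟨z, hz⟩ := cauchySeq_tendsto_of_complete hc
  have hz1 : ‖z‖ = 1 := tendsto_nhds_unique hz.norm (by simp [hx1])
  have hzE : E z = 0 := tendsto_nhds_unique ((E.continuous.tendsto z).comp hz) hE0
  rw [hE z hzE, norm_zero] at hz1
  exact zero_ne_one hz1
end Abstract

/-! ### The Gårding inequality on the Sobolev space. -/

section Coercive
variable {n : ℕ} {M : Type*} [TopologicalSpace M] [ChartedSpace (EuclideanSpace ℝ (Fin n)) M]
  [IsManifold (𝓡 n) ∞ M] {k : ℕ}
  [RiemannianBundle (fun x : M => TangentSpace (𝓡 n) x)]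
  [IsContMDiffRiemannianBundle (𝓡 n) ∞ (EuclideanSpace ℝ (Fin n))
    (fun x : M => TangentSpace (𝓡 n) x)]
  [T2Space M] [CompactSpace M] [MeasurableSpace M] [BorelSpace M] {Ω : Set M}

/-- `adjD θ` is a chosen form known only through its integrals, so its locality has to be recovered:
off the support of `θ` it is orthogonal to every test form, hence zero in L². -/
theorem setIntegral_adjD_eq_zero {θ : Form n M (k + 1)} (hθ : IsSmoothForm θ) :
    ∫ p in (closure {x | θ x ≠ 0})ᶜ, formInner (adjD θ p) (adjD θ p) ∂(riemVol n M) = 0 := by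
  set U := (closure {x | θ x ≠ 0})ᶜ with hU
  have hUo : IsOpen U := isClosed_closure.isOpen_compl
  have hs := (isSmoothForm_adjD hθ).mem_sqIntegrable (ν := (riemVol n M).restrict U)
  have h0 : toL2 (adjD θ) hs = 0 := by
    refine eq_zero_of_inner_framePair hUo _ fun x₀ ρ v hρ h1 h2 p hp => ?_
    have ht : framePair x₀ ρ v ∈ testForms n U k := framePair_mem_testForms hρ.contMDiffOn h1 h2 v
    rw [(isClassOf_toL2 hs).inner_eq hp, integral_adjD_testForms ht hθ]
    refine setIntegral_eq_zero_of_forall_eq_zero fun y hy => ?_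
    have : θ y = 0 := by
      by_contra h; exact hy (subset_closure h)
    rw [this, formInner_zero_left]
  rw [← (isClassOf_toL2 hs).norm_sq_eq, h0, norm_zero, zero_pow two_ne_zero]

/-- Needed because `sobSq` integrates over `M` while the Sobolev norm integrates over `Ω`. -/
theorem integral_coD_le : ∀ {k : ℕ} {φ : Form n M k}, φ ∈ testForms n Ω k →
    ∫ p, formInner (coD φ p) (coD φ p) ∂(riemVol n M) ≤
      ∫ p in Ω, formInner (coD φ p) (coD φ p) ∂(riemVol n M)
  | 0, φ, _ => by
    have : ∀ p, formInner (coD φ p) (coD φ p) = 0 := fun p => formInner_zero_left _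
    simp [this]
  | k + 1, φ, hφ => by
    have hi : Integrable (fun p => formInner (adjD φ p) (adjD φ p)) (riemVol n M) :=
      integrable_formInner_self (isSmoothForm_adjD hφ.1)
    have hm : MeasurableSet (closure {x | φ x ≠ 0}) := isClosed_closure.measurableSet
    have h1 := integral_add_compl hm hi
    rw [setIntegral_adjD_eq_zero hφ.1, add_zero] at h1
    change ∫ p, formInner (adjD φ p) (adjD φ p) ∂(riemVol n M) ≤ _
    rw [← h1]
    exact setIntegral_mono_set hi.integrableOn
      (Eventually.of_forall fun p => formInner_self_nonneg _) hφ.2.2.eventuallyLE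

theorem energy_self (w : SobolevAmbient n Ω k) : energy w w = ‖w.snd‖ ^ 2 := by
  rw [WithLp.prod_norm_sq_eq_of_L2, energy, real_inner_self_eq_norm_sq,
    real_inner_self_eq_norm_sq]

theorem norm_sq_eq_add_energy (w : SobolevAmbient n Ω k) :
    ‖w‖ ^ 2 = ‖w.fst‖ ^ 2 + energy w w := by
  rw [energy_self, WithLp.prod_norm_sq_eq_of_L2]

theorem integral_testForms_eq {φ : Form n M k} (hφ : φ ∈ testForms n Ω k) :
    ∫ p, formInner (φ p) (φ p) ∂(riemVol n M) = ‖(testLift (Ω := Ω) φ hφ.1).fst‖ ^ 2 := by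
  rw [← setIntegral_testForms hφ]
  exact ((isClassOf_toL2 _).norm_sq_eq).symm

theorem sobSq_le_norm_sq {φ : Form n M k} (hφ : φ ∈ testForms n Ω k) :
    sobSq φ ≤ ‖testLift (Ω := Ω) φ hφ.1‖ ^ 2 := by
  have hs1 := isSmoothForm_extD hφ.1
  have hs2 := isSmoothForm_coD hφ.1
  have hd : ∫ p in Ω, formInner (extD φ p) (extD φ p) ∂(riemVol n M) =
      ∫ p, formInner (extD φ p) (extD φ p) ∂(riemVol n M) :=
    setIntegral_eq_integral_of_forall_compl_eq_zero fun p hp => by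
      rw [extD_eq_zero_of_notMem fun hc => hp (hφ.2.2 hc), formInner_zero_right]
  rw [norm_sq_eq_add_energy, energy_testLift, ← integral_testForms_eq hφ,
    integral_add (integrable_formInner_self hs1) (integrable_formInner_self hs2), hd, sobSq]
  linarith [integral_coD_le hφ]

/-- The Gårding inequality on `W^{1,2}_0`, with a remainder of finite rank. -/
theorem exists_norm_sq_le (hΩ : IsOpen Ω) : ∃ (κ : Type) (_ : Fintype κ)
    (ℓ : κ → L2Form n ((riemVol n M).restrict Ω) k →L[ℝ] ℝ), ∀ w ∈ sobolevZero n Ω k,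
      ‖w‖ ^ 2 ≤ 2 * (energy w w + ∑ i, ℓ i w.fst ^ 2) := by
  -- With the value 1/2, half of the squared Sobolev norm moves to the left-hand side, whence the
  -- factor 2.
  obtain ⟨κ, _, ℓ, hℓ⟩ := isCompactlyControlled_univ (n := n) (k := k) (Ω := Ω) (1 / 2) one_half_pos
  refine ⟨κ, inferInstance, ℓ, fun w hw => ?_⟩
  -- The inequality is a closed condition, so it needs to be checked on test forms only.
  have hcl : IsClosed {w : SobolevAmbient n Ω k |
      ‖w‖ ^ 2 ≤ 2 * (energy w w + ∑ i, ℓ i w.fst ^ 2)} := by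
    simp only [energy_self]
    have hf : Continuous fun w : SobolevAmbient n Ω k => w.fst :=
      (WithLp.prod_continuous_ofLp 2 _ _).fst
    have hs : Continuous fun w : SobolevAmbient n Ω k => w.snd :=
      (WithLp.prod_continuous_ofLp 2 _ _).snd
    exact isClosed_le (by fun_prop) (by fun_prop)
  refine closure_minimal ?_ hcl hw
  rintro w ⟨hw, φ, hφ, h⟩
  rw [mem_ofPred_eq]
  have e1 := hℓ φ hφ _ h
  have e2 := sobSq_le_norm_sq hφ
  rw [setIntegral_univ, integral_testForms_eq hφ] at e1
  rw [← eq_testLift hΩ hw hφ h] at e1 e2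
  linarith [norm_sq_eq_add_energy w]
end Coercive
end KreinFeller

namespace KreinFeller

/-- The Lax–Milgram theorem for the form `⟨E w, E v⟩`. -/
theorem exists_inner_eq {H H' : Type*} [NormedAddCommGroup H] [InnerProductSpace ℝ H]
    [CompleteSpace H] [NormedAddCommGroup H'] [InnerProductSpace ℝ H'] (E : H →L[ℝ] H') {c : ℝ}
    (hc : 0 < c) (hE : ∀ w, ‖w‖ ≤ c * ‖E w‖) (g : H →L[ℝ] ℝ) :
    ∃ w, ∀ v, inner ℝ (E w) (E v) = g v := by
  set B : H →L[ℝ] H →L[ℝ] ℝ := (innerSL ℝ).bilinearComp E E with hB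
  have hco : IsCoercive B := by
    refine ⟨(c ^ 2)⁻¹, by positivity, fun w => ?_⟩
    have h2 : B w w = ‖E w‖ ^ 2 := real_inner_self_eq_norm_sq _
    rw [h2, mul_assoc, inv_mul_le_iff₀ (by positivity), ← mul_pow, ← sq]
    exact pow_le_pow_left₀ (norm_nonneg _) (hE w) 2
  refine ⟨hco.continuousLinearEquivOfBilin.symm ((InnerProductSpace.toDual ℝ _).symm g),
    fun v => ?_⟩
  change B _ v = _
  rw [← hco.continuousLinearEquivOfBilin_apply, ContinuousLinearEquiv.apply_symm_apply,
    InnerProductSpace.toDual_symm_apply]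

/-! ### The map ι, coercivity of the energy, and solvability. -/

section Operator
variable {n : ℕ} {M : Type*} [TopologicalSpace M] [ChartedSpace (EuclideanSpace ℝ (Fin n)) M]
  [IsManifold (𝓡 n) ∞ M] {k : ℕ}
  [RiemannianBundle (fun x : M => TangentSpace (𝓡 n) x)]
  [IsContMDiffRiemannianBundle (𝓡 n) ∞ (EuclideanSpace ℝ (Fin n))
    (fun x : M => TangentSpace (𝓡 n) x)]
  [T2Space M] [CompactSpace M] [MeasurableSpace M] [BorelSpace M] {Ω : Set M}
  {μ : Measure M} {C : ℝ}

theorem continuous_sobolev_snd :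
    Continuous fun w : SobolevAmbient n Ω k => w.snd :=
  (WithLp.prod_continuous_ofLp 2 _ _).snd

theorem norm_snd_le (w : SobolevAmbient n Ω k) : ‖w.snd‖ ^ 2 ≤ ‖w‖ ^ 2 := by
  rw [norm_sq_eq_add_energy, energy_self]
  exact le_add_of_nonneg_left (sq_nonneg _)

/-- Both sides are continuous, so the inequality passes from test forms to the closure. It is the
only form in which the Poincaré inequality is used from here on. -/
theorem PoincareInequality.norm_sq_le_of_iotaGraph (h : PoincareInequality n μ Ω k C)
    (hΩ : IsOpen Ω) {z : SobolevAmbient n Ω k × L2Form n (μ.restrict Ω) k}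
    (hz : z ∈ iotaGraph n μ Ω k) : ‖z.2‖ ^ 2 ≤ C * energy z.1 z.1 := by
  have hcl : IsClosed {z : SobolevAmbient n Ω k × L2Form n (μ.restrict Ω) k |
      ‖z.2‖ ^ 2 ≤ C * energy z.1 z.1} := by
    simp only [energy_self]
    exact isClosed_le (by fun_prop)
      (((continuous_sobolev_snd.comp continuous_fst).norm.pow 2).const_mul C)
  exact closure_minimal (fun z hz => h.norm_sq_le hΩ hz) hcl hz

theorem PoincareInequality.eq_zero_of_mem_iotaGraph (h : PoincareInequality n μ Ω k C)
    (hΩ : IsOpen Ω) {w : SobolevAmbient n Ω k} {a : L2Form n (μ.restrict Ω) k}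
    (hz : (w, a) ∈ iotaGraph n μ Ω k) (hw : w.snd = 0) : a = 0 := by
  have h1 := h.norm_sq_le_of_iotaGraph hΩ hz
  rw [energy_self] at h1
  simp only [hw, norm_zero] at h1
  have h2 : ‖a‖ ^ 2 ≤ 0 := by simpa using h1
  exact norm_eq_zero.1 (pow_eq_zero_iff two_ne_zero |>.1 (le_antisymm h2 (sq_nonneg _)))

theorem isClosed_iotaGraph : IsClosed (iotaGraph n μ Ω k : Set (SobolevAmbient n Ω k ×
    L2Form n (μ.restrict Ω) k)) := Submodule.isClosed_topologicalClosure _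

theorem isClosed_sobolevZero : IsClosed (sobolevZero n Ω k : Set (SobolevAmbient n Ω k)) :=
  Submodule.isClosed_topologicalClosure _

theorem isClosed_nullSpace :
    IsClosed (nullSpace n μ Ω k : Set (SobolevAmbient n Ω k)) :=
  isClosed_sobolevZero.inter
    (isClosed_iotaGraph.preimage (continuous_id.prodMk continuous_const))

theorem isClosed_nullSpacePerp :
    IsClosed (nullSpacePerp n μ Ω k : Set (SobolevAmbient n Ω k)) :=
  isClosed_sobolevZero.inter (Submodule.isClosed_orthogonal _)

/-- Every element of `W^{1,2}_0` has a representative in `L²(μ)`. -/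
theorem PoincareInequality.exists_mem_iotaGraph [IsFiniteMeasure μ]
    (h : PoincareInequality n μ Ω k C) (hΩ : IsOpen Ω) {w : SobolevAmbient n Ω k}
    (hw : w ∈ sobolevZero n Ω k) : ∃ a, (w, a) ∈ iotaGraph n μ Ω k := by
  have hG : IsClosed (range fun z : iotaGraph n μ Ω k => z.1.1) := by
    -- The Poincaré inequality makes the projection of the graph to the Sobolev space antilipschitz,
    -- so its range is complete, hence closed, and it contains the test forms. The sign of `C` is
    -- not assumed, hence the absolute value.
    have : CompleteSpace (iotaGraph n μ Ω k) := isClosed_iotaGraph.completeSpace_coe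
    have hanti : AntilipschitzWith (1 + Real.toNNReal (√|C|))
        fun z : iotaGraph n μ Ω k => z.1.1 := by
      refine AntilipschitzWith.of_le_mul_dist fun z y => ?_
      have hzy : z.1 - y.1 ∈ iotaGraph n μ Ω k := sub_mem z.2 y.2
      have h1 := h.norm_sq_le_of_iotaGraph hΩ hzy
      have h2 : ‖z.1.2 - y.1.2‖ ≤ √|C| * ‖z.1.1 - y.1.1‖ := by
        refine le_of_sq_le_sq ?_ (by positivity)
        rw [mul_pow, Real.sq_sqrt (abs_nonneg _)]
        refine h1.trans ?_
        rw [energy_self]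
        exact (mul_le_mul_of_nonneg_right (le_abs_self C) (sq_nonneg _)).trans
          (mul_le_mul_of_nonneg_left (norm_snd_le _) (abs_nonneg _))
      rw [Subtype.dist_eq, Prod.dist_eq, dist_eq_norm, dist_eq_norm, NNReal.coe_add,
        NNReal.coe_one, Real.coe_toNNReal _ (Real.sqrt_nonneg _), add_mul, one_mul]
      exact max_le (le_add_of_nonneg_right (by positivity))
        (h2.trans (le_add_of_nonneg_left (norm_nonneg _)))
    have hu : UniformContinuous fun z : iotaGraph n μ Ω k => z.1.1 :=
      uniformContinuous_fst.comp uniformContinuous_subtype_val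
    exact (hanti.isComplete_range hu).isClosed
  have hsub : (sobolevTest n Ω k : Set (SobolevAmbient n Ω k)) ⊆
      range fun z : iotaGraph n μ Ω k => z.1.1 := fun v hv => by
    obtain ⟨a, ha⟩ := exists_mem_testGraph μ hv
    exact ⟨⟨(v, a), Submodule.le_topologicalClosure _ ha⟩, rfl⟩
  obtain ⟨⟨z, hz⟩, rfl⟩ := closure_minimal hsub hG hw
  exact ⟨z.2, hz⟩

/-- Such an element lies in the kernel of ι and in its orthogonal complement. -/
theorem eq_zero_of_mem_nullSpacePerp {w : SobolevAmbient n Ω k}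
    (hw : w ∈ nullSpacePerp n μ Ω k) (h0 : (w, (0 : L2Form n (μ.restrict Ω) k)) ∈
      iotaGraph n μ Ω k) : w = 0 :=
  inner_self_eq_zero (𝕜 := ℝ).1 (hw.2 w ⟨hw.1, h0⟩)

/-- Zero energy forces the representative in L²(μ) to vanish, so `w` belongs to the kernel of ι as
well as to its complement. Fields with vanishing `d` and `d*` are thus excluded without any
assumption on the topology. -/
theorem PoincareInequality.eq_zero_of_snd_eq_zero (h : PoincareInequality n μ Ω k C)
    (hΩ : IsOpen Ω) [IsFiniteMeasure μ] {w : SobolevAmbient n Ω k}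
    (hw : w ∈ nullSpacePerp n μ Ω k) (h0 : w.snd = 0) : w = 0 := by
  obtain ⟨a, ha⟩ := h.exists_mem_iotaGraph hΩ hw.1
  obtain rfl := h.eq_zero_of_mem_iotaGraph hΩ ha h0
  exact eq_zero_of_mem_nullSpacePerp hw ha

/-- The form `𝓔` is coercive on the orthogonal complement of the kernel of `ι`. -/
theorem PoincareInequality.exists_norm_le_mul_norm_snd (h : PoincareInequality n μ Ω k C)
    (hΩ : IsOpen Ω) [IsFiniteMeasure μ] :
    ∃ c > 0, ∀ w ∈ nullSpacePerp n μ Ω k, ‖w‖ ≤ c * ‖w.snd‖ := by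
  obtain ⟨κ, _, ℓ, hℓ⟩ := exists_norm_sq_le (n := n) (k := k) hΩ
  have : CompleteSpace (nullSpacePerp n μ Ω k) := isClosed_nullSpacePerp.completeSpace_coe
  set E := (WithLp.sndL 2 ℝ _ _).comp (nullSpacePerp n μ Ω k).subtypeL
  -- The functionals of `exists_norm_sq_le` are collected into one map to a Euclidean space, so that
  -- the sum of their squares is a squared norm.
  set L := (EuclideanSpace.equiv κ ℝ).symm.toContinuousLinearMap.comp
    (ContinuousLinearMap.pi fun i =>
      (ℓ i).comp ((WithLp.fstL 2 ℝ _ _).comp (nullSpacePerp n μ Ω k).subtypeL))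
  have hEL : ∀ w, ‖w‖ ≤ 2 * (‖E w‖ + ‖L w‖) := fun w => by
    have h1 := hℓ w.1 w.2.1
    have h2 : ‖L w‖ ^ 2 = ∑ i, ℓ i w.1.fst ^ 2 := by
      rw [EuclideanSpace.real_norm_sq_eq]; rfl
    rw [← h2, energy_self] at h1
    change ‖w.1‖ ≤ 2 * (‖w.1.snd‖ + ‖L w‖)
    refine le_of_sq_le_sq ?_ (by positivity)
    nlinarith [norm_nonneg w.1.snd, norm_nonneg (L w)]
  obtain ⟨c, hc, hcw⟩ := exists_le_mul_norm_of_injective E L hEL fun w hw =>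
    Subtype.ext (h.eq_zero_of_snd_eq_zero hΩ w.2 hw)
  exact ⟨c, hc, fun w hw => hcw ⟨w, hw⟩⟩

/-- The domain of `𝓔` is dense in `L²(μ)`. -/
theorem eq_zero_of_inner_nullSpacePerp (hΩ : IsOpen Ω) [IsFiniteMeasure μ]
    (a : L2Form n (μ.restrict Ω) k)
    (ha : ∀ v ∈ nullSpacePerp n μ Ω k, ∀ v', (v, v') ∈ iotaGraph n μ Ω k → inner ℝ a v' = 0) :
    a = 0 := by
  refine eq_zero_of_inner_testGraph hΩ a fun z hz => ?_
  have : CompleteSpace (nullSpace n μ Ω k) := isClosed_nullSpace.completeSpace_coe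
  have hz0 : z.1 ∈ sobolevZero n Ω k :=
    Submodule.le_topologicalClosure _ ⟨hz.1, by
      obtain ⟨φ, hφ, h, -⟩ := hz.2
      exact ⟨φ, hφ, h⟩⟩
  -- Subtracting the projection to the kernel of ι leaves the representative in L²(μ) unchanged, so
  -- the classes of test forms already lie in the domain of 𝓔.
  set p := (nullSpace n μ Ω k).starProjection z.1 with hp
  have hpN : p ∈ nullSpace n μ Ω k := Submodule.starProjection_apply_mem _ _
  refine ha (z.1 - p) ⟨sub_mem hz0 hpN.1, Submodule.sub_starProjection_mem_orthogonal _⟩ z.2 ?_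
  have h1 := sub_mem (Submodule.le_topologicalClosure _ hz) hpN.2
  rwa [show z - LinearMap.inl ℝ _ _ p = (z.1 - p, z.2) from
    Prod.ext rfl (sub_zero z.2)] at h1

/-- Single-valuedness, without which `toLinearPMap` need not have the given graph: `u = 0` gives `w
= 0`, so `f` is orthogonal to the dense domain of 𝓔. -/
theorem eq_zero_of_mem_laplacianGraph (hΩ : IsOpen Ω) [IsFiniteMeasure μ]
    (z : L2Form n (μ.restrict Ω) k × L2Form n (μ.restrict Ω) k)
    (hz : z ∈ laplacianGraph n μ Ω k) (h0 : z.1 = 0) : z.2 = 0 := by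
  obtain ⟨w, hw, hwz, hE⟩ := hz
  rw [h0] at hwz
  obtain rfl := eq_zero_of_mem_nullSpacePerp hw hwz
  refine eq_zero_of_inner_nullSpacePerp hΩ _ fun v hv v' hvv' => ?_
  have := hE v hv v' hvv'
  rw [inner_neg_left] at this
  simpa [energy] using this

/-- The operator is bounded below: `‖u‖ ≤ C ‖Δ_μ u‖`. -/
theorem PoincareInequality.norm_le_of_mem_laplacianGraph (h : PoincareInequality n μ Ω k C)
    (hΩ : IsOpen Ω) (hC : 0 < C) {u f : L2Form n (μ.restrict Ω) k}
    (hz : (u, f) ∈ laplacianGraph n μ Ω k) : ‖u‖ ≤ C * ‖f‖ := by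
  obtain ⟨w, hw, hwu, hE⟩ := hz
  have h1 := h.norm_sq_le_of_iotaGraph hΩ hwu
  have h2 : energy w w ≤ ‖f‖ * ‖u‖ := by
    rw [hE w hw u hwu]
    refine (real_inner_le_norm _ _).trans (le_of_eq ?_)
    rw [norm_neg]
  have h3 : ‖u‖ ^ 2 ≤ C * (‖f‖ * ‖u‖) := h1.trans (mul_le_mul_of_nonneg_left h2 hC.le)
  rcases (norm_nonneg u).eq_or_lt with h0 | h0
  · rw [← h0]; positivity
  · exact le_of_mul_le_mul_right (by nlinarith) h0

/-- Solvability of `Δ_μ u = f`. -/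
theorem PoincareInequality.exists_mem_laplacianGraph (h : PoincareInequality n μ Ω k C)
    (hΩ : IsOpen Ω) (hC : 0 < C) [IsFiniteMeasure μ] (f : L2Form n (μ.restrict Ω) k) :
    ∃ u, (u, f) ∈ laplacianGraph n μ Ω k := by
  obtain ⟨c, hc, hcoer⟩ := h.exists_norm_le_mul_norm_snd hΩ
  have : CompleteSpace (nullSpacePerp n μ Ω k) := isClosed_nullSpacePerp.completeSpace_coe
  -- The representatives are chosen one by one; uniqueness makes the resulting functional linear.
  choose ι hι using fun w : nullSpacePerp n μ Ω k => h.exists_mem_iotaGraph hΩ w.2.1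
  have huniq : ∀ {w : SobolevAmbient n Ω k} {a b : L2Form n (μ.restrict Ω) k},
      (w, a) ∈ iotaGraph n μ Ω k → (w, b) ∈ iotaGraph n μ Ω k → a = b := fun ha hb => by
    have hab := sub_mem ha hb
    rw [Prod.mk_sub_mk, sub_self] at hab
    exact sub_eq_zero.1 (h.eq_zero_of_mem_iotaGraph hΩ hab rfl)
  set g : nullSpacePerp n μ Ω k →ₗ[ℝ] ℝ :=
    { toFun := fun w => inner ℝ (-f) (ι w)
      map_add' := fun w v => by
        rw [← inner_add_right, huniq (hι (w + v)) (add_mem (hι w) (hι v))]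
      map_smul' := fun r w => by
        rw [RingHom.id_apply, smul_eq_mul, ← real_inner_smul_right,
          huniq (hι (r • w)) (Submodule.smul_mem _ r (hι w))] } with hg
  have hgb : ∀ w, ‖g w‖ ≤ ‖f‖ * √C * ‖w‖ := fun w => by
    refine (abs_real_inner_le_norm (-f) (ι w)).trans ?_
    rw [norm_neg, mul_assoc]
    refine mul_le_mul_of_nonneg_left (le_of_sq_le_sq ?_ (by positivity)) (norm_nonneg _)
    rw [mul_pow, Real.sq_sqrt hC.le]
    refine (h.norm_sq_le_of_iotaGraph hΩ (hι w)).trans (mul_le_mul_of_nonneg_left ?_ hC.le)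
    rw [energy_self]
    exact norm_snd_le _
  set E : nullSpacePerp n μ Ω k →L[ℝ]
      WithLp 2 (L2Form n ((riemVol n M).restrict Ω) (k + 1) ×
        L2Form n ((riemVol n M).restrict Ω) (k - 1)) :=
    (WithLp.sndL 2 ℝ _ _).comp (nullSpacePerp n μ Ω k).subtypeL with hE
  obtain ⟨w, hw⟩ := exists_inner_eq E hc (fun w : nullSpacePerp n μ Ω k => hcoer w.1 w.2) (g.mkContinuous _ hgb)
  refine ⟨ι w, w, w.2, hι w, fun v hv v' hvv' => ?_⟩
  rw [huniq hvv' (hι ⟨v, hv⟩)]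
  -- The energy is the inner product of the second components, which is the form that Lax–Milgram
  -- was applied to.
  exact (WithLp.prod_inner_apply _ _).symm.trans (hw ⟨v, hv⟩)

theorem mem_laplacianGraph_iff (hΩ : IsOpen Ω) [IsFiniteMeasure μ] {u f : L2Form n (μ.restrict Ω) k} :
    (u, f) ∈ laplacianGraph n μ Ω k ↔
      ∃ hu : u ∈ (laplacian n μ Ω k).domain, laplacian n μ Ω k ⟨u, hu⟩ = f := by
  have hgr : (laplacian n μ Ω k).graph = laplacianGraph n μ Ω k :=
    Submodule.toLinearPMap_graph_eq _ (eq_zero_of_mem_laplacianGraph hΩ)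
  rw [← hgr, LinearPMap.mem_graph_iff]
  exact ⟨fun ⟨⟨y, hy⟩, h1, h2⟩ => by cases h1; exact ⟨hy, h2⟩, fun ⟨hu, h1⟩ => ⟨⟨u, hu⟩, rfl, h1⟩⟩
end Operator
end KreinFeller

/-! ### The main theorem. -/

theorem theorem2p5 {n : ℕ} {M : Type*} [TopologicalSpace M] [T2Space M] [CompactSpace M]
    [ChartedSpace (EuclideanSpace ℝ (Fin n)) M] [IsManifold (𝓡 n) ∞ M]
    [RiemannianBundle (fun x : M => TangentSpace (𝓡 n) x)]
    [IsContMDiffRiemannianBundle (𝓡 n) ∞ (EuclideanSpace ℝ (Fin n))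
      (fun x : M => TangentSpace (𝓡 n) x)]
    [MeasurableSpace M] [BorelSpace M]
    (Ω : Set M) (hΩ : IsOpen Ω)
    (μ : Measure M) [IsFiniteMeasure μ] (hsupp : μ.support ⊆ closure Ω) (hpos : 0 < μ Ω)
    (k : ℕ) (hk : k ≤ n) (C : ℝ) (hC : 0 < C) (hPI : PoincareInequality n μ Ω k C) :
    (∀ f : L2Form n (μ.restrict Ω) k, ∃! u : (laplacian n μ Ω k).domain,
        laplacian n μ Ω k u = f) ∧
      ∃ T : L2Form n (μ.restrict Ω) k →L[ℝ] L2Form n (μ.restrict Ω) k,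
        (∀ f, ∃ h : T f ∈ (laplacian n μ Ω k).domain, laplacian n μ Ω k ⟨T f, h⟩ = f) ∧
        ‖T‖ ≤ C := by
  -- The a priori bound applied to the pair `(u - u', 0)`. It also makes the pointwise choice of
  -- solutions linear, since the graph is a subspace.
  have huniq : ∀ {u u' f : L2Form n (μ.restrict Ω) k}, (u, f) ∈ laplacianGraph n μ Ω k →
      (u', f) ∈ laplacianGraph n μ Ω k → u = u' := fun hu hu' => by
    have hd := sub_mem hu hu'
    rw [Prod.mk_sub_mk, sub_self] at hd
    have := hPI.norm_le_of_mem_laplacianGraph hΩ hC hd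
    rw [norm_zero, mul_zero] at this
    exact sub_eq_zero.1 (norm_le_zero_iff.1 this)
  choose T hT using hPI.exists_mem_laplacianGraph hΩ hC
  refine ⟨fun f => ?_, ?_⟩
  · obtain ⟨hu, huf⟩ := (mem_laplacianGraph_iff hΩ).1 (hT f)
    refine ⟨⟨T f, hu⟩, huf, fun v hv => Subtype.ext ?_⟩
    exact huniq ((mem_laplacianGraph_iff hΩ).2 ⟨v.2, hv⟩) (hT f)
  · let S : L2Form n (μ.restrict Ω) k →ₗ[ℝ] L2Form n (μ.restrict Ω) k :=
      { toFun := T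
        map_add' := fun f g => huniq (hT (f + g)) (add_mem (hT f) (hT g))
        map_smul' := fun c f => huniq (hT (c • f)) (Submodule.smul_mem _ c (hT f)) }
    exact ⟨S.mkContinuous C fun f => hPI.norm_le_of_mem_laplacianGraph hΩ hC (hT f),
      fun f => (mem_laplacianGraph_iff hΩ).1 (hT f), S.mkContinuous_norm_le hC.le _⟩
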